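/- Let $\mathds{k}$ be a commutative unital ring. *The category $\mathsf{gr}^{\mathsf{op}}$.* Objects are $n\in\mathbb{N}$; a morphism $n\to m$ is a group homomorphism $F_m\to F_n$ between free groups on $x_1,\dots,x_m$ and $x_1,\dots,x_n$. A $\mathsf{gr}^{\mathsf{op}}$-module is a functor $F$ from $\mathsf{gr}^{\mathsf{op}}$ to $\mathds{k}$-modules. For elements $w_1,\dots,w_m\in F_n$ write $[w_1|\cdots|w_m]:n\to m$ for the morphism given by $x_j\mapsto w_j$. *The bimodule.* Let $A_n=\mathds{k}\langle x_1,\dots,x_n\rangle$ be the free associative algebra, a cocommutative Hopf algebra with every $x_i$ primitive. As for any cocommutative Hopf algebra, $m\mapsto A_n^{\otimes m}$ is a $\mathsf{gr}^{\mathsf{op}}$-module: $[w_1|\cdots|w_l]:m\to l$ acts by $h_1\otimes\cdots\otimes h_m\mapsto v_1\otimes\cdots\otimes v_l$, where $v_j$ is obtained from the word $w_j$ by replacing the occurrences of $x_i$ (resp. $x_i^{-1}$) in $w_1,\dots,w_l$ by the successive components (resp. their antipodes) of the iterated coproduct of $h_i$ (the counit of $h_i$ if $x_i$ does not occur). The words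 $w_1\otimes\cdots\otimes w_m$ in which each of $x_1,\dots,x_n$ occurs exactly once in total span a $\mathds{k}$-submodule ${}_\Delta\mathsf{Cat}_{\mathfrak{Ass}^u}(n,m)\subset A_n^{\otimes m}$, and ${}_\Delta\mathsf{Cat}_{\mathfrak{Ass}^u}(n,-)$ is a $\mathsf{gr}^{\mathsf{op}}$-submodule. *The category $\mathsf{Cat}_{\mathfrak{Lie}}$.* It is the $\mathds{k}$-linear category with objects $n\in\mathbb{N}$ and $\mathsf{Cat}_{\mathfrak{Lie}}(n,m)=\bigoplus_{f:\{1,\dots,n\}\to\{1,\dots,m\}}\bigotimes_{j=1}^m\mathfrak{Lie}(f^{-1}(j))$, where $\mathfrak{Lie}(S)$ is the part of the free Lie $\mathds{k}$-algebra on $\{x_i\}_{i\in S}$ spanned by the iterated brackets in which each variable occurs exactly once (so $\mathfrak{Lie}(\emptyset)=0$); composition is by substitution. An element $p_1\otimes\cdots\otimes p_m$ of $\mathsf{Cat}_{\mathfrak{Lie}}(n,m)$ acts on the right on ${}_\Delta\mathsf{Cat}_{\mathfrak{Ass}^u}$, as a map ${}_\Delta\mathsf{Cat}_{\mathfrak{Ass}^u}(m,l)\to{}_\Delta\mathsf{Cat}_{\mathfrak{Ass}^u}(n,l)$,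 by substituting for $x_j$ the image of $p_j$ in $A_n$, where brackets become commutators. This action commutes with $\mathsf{gr}^{\mathsf{op}}$, so ${}_\Delta\mathsf{Cat}_{\mathfrak{Ass}^u}$ is a bimodule, and for every $\mathsf{gr}^{\mathsf{op}}$-module $F$, $n\mapsto\mathrm{Nat}({}_\Delta\mathsf{Cat}_{\mathfrak{Ass}^u}(n,-),F)$ is a (left) $\mathsf{Cat}_{\mathfrak{Lie}}$-module, i.e. a $\mathds{k}$-linear functor from $\mathsf{Cat}_{\mathfrak{Lie}}$ to $\mathds{k}$-modules. *The primitive part.* For a $\mathsf{gr}^{\mathsf{op}}$-module $G$ let $\mathrm{cr}^1(G)(X)\subset G(X)$ be the image of $\mathrm{id}-G(0_X)$, where $0_X:X\to X$ is the trivial morphism, and let $P_1(G)(X)$ be the kernel of the composite of $G(X)\to G(X\times X)$, induced by the diagonal, with $(\mathrm{id}-G(0_X\times\mathrm{id}))\circ(\mathrm{id}-G(\mathrm{id}\times 0_X))$. The primitive part of $F$ is $$\mathcal{P}(F)(n)=\bigcap_{a+1+b=n}P_1\big(\mathrm{cr}^1(F(a+(-)+b))\big)(1)\ \subset\ F(n),$$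 the intersection over all $a,b\in\mathbb{N}$ with $a+1+b=n$ (so $\mathcal{P}(F)(0)=F(0)$), where $F(a+(-)+b)$ is the $\mathsf{gr}^{\mathsf{op}}$-module $Y\mapsto F(a+Y+b)$. It is a $\mathsf{Cat}_{\mathfrak{Lie}}$-module: $p_1\otimes\cdots\otimes p_m\in\mathsf{Cat}_{\mathfrak{Lie}}(n,m)$ is sent to its image in $A_n^{\otimes m}$, and a linear combination of tensors of words $w_1\otimes\cdots\otimes w_m$ acts as the corresponding linear combination of the maps $F([w_1|\cdots|w_m]):F(n)\to F(m)$. This defines a functor $\mathcal{P}$ from $\mathsf{gr}^{\mathsf{op}}$-modules to $\mathsf{Cat}_{\mathfrak{Lie}}$-modules. **Theorem.** For every $\mathsf{gr}^{\mathsf{op}}$-module $F$ and every $n\in\mathbb{N}$, the evaluation $\xi\mapsto\xi(x_1\otimes\cdots\otimes x_n)$ takes values in $\mathcal{P}(F)(n)$ and is an isomorphism of $\mathds{k}$-modules $$\mathrm{Nat}\big({}_\Delta\mathsf{Cat}_{\mathfrak{Ass}^u}(n,-),F\big)\;\cong\;\mathcal{P}(F)(n),$$ natural in $n\in\mathsf{Cat}_{\mathfrak{Lie}}$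 and in $F$. So the bimodule ${}_\Delta\mathsf{Cat}_{\mathfrak{Ass}^u}$ represents the functor $\mathcal{P}$ from $\mathsf{gr}^{\mathsf{op}}$-modules to $\mathsf{Cat}_{\mathfrak{Lie}}$-modules. -/

import Mathlib

universe u

open CategoryTheory

noncomputable section

namespace PrimPart

open scoped TensorProduct
open Coalgebra Bialgebra HopfAlgebra WithConv CategoryTheory


section FreeHopf
variable (k : Type u) [CommRing k] (X : Type)

def freeComul : FreeAlgebra k X →ₐ[k] FreeAlgebra k X ⊗[k] FreeAlgebra k X :=
  FreeAlgebra.lift k fun x => FreeAlgebra.ι k x ⊗ₜ 1 + 1 ⊗ₜ FreeAlgebra.ι k x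

def freeCounit : FreeAlgebra k X →ₐ[k] k := FreeAlgebra.lift k fun _ => 0

def freeAntipodeOp : FreeAlgebra k X →ₐ[k] (FreeAlgebra k X)ᵐᵒᵖ :=
  FreeAlgebra.lift k fun x => MulOpposite.op (-FreeAlgebra.ι k x)

def freeAntipode : FreeAlgebra k X →ₗ[k] FreeAlgebra k X :=
  (MulOpposite.opLinearEquiv k).symm.toLinearMap ∘ₗ (freeAntipodeOp k X).toLinearMap

instance freeBialgebra : Bialgebra k (FreeAlgebra k X) :=
  Bialgebra.ofAlgHom (freeComul k X) (freeCounit k X)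
    (by ext x
        simp [freeComul, TensorProduct.add_tmul, TensorProduct.tmul_add, add_assoc,
          Algebra.TensorProduct.one_def])
    (by ext x; simp [freeComul, freeCounit])
    (by ext x; simp [freeComul, freeCounit])

variable {k X}
@[simp] lemma comul_ι (x : X) : comul (R := k) (FreeAlgebra.ι k x) =
    FreeAlgebra.ι k x ⊗ₜ[k] 1 + 1 ⊗ₜ[k] FreeAlgebra.ι k x := by
  change freeComul k X _ = _
  simp [freeComul]

@[simp] lemma counit_ι (x : X) : counit (R := k) (FreeAlgebra.ι k x) = 0 := by
  change freeCounit k X _ = _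
  simp [freeCounit]

@[simp] lemma freeAntipode_ι (x : X) :
    freeAntipode k X (FreeAlgebra.ι k x) = -FreeAlgebra.ι k x := by
  simp [freeAntipode, freeAntipodeOp]

lemma freeAntipode_mul (a b : FreeAlgebra k X) :
    freeAntipode k X (a * b) = freeAntipode k X b * freeAntipode k X a := by
  simp [freeAntipode]

@[simp] lemma freeAntipode_one : freeAntipode k X 1 = 1 := by
  simp [freeAntipode]

instance freeHopf : HopfAlgebra k (FreeAlgebra k X) where
  antipode := freeAntipode k X
  mul_antipode_rTensor_comul := by
    set T := LinearMap.mul' k (FreeAlgebra k X) ∘ₗ (freeAntipode k X).rTensor _ with hT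
    have key : ∀ (u v : FreeAlgebra k X ⊗[k] FreeAlgebra k X) (c : k), T u = algebraMap _ _ c →
        T (u * v) = c • T v := by
      intro u v c hu
      induction v with
      | zero => simp
      | add v w hv hw => rw [mul_add, map_add, hv, hw, map_add, smul_add]
      | tmul v w =>
        have : T (u * v ⊗ₜ w) = freeAntipode k X v * T u * w := by
          clear hu
          induction u with
          | zero => simp
          | add a b ha hb => simp only [add_mul, map_add, mul_add, ha, hb]
          | tmul a b => simp [hT, freeAntipode_mul, mul_assoc]
        rw [this, hu, ← Algebra.commutes, mul_assoc, ← Algebra.smul_def]; simp [hT]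
    refine LinearMap.ext fun a => ?_
    change T (comul a) = algebraMap k _ (counit (R := k) a)
    induction a with
    | grade0 r => simp [hT, Algebra.TensorProduct.one_def, Algebra.algebraMap_eq_smul_one]
    | grade1 x => simp [hT]
    | mul a b ha hb => rw [Bialgebra.comul_mul, key _ _ _ ha, hb]; simp [Algebra.smul_def]
    | add a b ha hb => simp only [map_add, ha, hb]
  mul_antipode_lTensor_comul := by
    set T := LinearMap.mul' k (FreeAlgebra k X) ∘ₗ (freeAntipode k X).lTensor _ with hT
    have key : ∀ (u v : FreeAlgebra k X ⊗[k] FreeAlgebra k X) (c : k), T v = algebraMap _ _ c →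
        T (u * v) = c • T u := by
      intro u v c hu
      induction u with
      | zero => simp
      | add v w hv hw => rw [add_mul, map_add, hv, hw, map_add, smul_add]
      | tmul a b =>
        have : T (a ⊗ₜ b * v) = a * T v * freeAntipode k X b := by
          clear hu
          induction v with
          | zero => simp
          | add a b ha hb => simp only [add_mul, map_add, mul_add, ha, hb]
          | tmul a b => simp [hT, freeAntipode_mul, mul_assoc]
        rw [this, hu, ← Algebra.commutes, mul_assoc, ← Algebra.smul_def]; simp [hT]
    refine LinearMap.ext fun a => ?_
    change T (comul a) = algebraMap k _ (counit (R := k) a)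
    induction a with
    | grade0 r => simp [hT, Algebra.TensorProduct.one_def, Algebra.algebraMap_eq_smul_one]
    | grade1 x => simp [hT]
    | mul a b ha hb => rw [Bialgebra.comul_mul, key _ _ _ hb, ha, Bialgebra.counit_mul, mul_comm]; simp [Algebra.smul_def]
    | add a b ha hb => simp only [map_add, ha, hb]

instance freeCocomm : IsCocomm k (FreeAlgebra k X) where
  comm_comp_comul := by
    have : (Algebra.TensorProduct.comm k _ _).toAlgHom.comp (freeComul k X) = freeComul k X := by
      ext x; simp [freeComul, add_comm]
    exact congr(($this).toLinearMap)

end FreeHopf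

lemma prod_ofFn_mul {M : Type u} [Monoid M] : ∀ {m : ℕ} (x y : Fin m → M),
    (∀ i j, i ≠ j → Commute (x i) (y j)) →
    (List.ofFn fun i => x i * y i).prod = (List.ofFn x).prod * (List.ofFn y).prod
  | 0, _, _, _ => by simp
  | m + 1, x, y, h => by
    have ih := prod_ofFn_mul (fun i => x i.succ) (fun i => y i.succ)
      fun i j hij => h _ _ (by simpa using hij)
    have hc : Commute (List.ofFn fun i => x i.succ).prod (y 0) := by
      refine Commute.list_prod_left _ _ fun z hz => ?_
      obtain ⟨i, rfl⟩ := (List.mem_ofFn' _ _).1 hz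
      exact h _ _ (Fin.succ_ne_zero i)
    simp only [List.ofFn_succ, List.prod_cons]
    rw [ih, mul_assoc, mul_assoc, ← mul_assoc (y 0), ← hc.eq, mul_assoc]

lemma prod_ofFn_eq {M : Type u} [Monoid M] : ∀ {m : ℕ} (x : Fin m → M) (i : Fin m),
    (∀ j, j ≠ i → x j = 1) → (List.ofFn x).prod = x i
  | 0, _, i, _ => i.elim0
  | m + 1, x, i, h => by
    rw [List.ofFn_succ, List.prod_cons]
    refine Fin.cases (fun h => ?_) (fun i h => ?_) i h
    · have : (fun i : Fin m => x i.succ) = fun _ => 1 := by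
        funext j; exact h _ (Fin.succ_ne_zero j)
      simp [this]
    · rw [h 0 (Fin.succ_ne_zero i).symm, one_mul]
      exact prod_ofFn_eq (fun i => x i.succ) i fun j hj => h _ (by simpa using hj)

/-- The tensor power `H^{⊗ m}`. -/
def TPow (k : Type u) [CommRing k] (H : Type u) [Ring H] [Algebra k H] (m : ℕ) : Type u :=
  PiTensorProduct k fun _ : Fin m => H

namespace TPow

instance (k : Type u) [CommRing k] (H : Type u) [Ring H] [Algebra k H] (m : ℕ) :
    Ring (TPow k H m) :=
  inferInstanceAs (Ring (PiTensorProduct k fun _ : Fin m => H))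

instance (k : Type u) [CommRing k] (H : Type u) [Ring H] [Algebra k H] (m : ℕ) :
    Algebra k (TPow k H m) :=
  inferInstanceAs (Algebra k (PiTensorProduct k fun _ : Fin m => H))

section Lift
variable {k : Type u} [CommRing k] {H : Type u} [Ring H] [Algebra k H] {m : ℕ}
  {S : Type u} [Ring S] [Algebra k S]

variable (k) in
/-- The pure tensor `h₁ ⊗ ⋯ ⊗ h_m`. -/
def tprod : MultilinearMap k (fun _ : Fin m => H) (TPow k H m) :=
  PiTensorProduct.tprod k

/-- The inclusion `h ↦ 1 ⊗ ⋯ ⊗ h ⊗ ⋯ ⊗ 1` of the `j`-th tensor factor. -/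
def single (j : Fin m) : H →ₐ[k] TPow k H m :=
  PiTensorProduct.singleAlgHom (R := k) (A := fun _ : Fin m => H) j

/-- Algebra maps with commuting images induce an algebra map
`h₁ ⊗ ⋯ ⊗ h_m ↦ g₁ h₁ ⋯ g_m h_m` on the tensor power. -/
def lift (g : Fin m → H →ₐ[k] S) (hg : ∀ i j, i ≠ j → ∀ a b, Commute (g i a) (g j b)) :
    TPow k H m →ₐ[k] S :=
  PiTensorProduct.liftAlgHom
    ((MultilinearMap.mkPiAlgebraFin k m S).compLinearMap fun j => (g j).toLinearMap)
    (by simp)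
    (fun x y => by
      simp only [MultilinearMap.compLinearMap_apply, MultilinearMap.mkPiAlgebraFin_apply,
        Pi.mul_apply, AlgHom.toLinearMap_apply, map_mul]
      exact prod_ofFn_mul _ _ fun i j hij => hg i j hij _ _)

lemma single_apply (j : Fin m) (h : H) : single (k := k) j h =
    tprod k (Pi.mulSingle j h) := rfl

lemma lift_tprod (g : Fin m → H →ₐ[k] S) (hg) (x : Fin m → H) :
    lift g hg (tprod k x) = (List.ofFn fun j => g j (x j)).prod :=
  (PiTensorProduct.lift.tprod _).trans (by simp)

@[simp] lemma lift_single (g : Fin m → H →ₐ[k] S) (hg) (j : Fin m) (h : H) :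
    lift g hg (single j h) = g j h := by
  rw [single_apply, lift_tprod, prod_ofFn_eq _ j, Pi.mulSingle_eq_same]
  intro i hi
  rw [Pi.mulSingle_eq_of_ne hi, map_one]

lemma hom_ext {f g : TPow k H m →ₐ[k] S} (h : ∀ j a, f (single j a) = g (single j a)) : f = g :=
  PiTensorProduct.algHom_ext fun j => AlgHom.ext fun a => h j a

lemma single_commute {i j : Fin m} (hij : i ≠ j) (a b : H) :
    Commute (single (k := k) i a) (single j b) :=
  Commute.tprod (Pi.mulSingle_commute (f := fun _ : Fin m => H) hij a b)

/-- The tensor power `g^{⊗ m}` of an algebra map. -/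
def map {H' : Type u} [Ring H'] [Algebra k H'] (m : ℕ) (g : H →ₐ[k] H') :
    TPow k H m →ₐ[k] TPow k H' m :=
  lift (fun j => (single j).comp g) fun _ _ hij _ _ => single_commute hij _ _

@[simp] lemma map_single {H' : Type u} [Ring H'] [Algebra k H'] (g : H →ₐ[k] H') (j : Fin m)
    (a : H) : map m g (single j a) = single j (g a) := lift_single _ _ _ _

end Lift

section Bialg
variable (k : Type u) [CommRing k] (H : Type u) [Ring H] [Bialgebra k H] (m : ℕ)

/-- The comultiplication of `H^{⊗ m}`, which is that of `H` on each tensor factor. -/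
def comulHom : TPow k H m →ₐ[k] TPow k H m ⊗[k] TPow k H m :=
  lift (fun j => (Algebra.TensorProduct.map (single j) (single j)).comp (comulAlgHom k H))
    fun i j hij a b => by
      simp only [AlgHom.comp_apply]
      generalize (comulAlgHom k H) a = s
      generalize (comulAlgHom k H) b = t
      induction s with
      | zero => simp
      | add x y hx hy => rw [map_add]; exact hx.add_left hy
      | tmul x y =>
        induction t with
        | zero => simp
        | add x y hx hy => rw [map_add]; exact hx.add_right hy
        | tmul z w =>
          simp only [Algebra.TensorProduct.map_tmul, commute_iff_eq,
            Algebra.TensorProduct.tmul_mul_tmul, (single_commute hij _ _).eq]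

/-- The counit of `H^{⊗ m}`. -/
def counitHom : TPow k H m →ₐ[k] k :=
  lift (fun _ => counitAlgHom k H) fun _ _ _ _ _ => Commute.all _ _

/-- The tensor power bialgebra. -/
instance bialgebra : Bialgebra k (TPow k H m) :=
  Bialgebra.ofAlgHom (comulHom k H m) (counitHom k H m)
    (hom_ext fun j a => by
      have h := congr(Algebra.TensorProduct.map (single (k := k) j)
        (Algebra.TensorProduct.map (single (k := k) j) (single (m := m) j))
        $(Coalgebra.coassoc_apply (R := k) a))
      simp only [AlgHom.comp_apply, comulHom, lift_single]
      convert h using 1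
      · simp only [comulAlgHom_apply]
        generalize comul (R := k) a = s
        induction s with
        | zero => simp
        | add x y hx hy => simp only [map_add, hx, hy]
        | tmul x y =>
          simp only [Algebra.TensorProduct.map_tmul, lift_single, AlgHom.comp_apply,
            comulAlgHom_apply, AlgHom.id_apply, LinearMap.rTensor_tmul]
          generalize comul (R := k) x = s
          induction s with
          | zero => simp
          | add x y hx hy => simp only [map_add, TensorProduct.add_tmul, hx, hy]
          | tmul x y => simp
      · simp only [comulAlgHom_apply]
        generalize comul (R := k) a = s
        induction s with
        | zero => simp
        | add x y hx hy => simp only [map_add, hx, hy]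
        | tmul x y => simp)
    (hom_ext fun j a => by
      have h := congr(Algebra.TensorProduct.map (AlgHom.id k k) (single (m := m) (k := k) j)
        $(Coalgebra.rTensor_counit_comul (R := k) a))
      simp only [AlgHom.comp_apply, comulHom, lift_single]
      convert h using 1
      · simp only [comulAlgHom_apply]
        generalize comul (R := k) a = s
        induction s with
        | zero => simp
        | add x y hx hy => simp only [map_add, hx, hy]
        | tmul x y => simp [counitHom]
      · simp)
    (hom_ext fun j a => by
      have h := congr(Algebra.TensorProduct.map (single (m := m) (k := k) j) (AlgHom.id k k)
        $(Coalgebra.lTensor_counit_comul (R := k) a))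
      simp only [AlgHom.comp_apply, comulHom, lift_single]
      convert h using 1
      · simp only [comulAlgHom_apply]
        generalize comul (R := k) a = s
        induction s with
        | zero => simp
        | add x y hx hy => simp only [map_add, hx, hy]
        | tmul x y => simp [counitHom]
      · simp)

variable {k H m}

lemma comul_single (j : Fin m) (a : H) : comul (R := k) (single (k := k) j a) =
    Algebra.TensorProduct.map (single j) (single j) (comul (R := k) a) := by
  change comulHom k H m (single j a) = _
  simp [comulHom]

lemma counit_single (j : Fin m) (a : H) :
    counit (R := k) (single (k := k) j a) = counit (R := k) a := by
  change counitHom k H m (single j a) = _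
  simp [counitHom]

instance cocomm [IsCocomm k H] : IsCocomm k (TPow k H m) where
  comm_comp_comul := by
    have : (Algebra.TensorProduct.comm k _ _).toAlgHom.comp (comulHom k H m) = comulHom k H m := by
      refine hom_ext fun j a => ?_
      have h := congr(Algebra.TensorProduct.map (single (k := k) j) (single (m := m) (k := k) j)
        $(Coalgebra.comm_comul k a))
      simp only [AlgHom.comp_apply, comulHom, lift_single]
      refine Eq.trans ?_ h
      simp only [comulAlgHom_apply]
      generalize comul (R := k) a = s
      induction s with
      | zero => simp
      | add x y hx hy => simp only [map_add, hx, hy]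
      | tmul x y => simp
    exact congr(($this).toLinearMap)

/-- The projection `h₁ ⊗ ⋯ ⊗ h_m ↦ ε(h₁) ⋯ h_i ⋯ ε(h_m)` to the `i`-th tensor factor. -/
def proj (i : Fin m) : TPow k H m →ₐ[k] H :=
  lift (fun j => if j = i then AlgHom.id k H else (Algebra.ofId k H).comp (counitAlgHom k H))
    fun a b hab x y => by
      by_cases ha : a = i
      · rw [if_neg (show b ≠ i from fun hb => hab (ha.trans hb.symm))]
        exact Algebra.commute_algebraMap_right _ _
      · rw [if_neg ha]
        exact Algebra.commute_algebraMap_left _ _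

@[simp] lemma proj_single_same (i : Fin m) (a : H) : proj (k := k) i (single i a) = a := by
  simp [proj]

lemma proj_single_ne {i j : Fin m} (h : j ≠ i) (a : H) :
    proj (k := k) i (single j a) = algebraMap k H (counit (R := k) a) := by
  simp [proj, h, Algebra.ofId_apply]

end Bialg
end TPow

section Conv
variable {k : Type u} [CommRing k]

/-- Postcomposition with an algebra map, as a map of convolution monoids. -/
def convPost {C A B : Type u} [AddCommGroup C] [Module k C] [Coalgebra k C] [Ring A] [Algebra k A]
    [Ring B] [Algebra k B] (h : A →ₐ[k] B) : WithConv (C →ₗ[k] A) →* WithConv (C →ₗ[k] B) where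
  toFun f := toConv (h.toLinearMap ∘ₗ f.ofConv)
  map_one' := by
    ext c; simp [LinearMap.convOne_def]
  map_mul' f g := congrArg toConv (LinearMap.algHom_comp_convMul_distrib h f g)

/-- Precomposition with a coalgebra map, as a map of convolution monoids. -/
def convPre {C D A : Type u} [AddCommGroup C] [Module k C] [Coalgebra k C] [AddCommGroup D]
    [Module k D] [Coalgebra k D] [Ring A] [Algebra k A] (h : D →ₗc[k] C) :
    WithConv (C →ₗ[k] A) →* WithConv (D →ₗ[k] A) where
  toFun f := toConv (f.ofConv ∘ₗ h.toLinearMap)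
  map_one' := by
    ext c; simp [LinearMap.convOne_def]
  map_mul' f g := congrArg toConv (LinearMap.convMul_comp_coalgHom_distrib f g h)

/-- The convolution monoid homomorphism conditions for a coalgebra map. -/
def IsCoalgConv {C B : Type u} [AddCommGroup C] [Module k C] [Coalgebra k C] [Ring B] [Bialgebra k B]
    (f : WithConv (C →ₗ[k] B)) : Prop :=
  convPost (comulAlgHom k B) f = convPost Algebra.TensorProduct.includeLeft f *
    convPost Algebra.TensorProduct.includeRight f ∧ convPost (counitAlgHom k B) f = 1

variable {C B : Type u} [AddCommGroup C] [Module k C] [Coalgebra k C] [Ring B] [Bialgebra k B]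

lemma convPost_left_mul_right (f g : WithConv (C →ₗ[k] B)) :
    convPost Algebra.TensorProduct.includeLeft f * convPost Algebra.TensorProduct.includeRight g =
      toConv (TensorProduct.map f.ofConv g.ofConv ∘ₗ comul) := by
  refine WithConv.ext (LinearMap.ext fun c => ?_)
  rw [LinearMap.convMul_def]
  simp only [LinearMap.comp_apply]
  generalize comul (R := k) c = s
  induction s with
  | zero => simp
  | add x y hx hy => simp only [map_add, hx, hy]
  | tmul x y => simp [convPost]

lemma convPost_commute [IsCocomm k C] (f g : WithConv (C →ₗ[k] B)) :
    Commute (convPost (Algebra.TensorProduct.includeLeft (R := k) (S := k) (A := B) (B := B)) f)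
      (convPost Algebra.TensorProduct.includeRight g) := by
  rw [commute_iff_eq, convPost_left_mul_right]
  refine WithConv.ext (LinearMap.ext fun c => ?_)
  rw [LinearMap.convMul_def]
  simp only [LinearMap.comp_apply]
  conv_lhs => rw [← Coalgebra.comm_comul k c]
  generalize comul (R := k) c = s
  induction s with
  | zero => simp
  | add x y hx hy => simp only [map_add, hx, hy]
  | tmul x y => simp [convPost]

lemma IsCoalgConv.mul [IsCocomm k C] {f g : WithConv (C →ₗ[k] B)} (hf : IsCoalgConv f)
    (hg : IsCoalgConv g) : IsCoalgConv (f * g) := by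
  refine ⟨?_, by rw [map_mul, hf.2, hg.2, one_mul]⟩
  rw [map_mul, map_mul, map_mul, hf.1, hg.1, mul_assoc, mul_assoc, ← mul_assoc _ _ (convPost _ g),
    ← (convPost_commute g f).eq, mul_assoc]

lemma IsCoalgConv.one : IsCoalgConv (1 : WithConv (C →ₗ[k] B)) := by
  simp [IsCoalgConv]

lemma IsCoalgConv.inv [IsCocomm k C] (f : (WithConv (C →ₗ[k] B))ˣ)
    (hf : IsCoalgConv (f : WithConv (C →ₗ[k] B))) :
    IsCoalgConv ((f⁻¹ : (WithConv (C →ₗ[k] B))ˣ) : WithConv (C →ₗ[k] B)) := by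
  have e1 := hf.1
  have e2 := hf.2
  constructor
  · have h : Units.map (convPost (C := C) (comulAlgHom k B)) f =
        Units.map (convPost (C := C) Algebra.TensorProduct.includeLeft) f *
        Units.map (convPost (C := C) Algebra.TensorProduct.includeRight) f := Units.ext (by simpa using e1)
    have h' := congr(((($h)⁻¹ : (WithConv (C →ₗ[k] B ⊗[k] B))ˣ) : WithConv (C →ₗ[k] B ⊗[k] B)))
    rw [mul_inv_rev, ← map_inv, ← map_inv, ← map_inv] at h'
    simp only [Units.coe_map, Units.val_mul] at h'
    rw [h']
    exact (convPost_commute _ _).eq.symm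
  · have h : Units.map (convPost (C := C) (counitAlgHom k B)) f = 1 := Units.ext (by simpa using e2)
    have h' := congr(((($h)⁻¹ : (WithConv (C →ₗ[k] k))ˣ) : WithConv (C →ₗ[k] k)))
    rw [← map_inv] at h'
    simpa using h'

lemma IsCoalgConv.of_bialgHom {D : Type u} [Ring D] [Bialgebra k D] (g : D →ₐc[k] B) :
    IsCoalgConv (toConv (g : D →ₐ[k] B).toLinearMap) := by
  constructor
  · rw [convPost_left_mul_right]
    refine WithConv.ext (LinearMap.ext fun c => ?_)
    exact (CoalgHomClass.map_comp_comul_apply g c).symm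
  · refine WithConv.ext (LinearMap.ext fun c => ?_)
    exact CoalgHomClass.counit_comp_apply g c

/-- The coalgebra map underlying an element of the convolution monoid. -/
def IsCoalgConv.toCoalgHom {f : WithConv (C →ₗ[k] B)} (hf : IsCoalgConv f) : C →ₗc[k] B where
  __ := f.ofConv
  counit_comp := congrArg WithConv.ofConv hf.2
  map_comp_comul := by
    have := hf.1
    rw [convPost_left_mul_right] at this
    exact (congrArg WithConv.ofConv this).symm

end Conv

namespace TPow
variable {k : Type u} [CommRing k] {H : Type u} [Ring H]

section
variable [Bialgebra k H] {m : ℕ}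

/-- The inclusion of a tensor factor is a bialgebra map. -/
def singleB (j : Fin m) : H →ₐc[k] TPow k H m :=
  BialgHom.ofAlgHom (single j) (by ext a; exact counit_single j a)
    (by ext a; exact (comul_single j a).symm)

/-- The projection to a tensor factor is a bialgebra map. -/
def projB (i : Fin m) : TPow k H m →ₐc[k] H :=
  BialgHom.ofAlgHom (proj i)
    (hom_ext fun j a => by
      rw [AlgHom.comp_apply]
      by_cases h : j = i
      · subst h; simp [counit_single]
      · simp [proj_single_ne h, counit_single])
    (hom_ext fun j a => by
      simp only [AlgHom.comp_apply, comulAlgHom_apply, comul_single]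
      by_cases h : j = i
      · subst h
        rw [proj_single_same]
        generalize comul (R := k) a = s
        induction s with
        | zero => simp
        | add x y hx hy => simp only [map_add, hx, hy]
        | tmul x y => simp
      · rw [proj_single_ne h]
        have e : ∀ s : H ⊗[k] H, (Algebra.TensorProduct.map (proj (k := k) i) (proj i))
            (Algebra.TensorProduct.map (single (k := k) j) (single (m := m) j) s) =
            algebraMap k _ (counit (R := k) (LinearMap.mul' k H s)) := by
          intro s
          induction s with
          | zero => simp
          | add x y hx hy => simp only [map_add, hx, hy]
          | tmul x y =>
            simp [proj_single_ne h, Algebra.TensorProduct.one_def, Algebra.algebraMap_eq_smul_one,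
              TensorProduct.smul_tmul, smul_smul, mul_comm]
        rw [e]
        have h2 : counit (R := k) (LinearMap.mul' k H (comul (R := k) a)) = counit (R := k) a := by
          have h3 := congr(counit (R := k) ((TensorProduct.lid k H)
            $(Coalgebra.rTensor_counit_comul (R := k) a)))
          simp only [TensorProduct.lid_tmul, one_smul] at h3
          rw [← h3]
          generalize comul (R := k) a = s
          induction s with
          | zero => simp
          | add x y hx hy => simp only [map_add, hx, hy]
          | tmul x y => simp
        rw [h2]
        simp)

/-- `g^{⊗ m}` is a bialgebra map if `g` is. -/
def mapB {H' : Type u} [Ring H'] [Bialgebra k H'] (m : ℕ) (g : H →ₐc[k] H') :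
    TPow k H m →ₐc[k] TPow k H' m :=
  BialgHom.ofAlgHom (map m (g : H →ₐ[k] H'))
    (hom_ext fun j a => by
      rw [AlgHom.comp_apply, map_single, counitAlgHom_apply, counitAlgHom_apply, counit_single,
        counit_single]
      exact CoalgHomClass.counit_comp_apply g a)
    (hom_ext fun j a => by
      rw [AlgHom.comp_apply, AlgHom.comp_apply, map_single, comulAlgHom_apply, comulAlgHom_apply,
        comul_single, comul_single]
      have h := CoalgHomClass.map_comp_comul_apply g a
      change _ = Algebra.TensorProduct.map (single (k := k) j) (single j) (comul (R := k) (g a))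
      rw [← h]
      generalize comul (R := k) a = s
      induction s with
      | zero => simp
      | add x y hx hy => simp only [map_add, hx, hy]
      | tmul x y => simp)

end

section
variable [HopfAlgebra k H] {m l : ℕ} {B : Type u} [Ring B] [Algebra k B]

/-- For an algebra map `g : H → B`, the map `g ∘ proj i` as an invertible element of the
convolution monoid of linear maps `H^{⊗ m} → B`; its inverse is `g ∘ S ∘ proj i`. -/
def gen (g : H →ₐ[k] B) (i : Fin m) : (WithConv (TPow k H m →ₗ[k] B))ˣ where
  val := toConv (g.toLinearMap ∘ₗ (proj i).toLinearMap)
  inv := toConv (g.toLinearMap ∘ₗ antipode k ∘ₗ (proj i).toLinearMap)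
  val_inv := by
    have h := congrArg (fun f => convPost g (convPre (projB (k := k) (H := H) i).toCoalgHom f))
      (LinearMap.id_mul_antipode (R := k) (C := H))
    rw [map_mul, map_mul, map_one, map_one] at h
    exact h
  inv_val := by
    have h := congrArg (fun f => convPost g (convPre (projB (k := k) (H := H) i).toCoalgHom f))
      (LinearMap.antipode_mul_id (R := k) (C := H))
    rw [map_mul, map_mul, map_one, map_one] at h
    exact h

/-- The homomorphism from the free group on `x_1, …, x_m` to the invertible elements of the
convolution monoid of linear maps `H^{⊗ m} → B` with `x_i ↦ g ∘ proj i`. -/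
def ev (m : ℕ) (g : H →ₐ[k] B) : FreeGroup (Fin m) →* (WithConv (TPow k H m →ₗ[k] B))ˣ :=
  FreeGroup.lift (gen g)

lemma ev_of (g : H →ₐ[k] B) (i : Fin m) : (ev m g (FreeGroup.of i)).val =
    toConv (g.toLinearMap ∘ₗ (proj i).toLinearMap) := by
  simp [ev, gen]

/-- The map `H^{⊗ m} → H^{⊗ l}` induced by `ρ : F_l → F_m`. In Sweedler notation, with
`ρ (x_j) = ∏ x_{i}^{±1}`, it sends `h_1 ⊗ ⋯ ⊗ h_m` to the sum of the tensors whose `j`-th factor is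
the corresponding product of components of the `h_i`, or of their images under the antipode. -/
def act (ρ : FreeGroup (Fin l) →* FreeGroup (Fin m)) : TPow k H m →ₗ[k] TPow k H l :=
  (List.ofFn fun j : Fin l =>
    (ev (H := H) m (single (k := k) j) (ρ (FreeGroup.of j))).val).prod.ofConv

lemma toConv_act (ρ : FreeGroup (Fin l) →* FreeGroup (Fin m)) :
    toConv (act (k := k) (H := H) ρ) = (List.ofFn fun j : Fin l =>
      (ev (H := H) m (single (k := k) j) (ρ (FreeGroup.of j))).val).prod := rfl

lemma post_ev {B' : Type u} [Ring B'] [Algebra k B'] (h : B →ₐ[k] B') (g : H →ₐ[k] B)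
    (u : FreeGroup (Fin m)) : convPost h (ev m g u).val =
      (ev m (h.comp g) u).val := by
  have : (Units.map (convPost (C := TPow k H m) h)).comp (ev m g) = ev m (h.comp g) :=
    FreeGroup.ext_hom _ _ fun i => Units.ext (by
      rw [MonoidHom.comp_apply, Units.coe_map, ev_of, ev_of]; rfl)
  exact congrArg Units.val (DFunLike.congr_fun this u)

lemma ev_trivial (u : FreeGroup (Fin m)) :
    ev m ((Algebra.ofId k B).comp (counitAlgHom k H)) u = 1 := by
  have : ev m ((Algebra.ofId k B).comp (counitAlgHom k H)) = 1 :=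
    FreeGroup.ext_hom _ _ fun i => Units.ext (WithConv.ext (LinearMap.ext fun c => by
      rw [ev_of]
      exact congrArg (algebraMap k B)
        (CoalgHomClass.counit_comp_apply (R := k) (projB (k := k) (H := H) i) c)))
  rw [this]; rfl

lemma post_act (h : TPow k H l →ₐ[k] B) (ρ : FreeGroup (Fin l) →* FreeGroup (Fin m)) :
    convPost h (toConv (act ρ)) = (List.ofFn fun j : Fin l =>
      (ev m (h.comp (single j)) (ρ (FreeGroup.of j))).val).prod := by
  rw [toConv_act, map_list_prod, List.map_ofFn]
  congr 2
  funext j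
  exact post_ev _ _ _

lemma proj_act (g : H →ₐ[k] B) (ρ : FreeGroup (Fin l) →* FreeGroup (Fin m)) (i : Fin l) :
    convPost (g.comp (proj i)) (toConv (act ρ)) =
      (ev m g (ρ (FreeGroup.of i))).val := by
  rw [post_act, prod_ofFn_eq _ i]
  · congr 3
    ext a; simp
  · intro j hj
    have : (g.comp (proj i)).comp (single (k := k) j) =
        (Algebra.ofId k B).comp (counitAlgHom k H) := by
      ext a; simp [proj_single_ne hj, Algebra.ofId_apply]
    rw [this, ev_trivial]; rfl

lemma prod_single_proj : ∀ L : List (Fin m), L.Nodup → ∃ f : TPow k H m →ₐ[k] TPow k H m,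
    (L.map fun j => toConv ((single (k := k) (H := H) j).toLinearMap ∘ₗ
      (proj j).toLinearMap)).prod = toConv f.toLinearMap ∧
    (∀ i ∈ L, ∀ a, f (single i a) = single i a) ∧
    (∀ i ∉ L, ∀ a, f (single i a) = algebraMap k _ (counit (R := k) a)) ∧
    ∀ i ∉ L, ∀ a x, Commute (single i a) (f x)
  | [], _ => ⟨(Algebra.ofId k _).comp (counitAlgHom k _), rfl, by simp,
      fun i _ a => congrArg (algebraMap k _) (counit_single i a),
      fun i _ a x => Algebra.commute_algebraMap_right (counit (R := k) x) (single i a)⟩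
  | j :: L, hL => by
    obtain ⟨f, h1, h2, h3, h4⟩ := prod_single_proj L (List.nodup_cons.1 hL).2
    have hj := (List.nodup_cons.1 hL).1
    set f' := (Algebra.TensorProduct.lift ((single (k := k) (H := H) j).comp (proj j)) f
      fun x y => h4 j hj _ _).comp (comulAlgHom k (TPow k H m)) with hf'
    have hx : ∀ x, f' x = LinearMap.mul' k _ (TensorProduct.map
        ((single (k := k) (H := H) j).toLinearMap ∘ₗ (proj j).toLinearMap)
        f.toLinearMap (comul (R := k) x)) := by
      intro x
      rw [hf', AlgHom.comp_apply, comulAlgHom_apply]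
      generalize comul (R := k) x = s
      induction s with
      | zero => simp
      | add x y hx hy => simp only [map_add, hx, hy]
      | tmul x y => exact Algebra.TensorProduct.lift_tmul _ _ _ _ _
    refine ⟨f', ?_, ?_, ?_, ?_⟩
    · rw [List.map_cons, List.prod_cons, h1]
      exact WithConv.ext (LinearMap.ext fun x => (hx x).symm)
    · intro i hi a
      rw [hx, comul_single]
      by_cases hij : i = j
      · subst hij
        have h := congr(single (m := m) (k := k) i ((TensorProduct.rid k H)
            $(Coalgebra.lTensor_counit_comul (R := k) a)))
        simp only [TensorProduct.rid_tmul, one_smul] at h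
        refine Eq.trans ?_ h
        generalize comul (R := k) a = s
        induction s with
        | zero => simp
        | add x y hx hy => simp only [map_add, hx, hy]
        | tmul x y => simp [h3 i hj, Algebra.smul_def, Algebra.commutes]
      · have hi' : i ∈ L := by simpa [hij] using hi
        have h := congr(single (m := m) (k := k) i ((TensorProduct.lid k H)
            $(Coalgebra.rTensor_counit_comul (R := k) a)))
        simp only [TensorProduct.lid_tmul, one_smul] at h
        refine Eq.trans ?_ h
        generalize comul (R := k) a = s
        induction s with
        | zero => simp
        | add x y hx hy => simp only [map_add, hx, hy]
        | tmul x y => simp [h2 i hi', proj_single_ne hij, Algebra.smul_def]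
    · intro i hi a
      rw [hx, comul_single]
      have hij : i ≠ j := fun h => hi (by simp [h])
      have hi' : i ∉ L := fun h => hi (by simp [h])
      have h := congr(algebraMap k (TPow k H m) (counit (R := k) ((TensorProduct.lid k H)
          $(Coalgebra.rTensor_counit_comul (R := k) a))))
      simp only [TensorProduct.lid_tmul, one_smul] at h
      refine Eq.trans ?_ h
      generalize comul (R := k) a = s
      induction s with
      | zero => simp
      | add x y hx hy => simp only [map_add, hx, hy]
      | tmul x y => simp [h3 i hi', proj_single_ne hij]
    · intro i hi a x
      have hij : i ≠ j := fun h => hi (by simp [h])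
      have hi' : i ∉ L := fun h => hi (by simp [h])
      rw [hx]
      generalize comul (R := k) x = s
      induction s with
      | zero => simp
      | add x y hx hy => rw [map_add, map_add]; exact hx.add_right hy
      | tmul x y => exact (single_commute hij _ _).mul_right (h4 i hi' _ _)

lemma act_id : act (k := k) (H := H) (MonoidHom.id (FreeGroup (Fin m))) = LinearMap.id := by
  obtain ⟨f, h1, h2, -⟩ := prod_single_proj (k := k) (H := H) (List.finRange m)
    (List.nodup_finRange m)
  have hf : f = AlgHom.id k _ := hom_ext fun j a => h2 j (List.mem_finRange j) a
  have h := toConv_act (k := k) (H := H) (MonoidHom.id (FreeGroup (Fin m)))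
  simp only [MonoidHom.id_apply, ev_of] at h
  rw [List.ofFn_eq_map, h1, hf] at h
  exact congrArg ofConv h

lemma act_natural {H' : Type u} [Ring H'] [HopfAlgebra k H'] (g : H →ₐc[k] H')
    (ρ : FreeGroup (Fin l) →* FreeGroup (Fin m)) :
    (map l (g : H →ₐ[k] H')).toLinearMap ∘ₗ act ρ =
      act ρ ∘ₗ (map m (g : H →ₐ[k] H')).toLinearMap := by
  have h1 : ∀ {B : Type u} [Ring B] [Algebra k B] (f : H' →ₐ[k] B) (v : FreeGroup (Fin m)),
      convPre (mapB m g).toCoalgHom (ev m f v).val =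
      (ev m (f.comp (g : H →ₐ[k] H')) v).val := by
    intro B _ _ f v
    have : (Units.map (convPre (A := B) (mapB m g).toCoalgHom)).comp (ev m f) =
        ev m (f.comp (g : H →ₐ[k] H')) := by
      refine FreeGroup.ext_hom _ _ fun i => Units.ext ?_
      have e : (proj (k := k) i).comp (map m (g : H →ₐ[k] H')) =
          (g : H →ₐ[k] H').comp (proj i) := by
        refine hom_ext fun j a => ?_
        rw [AlgHom.comp_apply, AlgHom.comp_apply, map_single]
        by_cases h : j = i
        · subst h; simp
        · rw [proj_single_ne h, proj_single_ne h, AlgHom.commutes]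
          exact congrArg _ (CoalgHomClass.counit_comp_apply g a)
      have e' := congrArg (fun t => toConv (f.toLinearMap ∘ₗ AlgHom.toLinearMap t)) e
      rw [MonoidHom.comp_apply, Units.coe_map, ev_of, ev_of]
      exact e'
    exact congrArg Units.val (DFunLike.congr_fun this v)
  have h2 : convPost (map l (g : H →ₐ[k] H')) (toConv (act ρ)) =
      convPre (mapB m g).toCoalgHom (toConv (act ρ)) := by
    rw [post_act, toConv_act, map_list_prod, List.map_ofFn]
    congr 2
    funext j
    refine Eq.trans ?_ (h1 _ _).symm
    rw [show (map l (g : H →ₐ[k] H')).comp (single j) = (single j).comp (g : H →ₐ[k] H') from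
      AlgHom.ext fun a => map_single _ _ _]
  exact congrArg ofConv h2

variable [IsCocomm k H]

lemma isCoalgConv_ev {B : Type u} [Ring B] [Bialgebra k B] (g : H →ₐc[k] B)
    (u : FreeGroup (Fin m)) : IsCoalgConv (ev m (g : H →ₐ[k] B) u).val := by
  induction u using FreeGroup.induction_on with
  | C1 => simpa using IsCoalgConv.one
  | of i => rw [ev_of]; exact IsCoalgConv.of_bialgHom (g.comp (projB (k := k) (H := H) i))
  | inv_of i h => rw [map_inv]; exact h.inv _
  | mul x y hx hy => rw [map_mul, Units.val_mul]; exact hx.mul hy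

lemma isCoalgConv_act (ρ : FreeGroup (Fin l) →* FreeGroup (Fin m)) :
    IsCoalgConv (toConv (act (k := k) (H := H) ρ)) := by
  have : ∀ L : List (WithConv (TPow k H m →ₗ[k] TPow k H l)), (∀ f ∈ L, IsCoalgConv f) →
      IsCoalgConv L.prod := by
    intro L hL
    induction L with
    | nil => exact IsCoalgConv.one
    | cons a L ih =>
      rw [List.prod_cons]
      exact (hL a (by simp)).mul (ih fun f hf => hL f (by simp [hf]))
  refine this _ fun f hf => ?_
  obtain ⟨j, rfl⟩ := (List.mem_ofFn' _ _).1 hf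
  exact isCoalgConv_ev (singleB j) _

lemma ev_act (g : H →ₐ[k] B) (ρ : FreeGroup (Fin l) →* FreeGroup (Fin m))
    (u : FreeGroup (Fin l)) :
    convPre (isCoalgConv_act (k := k) (H := H) ρ).toCoalgHom
      (ev l g u).val =
      (ev m g (ρ u)).val := by
  have : (Units.map (convPre (A := B) (isCoalgConv_act (k := k) (H := H) ρ).toCoalgHom)).comp
      (ev l g) = (ev m g).comp ρ := by
    refine FreeGroup.ext_hom _ _ fun i => Units.ext ?_
    rw [MonoidHom.comp_apply, MonoidHom.comp_apply, ← proj_act, Units.coe_map, ev_of]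
    rfl
  exact congrArg Units.val (DFunLike.congr_fun this u)

lemma act_comp {r : ℕ} (ρ : FreeGroup (Fin l) →* FreeGroup (Fin m))
    (σ : FreeGroup (Fin r) →* FreeGroup (Fin l)) :
    act (k := k) (H := H) (ρ.comp σ) = act σ ∘ₗ act ρ := by
  have : toConv (act (k := k) (H := H) (ρ.comp σ)) =
      convPre (isCoalgConv_act (k := k) (H := H) ρ).toCoalgHom (toConv (act σ)) := by
    rw [toConv_act σ, map_list_prod, List.map_ofFn, toConv_act]
    congr 2
    funext j
    exact (ev_act (single (k := k) (H := H) j) ρ _).symm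
  exact congrArg ofConv this

end
end TPow

section Multidegree
variable (k : Type u) [CommRing k]

/-- The free associative algebra on `x_1, …, x_n`. -/
abbrev Alg (n : ℕ) : Type u := FreeAlgebra k (Fin n)

/-- A word in `x_1, …, x_n`, as an element of the free associative algebra. -/
def word (n : ℕ) : FreeMonoid (Fin n) →* Alg k n := FreeMonoid.lift (FreeAlgebra.ι k)

/-- The tensor `w_1 ⊗ ⋯ ⊗ w_m` of words. -/
def wordTensor (n m : ℕ) : (Fin m → FreeMonoid (Fin n)) →* TPow k (Alg k n) m where
  toFun w := TPow.tprod k fun j => word k n (w j)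
  map_one' := by simp only [Pi.one_apply, map_one]; rfl
  map_mul' v w := by
    simp only [Pi.mul_apply, map_mul]
    exact (PiTensorProduct.tprod_mul_tprod _ _).symm

/-- The number of occurrences of each variable in the tuple of words `(w_1, …, w_m)`. -/
def deg {n m : ℕ} (w : Fin m → FreeMonoid (Fin n)) : Fin n → ℕ :=
  fun i => ∑ j, (w j).toList.count i

/-- The span of the tensors of words of multidegree `d`. -/
def homog (n m : ℕ) (d : Fin n → ℕ) : Submodule k (TPow k (Alg k n) m) :=
  Submodule.span k (wordTensor k n m '' {w | deg w = d})

/-- The multilinear part: the span of the tensors `w_1 ⊗ ⋯ ⊗ w_m` of words such that each of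
`x_1, …, x_n` occurs exactly once in the concatenation `w_1 ⋯ w_m`. -/
def multilin (n m : ℕ) : Submodule k (TPow k (Alg k n) m) :=
  homog k n m fun _ => 1

lemma deg_mul {n m : ℕ} (v w : Fin m → FreeMonoid (Fin n)) : deg (v * w) = deg v + deg w := by
  funext i
  simp [deg, FreeMonoid.toList_mul, List.count_append, Finset.sum_add_distrib]

instance homog_graded (n m : ℕ) : SetLike.GradedMonoid (homog k n m) where
  one_mem := Submodule.subset_span ⟨1, by funext i; simp [deg], map_one _⟩
  mul_mem := by
    intro d e a b ha hb
    have := Submodule.mul_mem_mul ha hb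
    rw [homog, homog, Submodule.span_mul_span] at this
    refine Submodule.span_mono ?_ this
    rintro _ ⟨_, ⟨v, hv, rfl⟩, _, ⟨w, hw, rfl⟩, rfl⟩
    exact ⟨v * w, (deg_mul v w).trans (congrArg₂ _ hv hw), map_mul _ _ _⟩

variable {k}

lemma single_mem_homog {n m : ℕ} (j : Fin m) (i : Fin n) :
    TPow.single j (FreeAlgebra.ι k i) ∈ homog k n m (Pi.single i 1) := by
  refine Submodule.subset_span ⟨Pi.mulSingle j (FreeMonoid.of i), ?_, ?_⟩
  · funext a
    rw [deg, Finset.sum_eq_single j]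
    · rw [Pi.mulSingle_eq_same, FreeMonoid.toList_of, List.count_singleton, Pi.single_apply]
      by_cases h : a = i
      · simp [h]
      · simp [h, Ne.symm h]
    · intro b _ hb
      rw [Pi.mulSingle_eq_of_ne hb]; simp
    · simp
  · rw [TPow.single_apply]
    refine congrArg (TPow.tprod k) (funext fun a => ?_)
    by_cases h : a = j
    · subst h; simp [word]
    · simp [Pi.mulSingle_eq_of_ne h]

lemma tprod_eq_prod {n m : ℕ} (x : Fin m → Alg k n) :
    TPow.tprod k x = (List.ofFn fun j => TPow.single (k := k) j (x j)).prod := by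
  have h : TPow.lift (fun j => TPow.single (k := k) (H := Alg k n) (m := m) j)
      (fun i j hij a b => TPow.single_commute hij a b) = AlgHom.id k _ :=
    TPow.hom_ext fun j a => by simp
  rw [← TPow.lift_tprod _ fun i j hij a b => TPow.single_commute hij a b, h]; rfl

/-- An algebra map that takes generators to degree one takes multidegree `d` to degree `d`. -/
lemma map_homog {n m : ℕ} {R : Type*} [Ring R] [Algebra k R] (𝒟 : (Fin n → ℕ) → Submodule k R)
    [SetLike.GradedMonoid 𝒟] (f : TPow k (Alg k n) m →ₐ[k] R)
    (hf : ∀ j i, f (TPow.single j (FreeAlgebra.ι k i)) ∈ 𝒟 (Pi.single i 1)) {d : Fin n → ℕ}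
    {t : TPow k (Alg k n) m} (ht : t ∈ homog k n m d) : f t ∈ 𝒟 d := by
  have h1 : ∀ j (v : FreeMonoid (Fin n)), f (TPow.single j (word k n v)) ∈
      𝒟 fun i => v.toList.count i := by
    intro j v
    induction v using FreeMonoid.inductionOn' with
    | one =>
      rw [map_one (word k n), map_one (TPow.single j), map_one f]
      exact SetLike.GradedOne.one_mem (A := 𝒟)
    | of_mul i v ih =>
      rw [map_mul (word k n), map_mul (TPow.single j), map_mul f]
      have := SetLike.GradedMul.mul_mem (hf j i) ih
      convert this using 2
      · funext a
        rw [FreeMonoid.toList_mul, FreeMonoid.toList_of, List.count_append, List.count_singleton]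
        by_cases h : a = i
        · simp [h]
        · simp [h, Ne.symm h]
      · simp [word]
  suffices h : homog k n m d ≤ (𝒟 d).comap f.toLinearMap from h ht
  refine Submodule.span_le.2 ?_
  rintro _ ⟨w, rfl, rfl⟩
  change f (TPow.tprod k fun j => word k n (w j)) ∈ 𝒟 _
  rw [tprod_eq_prod, map_list_prod, List.map_ofFn]
  convert SetLike.list_prod_ofFn_mem_graded (A := 𝒟) _ _ (fun j => h1 j (w j)) using 2
  · rw [List.sum_ofFn]
    funext i
    simp [deg]
  · rfl

/-- The linear maps that preserve the multidegree. -/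
def Homog {n m l : ℕ} (f : WithConv (TPow k (Alg k n) m →ₗ[k] TPow k (Alg k n) l)) : Prop :=
  ∀ d, ∀ t ∈ homog k n m d, f.ofConv t ∈ homog k n l d

/-- The multigrading of the tensor square. -/
def homogSq (k : Type u) [CommRing k] (n m : ℕ) (d : Fin n → ℕ) :
    Submodule k (TPow k (Alg k n) m ⊗[k] TPow k (Alg k n) m) :=
  Submodule.span k {t | ∃ p q x y, p + q = d ∧ x ∈ homog k n m p ∧ y ∈ homog k n m q ∧ x ⊗ₜ y = t}

instance homogSq_graded (n m : ℕ) : SetLike.GradedMonoid (homogSq k n m) where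
  one_mem := Submodule.subset_span ⟨0, 0, 1, 1, add_zero 0, SetLike.GradedOne.one_mem,
    SetLike.GradedOne.one_mem, rfl⟩
  mul_mem := by
    intro d e a b ha hb
    have := Submodule.mul_mem_mul ha hb
    rw [homogSq, homogSq, Submodule.span_mul_span] at this
    refine Submodule.span_mono ?_ this
    rintro _ ⟨_, ⟨p, q, x, y, rfl, hx, hy, rfl⟩, _, ⟨p', q', x', y', rfl, hx', hy', rfl⟩, rfl⟩
    exact ⟨p + p', q + q', x * x', y * y', by abel, SetLike.GradedMul.mul_mem hx hx',
      SetLike.GradedMul.mul_mem hy hy', (Algebra.TensorProduct.tmul_mul_tmul _ _ _ _).symm⟩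

/-- The multigrading of the opposite algebra. -/
def homogOp (k : Type u) [CommRing k] (n m : ℕ) (d : Fin n → ℕ) :
    Submodule k (TPow k (Alg k n) m)ᵐᵒᵖ :=
  (homog k n m d).comap (MulOpposite.opLinearEquiv k).symm.toLinearMap

instance homogOp_graded (n m : ℕ) : SetLike.GradedMonoid (homogOp k n m) where
  one_mem := SetLike.GradedOne.one_mem (A := homog k n m)
  mul_mem := by
    intro d e a b ha hb
    rw [add_comm]
    exact SetLike.GradedMul.mul_mem (A := homog k n m) hb ha

lemma Homog.mul {n m l : ℕ} {f g : WithConv (TPow k (Alg k n) m →ₗ[k] TPow k (Alg k n) l)}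
    (hf : Homog f) (hg : Homog g) : Homog (f * g) := by
  intro d t ht
  have h : comulAlgHom k _ t ∈ homogSq k n m d := map_homog _ _ (fun j i => by
    rw [comulAlgHom_apply, TPow.comul_single, comul_ι, map_add, Algebra.TensorProduct.map_tmul,
      Algebra.TensorProduct.map_tmul, map_one]
    refine add_mem (Submodule.subset_span ?_) (Submodule.subset_span ?_)
    · exact ⟨_, 0, _, _, add_zero _, single_mem_homog j i, SetLike.GradedOne.one_mem, rfl⟩
    · exact ⟨0, _, _, _, zero_add _, SetLike.GradedOne.one_mem, single_mem_homog j i, rfl⟩) ht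
  rw [LinearMap.convMul_def]
  change LinearMap.mul' k _ (TensorProduct.map f.ofConv g.ofConv (comulAlgHom k _ t)) ∈ _
  generalize comulAlgHom k (TPow k (Alg k n) m) t = s at h
  suffices h' : homogSq k n m d ≤ (homog k n l d).comap
    (LinearMap.mul' k _ ∘ₗ TensorProduct.map f.ofConv g.ofConv) from h' h
  refine Submodule.span_le.2 ?_
  rintro _ ⟨p, q, x, y, rfl, hx, hy, rfl⟩
  exact SetLike.GradedMul.mul_mem (hf _ _ hx) (hg _ _ hy)

lemma Homog.one {n m l : ℕ} :
    Homog (1 : WithConv (TPow k (Alg k n) m →ₗ[k] TPow k (Alg k n) l)) := fun d t ht =>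
  map_homog (homog k n l) ((Algebra.ofId k _).comp (counitAlgHom k _)) (fun j i => by
    rw [AlgHom.comp_apply, counitAlgHom_apply, TPow.counit_single, counit_ι, map_zero]
    exact zero_mem _) ht

lemma proj_ι {n m : ℕ} (i : Fin m) (j : Fin m) (a : Fin n) :
    TPow.proj (k := k) i (TPow.single j (FreeAlgebra.ι k a)) =
      if j = i then FreeAlgebra.ι k a else 0 := by
  by_cases h : j = i
  · subst h; simp
  · rw [TPow.proj_single_ne h, counit_ι, map_zero, if_neg h]

lemma homog_ev {n m l : ℕ} (j : Fin l) (u : FreeGroup (Fin m)) :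
    Homog (TPow.ev m (TPow.single (k := k) (H := Alg k n) j) u).val := by
  induction u using FreeGroup.induction_on with
  | C1 => rw [map_one]; exact Homog.one
  | of i =>
    intro d t ht
    rw [TPow.ev_of]
    refine map_homog (homog k n l) ((TPow.single j).comp (TPow.proj i)) (fun b a => ?_) ht
    rw [AlgHom.comp_apply, proj_ι]
    split_ifs
    · exact single_mem_homog j a
    · rw [map_zero]; exact zero_mem _
  | inv_of i h =>
    intro d t ht
    have e : (TPow.ev m (TPow.single (k := k) (H := Alg k n) j) (FreeGroup.of i)⁻¹).val =
      toConv ((TPow.single (k := k) j).toLinearMap ∘ₗ freeAntipode k (Fin n) ∘ₗ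
        (TPow.proj i).toLinearMap) := by
      rw [map_inv, TPow.ev, FreeGroup.lift_apply_of]; rfl
    rw [e]
    refine map_homog (homogOp k n l) ((AlgHom.op (TPow.single (k := k) j)).comp
      ((freeAntipodeOp k (Fin n)).comp (TPow.proj i))) (fun b a => ?_) ht
    rw [AlgHom.comp_apply, AlgHom.comp_apply, proj_ι]
    split_ifs
    · rw [freeAntipodeOp, FreeAlgebra.lift_ι_apply]
      change TPow.single (k := k) j (-FreeAlgebra.ι k a) ∈ homog k n l _
      rw [map_neg]
      exact neg_mem (single_mem_homog j a)
    · rw [map_zero, map_zero]; exact zero_mem _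
  | mul x y hx hy => rw [map_mul, Units.val_mul]; exact hx.mul hy

lemma act_mem_homog {n m l : ℕ} (ρ : FreeGroup (Fin l) →* FreeGroup (Fin m)) {d : Fin n → ℕ}
    {t : TPow k (Alg k n) m} (ht : t ∈ homog k n m d) : TPow.act ρ t ∈ homog k n l d := by
  have : ∀ L : List (WithConv (TPow k (Alg k n) m →ₗ[k] TPow k (Alg k n) l)),
      (∀ f ∈ L, Homog f) → Homog L.prod := by
    intro L hL
    induction L with
    | nil => exact Homog.one
    | cons a L ih =>
      rw [List.prod_cons]
      exact (hL a (by simp)).mul (ih fun f hf => hL f (by simp [hf]))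
  refine this _ (fun f hf => ?_) d t ht
  obtain ⟨j, rfl⟩ := (List.mem_ofFn' _ _).1 hf
  exact homog_ev j _

end Multidegree

section LieOperad
variable (k : Type u) [CommRing k]

/-- The free Lie algebra on `x_1, …, x_n`. -/
abbrev Lie (n : ℕ) : Type u := FreeLieAlgebra k (Fin n)

/-- `LieMonomial k n d p` says that `p` is a Lie monomial in `x_1, …, x_n`, that is, an iterated
bracket of variables, in which the variable `x_i` occurs `d i` times. -/
inductive LieMonomial (n : ℕ) : (Fin n → ℕ) → Lie k n → Prop
  | var (i : Fin n) : LieMonomial n (Pi.single i 1) (FreeLieAlgebra.of k i)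
  | bracket {d e : Fin n → ℕ} {a b : Lie k n} :
      LieMonomial n d a → LieMonomial n e b → LieMonomial n (d + e) ⁅a, b⁆

/-- The indicator function of the fibre of `f` at `j`. -/
def fib {n m : ℕ} (f : Fin n → Fin m) (j : Fin m) : Fin n → ℕ := fun i => if f i = j then 1 else 0

/-- The morphisms `n → m` of the linear category associated to the Lie operad, that is, the direct
sum over the maps `f : {1, …, n} → {1, …, m}` of the tensor products over `j` of `Lie (f⁻¹ j)`.
Here `Lie (S)` is the multilinear part of the free Lie algebra on the variables indexed by `S`, and
the direct sum is formed inside the `m`-th tensor power of the free Lie algebra on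
`x_1, …, x_n`, of which it is a multihomogeneous direct summand. -/
def lieHom (n m : ℕ) : Submodule k (⨂[k] _ : Fin m, Lie k n) :=
  Submodule.span k {t | ∃ (f : Fin n → Fin m) (p : Fin m → Lie k n),
    (∀ j, LieMonomial k n (fib f j) (p j)) ∧ PiTensorProduct.tprod k p = t}

variable {k}

/-- The substitution `x_i ↦ P_i`. -/
def lieSub {m n : ℕ} (P : Fin m → Lie k n) : Lie k m →ₗ[k] Lie k n :=
  (FreeLieAlgebra.lift k P : Lie k m →ₗ⁅k⁆ Lie k n)

@[simp] lemma lieSub_of {m n : ℕ} (P : Fin m → Lie k n) (i : Fin m) :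
    lieSub P (FreeLieAlgebra.of k i) = P i :=
  FreeLieAlgebra.lift_of_apply P i

lemma lieSub_lie {m n : ℕ} (P : Fin m → Lie k n) (a b : Lie k m) :
    lieSub P ⁅a, b⁆ = ⁅lieSub P a, lieSub P b⁆ :=
  LieHom.map_lie (FreeLieAlgebra.lift k P) a b

lemma lieSub_comp {r m n : ℕ} (P : Fin m → Lie k n) (Q : Fin r → Lie k m) :
    lieSub P ∘ₗ lieSub Q = lieSub fun j => lieSub P (Q j) := by
  have : (FreeLieAlgebra.lift k P).comp (FreeLieAlgebra.lift k Q) =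
      FreeLieAlgebra.lift k fun j => FreeLieAlgebra.lift k P (Q j) :=
    FreeLieAlgebra.hom_ext fun i => by simp
  exact congrArg LieHom.toLinearMap this

lemma lieSub_id (n : ℕ) : lieSub (FreeLieAlgebra.of k : Fin n → Lie k n) = LinearMap.id := by
  have : FreeLieAlgebra.lift k (FreeLieAlgebra.of k : Fin n → Lie k n) = LieHom.id :=
    FreeLieAlgebra.hom_ext fun i => by simp
  exact congrArg LieHom.toLinearMap this

/-- Functions of several vectors whose degree in the `i`-th vector is `0`, resp. `1`, if
`d i = 0`, resp. `d i = 1`. -/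
structure HasDeg {m : ℕ} {V W : Type*} [AddCommGroup V] [Module k V] [AddCommGroup W] [Module k W]
    (d : Fin m → ℕ) (g : (Fin m → V) → W) : Prop where
  const : ∀ i, d i = 0 → ∀ P x, g (Function.update P i x) = g P
  add : ∀ i, d i = 1 → ∀ P x y, g (Function.update P i (x + y)) =
    g (Function.update P i x) + g (Function.update P i y)
  smul : ∀ i, d i = 1 → ∀ P (c : k) x, g (Function.update P i (c • x)) =
    c • g (Function.update P i x)

/-- Functions of degree one in each argument are multilinear. -/
def HasDeg.multilinear {m : ℕ} {V W : Type*} [AddCommGroup V] [Module k V] [AddCommGroup W]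
    [Module k W] {g : (Fin m → V) → W} (hg : HasDeg (k := k) (fun _ => 1) g) :
    MultilinearMap k (fun _ : Fin m => V) W :=
  MultilinearMap.mk' g (fun P i x y => hg.add i rfl P x y) (fun P i c x => hg.smul i rfl P c x)

lemma hasDeg_lieSub {m n : ℕ} {d : Fin m → ℕ} {q : Lie k m} (hq : LieMonomial k m d q) :
    HasDeg (k := k) d fun P : Fin m → Lie k n => lieSub P q := by
  induction hq with
  | var a =>
    have key : ∀ i, (Pi.single a 1 : Fin m → ℕ) i = 1 → i = a := by
      intro i h
      by_contra h'
      simp [Pi.single_eq_of_ne h'] at h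
    refine ⟨fun i hi P x => ?_, fun i hi P x y => ?_, fun i hi P c x => ?_⟩
    · have : a ≠ i := by rintro rfl; simp at hi
      simp [Function.update_of_ne this]
    · simp [key i hi]
    · simp [key i hi]
  | bracket h1 h2 ih1 ih2 =>
    refine ⟨fun i hi P x => ?_, fun i hi P x y => ?_, fun i hi P c x => ?_⟩
    · rw [Pi.add_apply, Nat.add_eq_zero_iff] at hi
      simp only [lieSub_lie, ih1.const i hi.1, ih2.const i hi.2]
    · rw [Pi.add_apply, Nat.add_eq_one_iff] at hi
      rcases hi with hi | hi
      · simp only [lieSub_lie, ih1.const i hi.1, ih2.add i hi.2, lie_add]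
      · simp only [lieSub_lie, ih1.add i hi.1, ih2.const i hi.2, add_lie]
    · rw [Pi.add_apply, Nat.add_eq_one_iff] at hi
      rcases hi with hi | hi
      · simp only [lieSub_lie, ih1.const i hi.1, ih2.smul i hi.2, lie_smul]
      · simp only [lieSub_lie, ih1.smul i hi.1, ih2.const i hi.2, smul_lie]

lemma hasDeg_lieHom {m l : ℕ} (n : ℕ) {t : ⨂[k] _ : Fin l, Lie k m} (ht : t ∈ lieHom k m l) :
    HasDeg (k := k) (fun _ => 1) fun P : Fin m → Lie k n =>
      PiTensorProduct.map (fun _ : Fin l => lieSub P) t := by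
  induction ht using Submodule.span_induction with
  | mem t ht =>
    obtain ⟨f, q, hq, rfl⟩ := ht
    have key : ∀ (i : Fin m) P x, (fun j => lieSub (Function.update P i x) (q j)) =
        Function.update (fun j => lieSub (n := n) P (q j)) (f i)
          (lieSub (Function.update P i x) (q (f i))) := by
      intro i P x
      funext j
      by_cases h : j = f i
      · subst h; simp
      · rw [Function.update_of_ne h]
        exact (hasDeg_lieSub (hq j)).const i (by simp [fib, Ne.symm h]) P x
    refine ⟨fun i hi => by simp at hi, fun i _ P x y => ?_, fun i _ P c x => ?_⟩
    · simp only [PiTensorProduct.map_tprod]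
      rw [key, (hasDeg_lieSub (hq (f i))).add i (by simp [fib]), MultilinearMap.map_update_add,
        ← key, ← key]
    · simp only [PiTensorProduct.map_tprod]
      rw [key, (hasDeg_lieSub (hq (f i))).smul i (by simp [fib]), MultilinearMap.map_update_smul,
        ← key]
  | zero => exact ⟨by simp, by simp, by simp⟩
  | add s t _ _ hs ht =>
    refine ⟨fun i hi => by simp at hi, fun i hi P x y => ?_, fun i hi P c x => ?_⟩
    · simp only [map_add] at *
      rw [hs.add i rfl, ht.add i rfl]; abel
    · simp only [map_add] at *
      rw [hs.smul i rfl, ht.smul i rfl, smul_add]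
  | smul c t _ ht =>
    refine ⟨fun i hi => by simp at hi, fun i hi P x y => ?_, fun i hi P c' x => ?_⟩
    · simp only [map_smul] at *
      rw [ht.add i rfl, smul_add]
    · simp only [map_smul] at *
      rw [ht.smul i rfl, smul_comm]

lemma lieMonomial_lieSub {m n : ℕ} (f : Fin n → Fin m) {P : Fin m → Lie k n}
    (hP : ∀ i, LieMonomial k n (fib f i) (P i)) {d : Fin m → ℕ} {q : Lie k m}
    (hq : LieMonomial k m d q) : LieMonomial k n (d ∘ f) (lieSub P q) := by
  induction hq with
  | var a =>
    rw [lieSub_of]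
    convert hP a using 1
    funext i
    simp [fib, Pi.single_apply]
  | bracket h1 h2 ih1 ih2 =>
    rw [lieSub_lie]
    exact ih1.bracket ih2

/-- The composite of `s : n → m` and `t : m → l`, obtained by substituting the components of `s`
in `t`: for `s = P_1 ⊗ ⋯ ⊗ P_m` and `t = q_1 ⊗ ⋯ ⊗ q_l` it is
`q_1(P_1, …, P_m) ⊗ ⋯ ⊗ q_l(P_1, …, P_m)`. -/
def lieComp {n m l : ℕ} (s : lieHom k n m) (t : lieHom k m l) : ⨂[k] _ : Fin l, Lie k n :=
  PiTensorProduct.lift (hasDeg_lieHom n t.2).multilinear s.1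

variable (k) in
/-- The morphism `p_1 ⊗ ⋯ ⊗ p_m` for Lie monomials `p_1, …, p_m`. -/
def lieGen {n m : ℕ} (f : Fin n → Fin m) (p : Fin m → Lie k n)
    (h : ∀ j, LieMonomial k n (fib f j) (p j)) : lieHom k n m :=
  ⟨PiTensorProduct.tprod k p, Submodule.subset_span ⟨f, p, h, rfl⟩⟩

lemma lieHom_induction {n m : ℕ} {C : lieHom k n m → Prop}
    (gen : ∀ (f : Fin n → Fin m) (p : Fin m → Lie k n)
      (h : ∀ j, LieMonomial k n (fib f j) (p j)), C (lieGen k f p h))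
    (zero : C 0) (add : ∀ s t, C s → C t → C (s + t)) (smul : ∀ (c : k) s, C s → C (c • s))
    (s : lieHom k n m) : C s := by
  obtain ⟨s, hs⟩ := s
  induction hs using Submodule.span_induction with
  | mem s hs => obtain ⟨f, p, h, rfl⟩ := hs; exact gen f p h
  | zero => exact zero
  | add s t _ _ hs ht => exact add _ _ hs ht
  | smul c s _ hs => exact smul c _ hs

lemma lieHom_ext {n m : ℕ} {M : Type*} [AddCommGroup M] [Module k M] {a b : lieHom k n m →ₗ[k] M}
    (h : ∀ (f : Fin n → Fin m) (p : Fin m → Lie k n)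
      (hp : ∀ j, LieMonomial k n (fib f j) (p j)), a (lieGen k f p hp) = b (lieGen k f p hp)) :
    a = b := by
  refine LinearMap.ext fun s => ?_
  induction s using lieHom_induction with
  | gen f p hp => exact h f p hp
  | zero => rw [map_zero, map_zero]
  | add s t hs ht => rw [map_add, map_add, hs, ht]
  | smul c s hs => rw [map_smul, map_smul, hs]

lemma lieComp_gen {n m l : ℕ} (f : Fin n → Fin m) (P : Fin m → Lie k n)
    (hP : ∀ j, LieMonomial k n (fib f j) (P j)) (t : lieHom k m l) :
    lieComp (lieGen k f P hP) t = PiTensorProduct.map (fun _ : Fin l => lieSub P) t.1 :=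
  PiTensorProduct.lift.tprod _

lemma lieComp_mem {n m l : ℕ} (s : lieHom k n m) (t : lieHom k m l) :
    lieComp s t ∈ lieHom k n l := by
  induction s using lieHom_induction with
  | gen f P hP =>
    rw [lieComp_gen]
    have : lieHom k m l ≤
        (lieHom k n l).comap (PiTensorProduct.map fun _ : Fin l => lieSub P) := by
      refine Submodule.span_le.2 ?_
      rintro _ ⟨g, q, hq, rfl⟩
      refine Submodule.subset_span ⟨g ∘ f, _, fun j => lieMonomial_lieSub f hP (hq j), ?_⟩
      rw [PiTensorProduct.map_tprod]
    exact this t.2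
  | zero =>
    rw [lieComp, ZeroMemClass.coe_zero, map_zero]
    exact zero_mem _
  | add s s' hs hs' =>
    rw [lieComp, Submodule.coe_add, map_add]
    exact add_mem hs hs'
  | smul c s hs =>
    rw [lieComp, Submodule.coe_smul, map_smul]
    exact Submodule.smul_mem _ c hs

/-- Composition as a bilinear map. -/
def lieCompL (n m l : ℕ) : lieHom k n m →ₗ[k] lieHom k m l →ₗ[k] lieHom k n l :=
  LinearMap.mk₂ k (fun s t => ⟨lieComp s t, lieComp_mem s t⟩)
    (fun s s' _ => Subtype.ext (map_add (PiTensorProduct.lift _) s.1 s'.1))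
    (fun c s _ => Subtype.ext (map_smul (PiTensorProduct.lift _) c s.1))
    (fun s t t' => Subtype.ext (by
      have : (hasDeg_lieHom n (t + t').2).multilinear =
          (hasDeg_lieHom n t.2).multilinear + (hasDeg_lieHom n t'.2).multilinear :=
        MultilinearMap.ext fun P =>
          map_add (PiTensorProduct.map fun _ : Fin l => lieSub P) t.1 t'.1
      change lieComp _ _ = _
      rw [lieComp, this, map_add]; rfl))
    (fun c s t => Subtype.ext (by
      have : (hasDeg_lieHom n (c • t).2).multilinear = c • (hasDeg_lieHom n t.2).multilinear :=
        MultilinearMap.ext fun P =>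
          map_smul (PiTensorProduct.map fun _ : Fin l => lieSub P) c t.1
      change lieComp _ _ = _
      rw [lieComp, this, map_smul]; rfl))

lemma lieCompL_gen {n m l : ℕ} (f : Fin n → Fin m) (P : Fin m → Lie k n)
    (hP : ∀ j, LieMonomial k n (fib f j) (P j)) (t : lieHom k m l) :
    (lieCompL n m l (lieGen k f P hP) t).1 = PiTensorProduct.map (fun _ : Fin l => lieSub P) t.1 :=
  lieComp_gen f P hP t

lemma lieMonomial_comp {n m l : ℕ} {f : Fin n → Fin m} {P : Fin m → Lie k n}
    (hP : ∀ j, LieMonomial k n (fib f j) (P j)) {g : Fin m → Fin l} {Q : Fin l → Lie k m}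
    (hQ : ∀ j, LieMonomial k m (fib g j) (Q j)) (j : Fin l) :
    LieMonomial k n (fib (g ∘ f) j) (lieSub P (Q j)) :=
  lieMonomial_lieSub f hP (hQ j)

lemma lieCompL_gen_gen {n m l : ℕ} (f : Fin n → Fin m) (P : Fin m → Lie k n)
    (hP : ∀ j, LieMonomial k n (fib f j) (P j)) (g : Fin m → Fin l) (Q : Fin l → Lie k m)
    (hQ : ∀ j, LieMonomial k m (fib g j) (Q j)) :
    lieCompL n m l (lieGen k f P hP) (lieGen k g Q hQ) =
      lieGen k (g ∘ f) (fun j => lieSub P (Q j)) (lieMonomial_comp hP hQ) :=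
  Subtype.ext ((lieCompL_gen f P hP _).trans (PiTensorProduct.map_tprod _ _))

variable (k) in
/-- The identity `x_1 ⊗ ⋯ ⊗ x_n`. -/
def lieId (n : ℕ) : lieHom k n n :=
  lieGen k id (FreeLieAlgebra.of k) fun j => by
    convert LieMonomial.var j using 1
    funext i
    simp [fib, Pi.single_apply]

end LieOperad

/-- The category associated to the Lie operad; its objects are the natural numbers. -/
structure CatLie (k : Type u) where
  /-- the underlying natural number -/
  rank : ℕ

section CatLie
variable {k : Type u} [CommRing k]

instance : Category (CatLie k) where
  Hom n m := lieHom k n.rank m.rank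
  id n := lieId k n.rank
  comp s t := lieCompL _ _ _ s t
  id_comp t := Subtype.ext (by
    rw [lieId, lieCompL_gen, lieSub_id, PiTensorProduct.map_id]; rfl)
  comp_id {n m} s := by
    have : (lieCompL n.rank m.rank m.rank).flip (lieId k _) = LinearMap.id :=
      lieHom_ext fun f P hP => by
        rw [LinearMap.flip_apply, lieId, lieCompL_gen_gen]
        exact Subtype.ext (by simp [lieGen])
    exact LinearMap.congr_fun this s
  assoc {n m r l} s t v := by
    have : (lieCompL n.rank r.rank l.rank).flip v ∘ₗ (lieCompL n.rank m.rank r.rank).flip t =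
        (lieCompL n.rank m.rank l.rank).flip (lieCompL _ _ _ t v) :=
      lieHom_ext fun f P hP => by
        have : (lieCompL n.rank r.rank l.rank).flip v ∘ₗ lieCompL _ _ _ (lieGen k f P hP) =
            lieCompL _ _ _ (lieGen k f P hP) ∘ₗ (lieCompL m.rank r.rank l.rank).flip v :=
          lieHom_ext fun g Q hQ => by
            simp only [LinearMap.comp_apply, LinearMap.flip_apply, lieCompL_gen_gen]
            refine Subtype.ext ?_
            simp only [lieCompL_gen]
            rw [← LinearMap.comp_apply, ← PiTensorProduct.map_comp]
            simp only [lieSub_comp]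
        exact LinearMap.congr_fun this t
    exact LinearMap.congr_fun this s

instance : Preadditive (CatLie k) where
  homGroup n m := inferInstanceAs (AddCommGroup (lieHom k n.rank m.rank))
  add_comp _ _ _ s s' t := LinearMap.map_add₂ (lieCompL (k := k) _ _ _) s s' t
  comp_add n m r s t t' := (lieCompL (k := k) n.rank m.rank r.rank s).map_add t t'

instance : Linear k (CatLie k) where
  homModule n m := inferInstanceAs (Module k (lieHom k n.rank m.rank))
  smul_comp _ _ _ c s t := LinearMap.map_smul₂ (lieCompL (k := k) _ _ _) c s t
  comp_smul n m r s c t := (lieCompL (k := k) n.rank m.rank r.rank s).map_smul c t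

end CatLie

section ToAlg
variable {k : Type u} [CommRing k]

attribute [local instance 100] LieRing.ofAssociativeRing

variable (k) in
/-- The map from the free Lie algebra to the free associative algebra, for the Lie bracket
`[a, b] = a b - b a`, with `x_i ↦ x_i`. -/
def toAlg (n : ℕ) : Lie k n →ₗ[k] Alg k n :=
  (FreeLieAlgebra.lift k (FreeAlgebra.ι k) : Lie k n →ₗ⁅k⁆ Alg k n)

@[simp] lemma toAlg_of {n : ℕ} (i : Fin n) : toAlg k n (FreeLieAlgebra.of k i) = FreeAlgebra.ι k i :=
  FreeLieAlgebra.lift_of_apply (FreeAlgebra.ι k) i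

lemma toAlg_lie {n : ℕ} (a b : Lie k n) :
    toAlg k n ⁅a, b⁆ = toAlg k n a * toAlg k n b - toAlg k n b * toAlg k n a :=
  LieHom.map_lie (FreeLieAlgebra.lift k (FreeAlgebra.ι k)) a b

/-- The substitution `x_i ↦ P_i` in associative polynomials. -/
def algSub {m n : ℕ} (P : Fin m → Alg k n) : Alg k m →ₐ[k] Alg k n := FreeAlgebra.lift k P

lemma algSub_toAlg {m n : ℕ} (P : Fin m → Lie k n) (q : Lie k m) :
    algSub (fun i => toAlg k n (P i)) (toAlg k m q) = toAlg k n (lieSub P q) := by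
  have : (algSub fun i => toAlg k n (P i)).toLieHom.comp (FreeLieAlgebra.lift k (FreeAlgebra.ι k)) =
      (FreeLieAlgebra.lift k (FreeAlgebra.ι k)).comp (FreeLieAlgebra.lift k P) :=
    FreeLieAlgebra.hom_ext fun i => by simp [algSub, toAlg]
  exact LieHom.congr_fun this q

end ToAlg

section RightAction
variable {k : Type u} [CommRing k]

/-- The functions of several vectors that have degree `d i` in the `i`-th vector whenever
`d i ≤ 1`. -/
def hasDegSubmodule {m : ℕ} {V W : Type u} [AddCommGroup V] [Module k V] [Ring W] [Algebra k W]
    (d : Fin m → ℕ) : Submodule k ((Fin m → V) → W) where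
  carrier := {g | HasDeg (k := k) d g}
  zero_mem' := ⟨by simp, by simp, by simp⟩
  add_mem' {f g} hf hg := ⟨fun i hi P x => by simp [hf.const i hi, hg.const i hi],
    fun i hi P x y => by simp only [Pi.add_apply, hf.add i hi, hg.add i hi]; abel,
    fun i hi P c x => by simp only [Pi.add_apply, hf.smul i hi, hg.smul i hi, smul_add]⟩
  smul_mem' c f hf := ⟨fun i hi P x => by simp [hf.const i hi],
    fun i hi P x y => by simp only [Pi.smul_apply, hf.add i hi, smul_add],
    fun i hi P c' x => by simp only [Pi.smul_apply, hf.smul i hi, smul_comm c c']⟩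

instance hasDegSubmodule_graded {m : ℕ} {V W : Type u} [AddCommGroup V] [Module k V] [Ring W]
    [Algebra k W] : SetLike.GradedMonoid (hasDegSubmodule (k := k) (m := m) (V := V) (W := W)) where
  one_mem := ⟨by simp, by simp, by simp⟩
  mul_mem := by
    intro d e f g hf hg
    refine ⟨fun i hi P x => ?_, fun i hi P x y => ?_, fun i hi P c x => ?_⟩
    · rw [Pi.add_apply, Nat.add_eq_zero_iff] at hi
      simp only [Pi.mul_apply, hf.const i hi.1, hg.const i hi.2]
    · rw [Pi.add_apply, Nat.add_eq_one_iff] at hi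
      rcases hi with hi | hi
      · simp only [Pi.mul_apply, hf.const i hi.1, hg.add i hi.2, mul_add]
      · simp only [Pi.mul_apply, hf.add i hi.1, hg.const i hi.2, add_mul]
    · rw [Pi.add_apply, Nat.add_eq_one_iff] at hi
      rcases hi with hi | hi
      · simp only [Pi.mul_apply, hf.const i hi.1, hg.smul i hi.2, mul_smul_comm]
      · simp only [Pi.mul_apply, hf.smul i hi.1, hg.const i hi.2, smul_mul_assoc]

lemma hasDeg_algSub {m l : ℕ} (n : ℕ) {t : TPow k (Alg k m) l} (ht : t ∈ multilin k m l) :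
    HasDeg (k := k) (fun _ => 1) fun P : Fin m → Alg k n => TPow.map l (algSub P) t := by
  refine map_homog hasDegSubmodule
    (AlgHom.pi fun P : Fin m → Alg k n => TPow.map l (algSub P)) (fun j a => ?_) ht
  have : (AlgHom.pi fun P : Fin m → Alg k n => TPow.map l (algSub P))
      (TPow.single j (FreeAlgebra.ι k a)) = fun P => TPow.single j (P a) := by
    funext P
    simp [algSub]
  rw [this]
  have key : ∀ i, (Pi.single a 1 : Fin m → ℕ) i = 1 → i = a := by
    intro i h
    by_contra h'
    simp [Pi.single_eq_of_ne h'] at h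
  refine ⟨fun i hi P x => ?_, fun i hi P x y => ?_, fun i hi P c x => ?_⟩
  · have : a ≠ i := by rintro rfl; simp at hi
    simp [Function.update_of_ne this]
  · simp [key i hi]
  · simp [key i hi]

/-- The linear map on the tensor power induced by a multilinear map. -/
def TPow.liftM {n m : ℕ} {M : Type u} [AddCommGroup M] [Module k M]
    (g : MultilinearMap k (fun _ : Fin m => Alg k n) M) : TPow k (Alg k n) m →ₗ[k] M :=
  PiTensorProduct.lift g

lemma TPow.liftM_tprod {n m : ℕ} {M : Type u} [AddCommGroup M] [Module k M]
    (g : MultilinearMap k (fun _ : Fin m => Alg k n) M) (P : Fin m → Alg k n) :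
    TPow.liftM g (TPow.tprod k P) = g P :=
  PiTensorProduct.lift.tprod _

lemma TPow.lin_ext {n m : ℕ} {M : Type u} [AddCommGroup M] [Module k M]
    {f g : TPow k (Alg k n) m →ₗ[k] M} (h : ∀ P, f (TPow.tprod k P) = g (TPow.tprod k P)) :
    f = g :=
  PiTensorProduct.ext (MultilinearMap.ext h)

/-- Substitution in multilinear tensors: for `s = P_1 ⊗ ⋯ ⊗ P_m` and `t = q_1 ⊗ ⋯ ⊗ q_l` the result
is `q_1(P_1, …, P_m) ⊗ ⋯ ⊗ q_l(P_1, …, P_m)`. -/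
def algSubst (n m l : ℕ) :
    TPow k (Alg k n) m →ₗ[k] multilin k m l →ₗ[k] TPow k (Alg k n) l :=
  LinearMap.mk₂ k (fun s t => TPow.liftM (hasDeg_algSub n t.2).multilinear s)
    (fun s s' _ => map_add _ s s') (fun c s _ => map_smul _ c s)
    (fun s t t' => by
      have : TPow.liftM (hasDeg_algSub n (t + t').2).multilinear =
          TPow.liftM (hasDeg_algSub n t.2).multilinear +
          TPow.liftM (hasDeg_algSub n t'.2).multilinear :=
        TPow.lin_ext fun P => by
          rw [LinearMap.add_apply, TPow.liftM_tprod, TPow.liftM_tprod, TPow.liftM_tprod]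
          exact map_add (TPow.map l (algSub P)) t.1 t'.1
      rw [this]; rfl)
    (fun c s t => by
      have : TPow.liftM (hasDeg_algSub n (c • t).2).multilinear =
          c • TPow.liftM (hasDeg_algSub n t.2).multilinear :=
        TPow.lin_ext fun P => by
          rw [LinearMap.smul_apply, TPow.liftM_tprod, TPow.liftM_tprod]
          exact map_smul (TPow.map l (algSub P)) c t.1
      rw [this]; rfl)

lemma algSubst_tprod {n m l : ℕ} (P : Fin m → Alg k n) (t : multilin k m l) :
    algSubst n m l (TPow.tprod k P) t = TPow.map l (algSub P) t.1 :=
  TPow.liftM_tprod _ _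

variable (k) in
/-- The map `p_1 ⊗ ⋯ ⊗ p_m ↦ p_1 ⊗ ⋯ ⊗ p_m` that regards Lie polynomials as associative ones. -/
def toAlgT (n m : ℕ) : lieHom k n m →ₗ[k] TPow k (Alg k n) m :=
  (PiTensorProduct.map (fun _ : Fin m => toAlg k n)) ∘ₗ (lieHom k n m).subtype

lemma toAlgT_gen {n m : ℕ} (f : Fin n → Fin m) (p : Fin m → Lie k n)
    (h : ∀ j, LieMonomial k n (fib f j) (p j)) :
    toAlgT k n m (lieGen k f p h) = TPow.tprod k fun j => toAlg k n (p j) :=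
  PiTensorProduct.map_tprod _ _

lemma single_toAlg_mem {n l : ℕ} (j : Fin l) {d : Fin n → ℕ} {p : Lie k n}
    (hp : LieMonomial k n d p) : TPow.single j (toAlg k n p) ∈ homog k n l d := by
  induction hp with
  | var i => rw [toAlg_of]; exact single_mem_homog j i
  | @bracket d e a b _ _ ha hb =>
    rw [toAlg_lie, map_sub, map_mul, map_mul]
    refine sub_mem (SetLike.GradedMul.mul_mem ha hb) ?_
    rw [add_comm]
    exact SetLike.GradedMul.mul_mem hb ha

/-- The multigrading, with degrees pulled back along `f`. -/
def homogPull (k : Type u) [CommRing k] {n m : ℕ} (l : ℕ) (f : Fin n → Fin m) (d : Fin m → ℕ) :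
    Submodule k (TPow k (Alg k n) l) :=
  homog k n l (d ∘ f)

instance homogPull_graded {n m : ℕ} (l : ℕ) (f : Fin n → Fin m) :
    SetLike.GradedMonoid (homogPull k l f) where
  one_mem := SetLike.GradedOne.one_mem (A := homog k n l)
  mul_mem := fun _ _ _ _ ha hb => SetLike.GradedMul.mul_mem (A := homog k n l) ha hb

lemma algSubst_mem {n m l : ℕ} (a : lieHom k n m) (t : multilin k m l) :
    algSubst n m l (toAlgT k n m a) t ∈ multilin k n l := by
  induction a using lieHom_induction with
  | gen f P hP =>
    rw [toAlgT_gen, algSubst_tprod]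
    have h : ∀ (j : Fin l) (i : Fin m), TPow.map l (algSub fun i => toAlg k n (P i))
        (TPow.single j (FreeAlgebra.ι k i)) ∈ homogPull k l f (Pi.single i 1) := by
      intro j i
      have e : (Pi.single i 1 : Fin m → ℕ) ∘ f = fib f i := by
        funext b
        simp [fib, Pi.single_apply]
      rw [TPow.map_single, algSub, FreeAlgebra.lift_ι_apply, homogPull, e]
      exact single_toAlg_mem j (hP i)
    exact map_homog (d := fun _ => 1) (homogPull k l f) _ h t.2
  | zero => rw [map_zero, map_zero, LinearMap.zero_apply]; exact zero_mem _
  | add s t hs ht => rw [map_add, map_add, LinearMap.add_apply]; exact add_mem hs ht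
  | smul c s hs => rw [map_smul, map_smul, LinearMap.smul_apply]; exact Submodule.smul_mem _ c hs

/-- The right action of morphisms of the Lie category on multilinear tensors, by substitution. -/
def rightAct (n m l : ℕ) : lieHom k n m →ₗ[k] multilin k m l →ₗ[k] multilin k n l :=
  LinearMap.mk₂ k (fun a t => ⟨algSubst n m l (toAlgT k n m a) t, algSubst_mem a t⟩)
    (fun a b t => Subtype.ext (by simp))
    (fun c a t => Subtype.ext (by simp))
    (fun a t t' => Subtype.ext (by simp))
    (fun c a t => Subtype.ext (by simp))

lemma rightAct_gen {n m l : ℕ} (f : Fin n → Fin m) (P : Fin m → Lie k n)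
    (hP : ∀ j, LieMonomial k n (fib f j) (P j)) (t : multilin k m l) :
    (rightAct n m l (lieGen k f P hP) t).1 =
      TPow.map l (algSub fun i => toAlg k n (P i)) t.1 := by
  change algSubst n m l (toAlgT k n m _) t = _
  rw [toAlgT_gen, algSubst_tprod]

lemma comul_toAlg {n : ℕ} {d : Fin n → ℕ} {p : Lie k n} (hp : LieMonomial k n d p) :
    comul (R := k) (toAlg k n p) = toAlg k n p ⊗ₜ[k] 1 + 1 ⊗ₜ[k] toAlg k n p := by
  induction hp with
  | var i => rw [toAlg_of, comul_ι]
  | bracket _ _ ha hb =>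
    rw [toAlg_lie, map_sub, Bialgebra.comul_mul, Bialgebra.comul_mul, ha, hb]
    simp only [mul_add, add_mul, Algebra.TensorProduct.tmul_mul_tmul, one_mul, mul_one,
      TensorProduct.sub_tmul, TensorProduct.tmul_sub]
    abel

lemma counit_toAlg {n : ℕ} {d : Fin n → ℕ} {p : Lie k n} (hp : LieMonomial k n d p) :
    counit (R := k) (toAlg k n p) = 0 := by
  cases hp with
  | var i => rw [toAlg_of, counit_ι]
  | bracket _ _ =>
    rw [toAlg_lie, map_sub, Bialgebra.counit_mul, Bialgebra.counit_mul, mul_comm, sub_self]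

/-- The substitution of Lie monomials is a bialgebra map. -/
def algSubB {n m : ℕ} (f : Fin n → Fin m) (P : Fin m → Lie k n)
    (hP : ∀ j, LieMonomial k n (fib f j) (P j)) : Alg k m →ₐc[k] Alg k n :=
  BialgHom.ofAlgHom (algSub fun i => toAlg k n (P i))
    (FreeAlgebra.hom_ext (funext fun i => by
      simp [algSub, counit_toAlg (hP i)]))
    (FreeAlgebra.hom_ext (funext fun i => by
      simp [algSub, comul_toAlg (hP i)]))

end RightAction

/-- The opposite of the category of finitely generated free groups, with the natural numbers as
objects: a morphism `n ⟶ m` is a group homomorphism from the free group on `x_1, …, x_m` to the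
free group on `x_1, …, x_n`. -/
structure GrOp where
  /-- the rank of the free group -/
  rank : ℕ

instance : Category GrOp where
  Hom n m := FreeGroup (Fin m.rank) →* FreeGroup (Fin n.rank)
  id n := MonoidHom.id _
  comp f g := f.comp g

section Bimodule
variable (k : Type u) [CommRing k]

/-- The action of a morphism of `GrOp` on multilinear tensors. -/
def leftAct (n : ℕ) {m l : ℕ} (ρ : FreeGroup (Fin l) →* FreeGroup (Fin m)) :
    multilin k n m →ₗ[k] multilin k n l :=
  (TPow.act ρ).restrict fun _ ht => act_mem_homog ρ ht

lemma leftAct_coe (n : ℕ) {m l : ℕ} (ρ : FreeGroup (Fin l) →* FreeGroup (Fin m))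
    (t : multilin k n m) : (leftAct k n ρ t).1 = TPow.act ρ t.1 := rfl

lemma leftAct_rightAct {n m l r : ℕ} (a : lieHom k n m)
    (ρ : FreeGroup (Fin r) →* FreeGroup (Fin l)) :
    leftAct k n ρ ∘ₗ rightAct n m l a = rightAct n m r a ∘ₗ leftAct k m ρ := by
  refine LinearMap.ext fun t => ?_
  change ((leftAct k n ρ) ∘ₗ (rightAct n m l).flip t) a =
    ((rightAct n m r).flip (leftAct k m ρ t)) a
  congr 1
  refine lieHom_ext fun f P hP => Subtype.ext ?_
  rw [LinearMap.comp_apply, LinearMap.flip_apply, LinearMap.flip_apply, rightAct_gen,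
    leftAct_coe, leftAct_coe, rightAct_gen]
  exact (LinearMap.congr_fun (TPow.act_natural (algSubB f P hP) ρ) t.1).symm

lemma rightAct_id (n l : ℕ) (t : multilin k n l) : rightAct n n l (lieId k n) t = t := by
  refine Subtype.ext ?_
  rw [lieId, rightAct_gen]
  have : TPow.map l (algSub fun i : Fin n => toAlg k n (FreeLieAlgebra.of k i)) = AlgHom.id k _ := by
    refine TPow.hom_ext fun j a => ?_
    rw [TPow.map_single]
    have : (algSub fun i : Fin n => toAlg k n (FreeLieAlgebra.of k i)) = AlgHom.id k _ :=
      FreeAlgebra.hom_ext (funext fun i => by simp [algSub])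
    rw [this]; rfl
  rw [this]; rfl

lemma map_algSub_comp {n m r l : ℕ} (P : Fin m → Lie k n) (Q : Fin r → Lie k m)
    (t : TPow k (Alg k r) l) :
    TPow.map l (algSub fun i => toAlg k n (P i)) (TPow.map l (algSub fun i => toAlg k m (Q i)) t) =
      TPow.map l (algSub fun i => toAlg k n (lieSub P (Q i))) t := by
  rw [← AlgHom.comp_apply]
  congr 1
  refine TPow.hom_ext fun j a => ?_
  simp only [AlgHom.comp_apply, TPow.map_single]
  rw [← AlgHom.comp_apply (algSub _)]
  congr 2
  refine FreeAlgebra.hom_ext (funext fun i => ?_)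
  simp only [AlgHom.coe_comp, Function.comp_apply]
  rw [algSub, algSub, FreeAlgebra.lift_ι_apply]
  change algSub _ _ = _
  rw [algSub_toAlg, algSub, FreeAlgebra.lift_ι_apply]

lemma rightAct_comp {n m r l : ℕ} (a : lieHom k n m) (b : lieHom k m r) (t : multilin k r l) :
    rightAct n r l (lieCompL n m r a b) t = rightAct n m l a (rightAct m r l b t) := by
  change ((rightAct n r l).flip t ∘ₗ (lieCompL n m r).flip b) a =
    (rightAct n m l).flip (rightAct m r l b t) a
  congr 1
  refine lieHom_ext fun f P hP => ?_
  change ((rightAct n r l).flip t ∘ₗ lieCompL n m r (lieGen k f P hP)) b =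
    (rightAct n m l (lieGen k f P hP) ∘ₗ (rightAct m r l).flip t) b
  congr 1
  refine lieHom_ext fun g Q hQ => Subtype.ext ?_
  simp only [LinearMap.comp_apply, LinearMap.flip_apply]
  rw [lieCompL_gen_gen, rightAct_gen, rightAct_gen, rightAct_gen, map_algSub_comp]

/-- The left `GrOp`-module of multilinear tensors in `n` variables. -/
def catAss (n : ℕ) : GrOp ⥤ ModuleCat.{u} k where
  obj m := ModuleCat.of k (multilin k n m.rank)
  map ρ := ModuleCat.ofHom (leftAct k n ρ)
  map_id _ := ModuleCat.hom_ext (LinearMap.ext fun t => Subtype.ext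
    (LinearMap.congr_fun TPow.act_id t.1))
  map_comp ρ σ := ModuleCat.hom_ext (LinearMap.ext fun t => Subtype.ext
    (LinearMap.congr_fun (TPow.act_comp ρ σ) t.1))

/-- The multilinear tensors in all numbers of variables, as a bimodule: a left module over `GrOp`
and a right module over the Lie category. -/
def catAssBimod : (CatLie k)ᵒᵖ ⥤ GrOp ⥤ ModuleCat.{u} k where
  obj n := catAss k n.unop.rank
  map a :=
    { app := fun m => ModuleCat.ofHom (rightAct _ _ m.rank a.unop)
      naturality := fun _ _ ρ => ModuleCat.hom_ext (leftAct_rightAct k a.unop ρ).symm }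
  map_id _ := NatTrans.ext (funext fun _ => ModuleCat.hom_ext (LinearMap.ext fun t =>
    rightAct_id k _ _ t))
  map_comp a b := NatTrans.ext (funext fun _ => ModuleCat.hom_ext (LinearMap.ext fun t =>
    rightAct_comp k b.unop a.unop t))

end Bimodule

section LinearExtension
variable {k : Type u} [CommRing k]

variable (k) in
/-- The basis of the tensor power given by the tensors of words. -/
def wordBasis (n m : ℕ) : Module.Basis (Fin m → FreeMonoid (Fin n)) k (TPow k (Alg k n) m) :=
  Basis.piTensorProduct fun _ : Fin m => FreeAlgebra.basisFreeMonoid k (Fin n)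

lemma wordBasis_apply {n m : ℕ} (w : Fin m → FreeMonoid (Fin n)) :
    wordBasis k n m w = wordTensor k n m w := by
  refine (Basis.piTensorProduct_apply _ w).trans ?_
  change TPow.tprod k _ = TPow.tprod k _
  congr 1
  funext j
  change (FreeAlgebra.equivMonoidAlgebraFreeMonoid (R := k) (X := Fin n)).symm
    (MonoidAlgebra.single (w j) 1) = word k n (w j)
  rw [AlgEquiv.symm_apply_eq]
  induction w j using FreeMonoid.inductionOn' with
  | one => rw [map_one, map_one]; rfl
  | of_mul i v ih =>
    rw [map_mul, map_mul, ← ih, word, FreeMonoid.lift_eval_of]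
    simp [FreeAlgebra.equivMonoidAlgebraFreeMonoid, MonoidAlgebra.single_mul_single]

lemma wordTensor_ext {n m : ℕ} {M : Type*} [AddCommGroup M] [Module k M]
    {f g : TPow k (Alg k n) m →ₗ[k] M} (h : ∀ w, f (wordTensor k n m w) = g (wordTensor k n m w)) :
    f = g :=
  (wordBasis k n m).ext fun w => by rw [wordBasis_apply, h]

/-- The morphism `[w_1 | ⋯ | w_m] : n ⟶ m` of `GrOp`, which is the group homomorphism with
`x_j ↦ w_j`. -/
def wordHom {n m : ℕ} (w : Fin m → FreeMonoid (Fin n)) : GrOp.mk n ⟶ GrOp.mk m :=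
  FreeGroup.lift fun j => FreeMonoid.lift FreeGroup.of (w j)

/-- The linear map `F(n) → F(m)` given by the action of the linear combination of morphisms
`[w_1 | ⋯ | w_m]` of `GrOp` that corresponds to a linear combination of tensors
`w_1 ⊗ ⋯ ⊗ w_m` of words. -/
def extMap (F : GrOp ⥤ ModuleCat.{u} k) (n m : ℕ) :
    TPow k (Alg k n) m →ₗ[k] (F.obj ⟨n⟩ →ₗ[k] F.obj ⟨m⟩) :=
  (wordBasis k n m).constr k fun w => (F.map (wordHom w)).hom

lemma extMap_word (F : GrOp ⥤ ModuleCat.{u} k) {n m : ℕ} (w : Fin m → FreeMonoid (Fin n)) :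
    extMap F n m (wordTensor k n m w) = (F.map (wordHom w)).hom := by
  rw [← wordBasis_apply, extMap, Module.Basis.constr_basis]

lemma algSub_word {n m : ℕ} (v : Fin m → FreeMonoid (Fin n)) (w : FreeMonoid (Fin m)) :
    algSub (fun i => word k n (v i)) (word k m w) = word k n (FreeMonoid.lift v w) := by
  have : ((algSub fun i => word k n (v i)) : Alg k m →* Alg k n).comp (word k m) =
      (word k n).comp (FreeMonoid.lift v) := by
    ext i; simp [algSub, word]
  exact DFunLike.congr_fun this w

lemma map_tprod {n m l : ℕ} (g : Alg k m →ₐ[k] Alg k n) (x : Fin l → Alg k m) :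
    TPow.map l g (TPow.tprod k x) = TPow.tprod k fun j => g (x j) := by
  rw [tprod_eq_prod, tprod_eq_prod, map_list_prod, List.map_ofFn]
  congr 2
  funext j
  exact TPow.map_single _ _ _

lemma extMap_algSubst (F : GrOp ⥤ ModuleCat.{u} k) {n m l : ℕ} (s : TPow k (Alg k n) m)
    (t : multilin k m l) :
    extMap F n l (algSubst n m l s t) = extMap F m l t.1 ∘ₗ extMap F n m s := by
  change (extMap F n l ∘ₗ (algSubst n m l).flip t) s =
    ((LinearMap.llcomp k (F.obj ⟨n⟩) (F.obj ⟨m⟩) (F.obj ⟨l⟩) (extMap F m l t.1)) ∘ₗ extMap F n m) s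
  congr 1
  refine wordTensor_ext fun v => ?_
  rw [LinearMap.comp_apply, LinearMap.comp_apply, LinearMap.flip_apply, extMap_word]
  change extMap F n l (algSubst n m l (TPow.tprod k _) t) = extMap F m l t.1 ∘ₗ _
  rw [algSubst_tprod]
  generalize t.1 = t
  change (extMap F n l ∘ₗ (TPow.map l (algSub fun i => word k n (v i))).toLinearMap) t =
    ((LinearMap.lcomp k (F.obj ⟨l⟩) (F.map (wordHom v)).hom) ∘ₗ extMap F m l) t
  congr 1
  refine wordTensor_ext fun w => ?_
  rw [LinearMap.comp_apply, LinearMap.comp_apply, extMap_word]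
  change extMap F n l (TPow.map l _ (TPow.tprod k _)) = (F.map (wordHom w)).hom ∘ₗ _
  rw [map_tprod]
  simp only [algSub_word]
  refine (extMap_word F fun j => FreeMonoid.lift v (w j)).trans ?_
  rw [← ModuleCat.hom_comp, ← F.map_comp]
  congr 2
  refine FreeGroup.ext_hom _ _ fun j => ?_
  change FreeGroup.lift (fun j => FreeMonoid.lift FreeGroup.of (FreeMonoid.lift v (w j)))
    (FreeGroup.of j) = FreeGroup.lift (fun j => FreeMonoid.lift FreeGroup.of (v j))
      (FreeGroup.lift (fun j => FreeMonoid.lift FreeGroup.of (w j)) (FreeGroup.of j))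
  rw [FreeGroup.lift_apply_of, FreeGroup.lift_apply_of]
  have : (FreeMonoid.lift FreeGroup.of).comp (FreeMonoid.lift v) =
      ((FreeGroup.lift fun j => FreeMonoid.lift FreeGroup.of (v j) :
        FreeGroup (Fin m) →* FreeGroup (Fin n))).comp (FreeMonoid.lift FreeGroup.of) := by
    ext i; simp
  exact DFunLike.congr_fun this (w j)

lemma toAlgT_mem {n m : ℕ} (a : lieHom k n m) : toAlgT k n m a ∈ multilin k n m := by
  induction a using lieHom_induction with
  | gen f P hP =>
    rw [toAlgT_gen, tprod_eq_prod]
    have := SetLike.list_prod_ofFn_mem_graded (A := homog k n m) (fib f) _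
      fun j => single_toAlg_mem j (hP j)
    have e : (List.ofFn (fib f)).sum = fun _ => 1 := by
      rw [List.sum_ofFn]
      funext i
      simp [fib]
    rw [e] at this
    exact this
  | zero => rw [map_zero]; exact zero_mem _
  | add s t hs ht => rw [map_add]; exact add_mem hs ht
  | smul c s hs => rw [map_smul]; exact Submodule.smul_mem _ c hs

lemma toAlgT_comp {n m l : ℕ} (a : lieHom k n m) (b : lieHom k m l) :
    toAlgT k n l (lieCompL n m l a b) =
      algSubst n m l (toAlgT k n m a) ⟨toAlgT k m l b, toAlgT_mem b⟩ := by
  have h2 : ∀ b, toAlgT k n l (lieCompL n m l a b) =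
      algSubst n m l (toAlgT k n m a) ((toAlgT k m l).codRestrict _ toAlgT_mem b) := by
    intro b
    change (toAlgT k n l ∘ₗ lieCompL n m l a) b =
      (algSubst n m l (toAlgT k n m a) ∘ₗ (toAlgT k m l).codRestrict _ toAlgT_mem) b
    congr 1
    refine lieHom_ext fun g Q hQ => ?_
    change (toAlgT k n l ∘ₗ (lieCompL n m l).flip (lieGen k g Q hQ)) a =
      ((algSubst n m l).flip ((toAlgT k m l).codRestrict _ toAlgT_mem (lieGen k g Q hQ)) ∘ₗ
        toAlgT k n m) a
    congr 1
    refine lieHom_ext fun f P hP => ?_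
    rw [LinearMap.comp_apply, LinearMap.comp_apply, LinearMap.flip_apply, LinearMap.flip_apply,
      lieCompL_gen_gen, toAlgT_gen, toAlgT_gen, algSubst_tprod, LinearMap.codRestrict_apply,
      toAlgT_gen, map_tprod]
    simp only [algSub_toAlg]
  exact h2 b

lemma toAlgT_id (n : ℕ) : toAlgT k n n (lieId k n) =
    wordTensor k n n (FreeMonoid.of : Fin n → FreeMonoid (Fin n)) := by
  rw [lieId, toAlgT_gen]
  change _ = TPow.tprod k _
  simp [word]

lemma extMap_natural {F G : GrOp ⥤ ModuleCat.{u} k} (φ : F ⟶ G) {n m : ℕ}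
    (t : TPow k (Alg k n) m) (v : F.obj ⟨n⟩) :
    (φ.app ⟨m⟩).hom (extMap F n m t v) = extMap G n m t ((φ.app ⟨n⟩).hom v) := by
  change (LinearMap.llcomp k (F.obj ⟨n⟩) (F.obj ⟨m⟩) (G.obj ⟨m⟩) (φ.app ⟨m⟩).hom ∘ₗ
    extMap F n m) t v = (LinearMap.lcomp k (G.obj ⟨m⟩) (φ.app ⟨n⟩).hom ∘ₗ extMap G n m) t v
  congr 2
  refine wordTensor_ext fun w => ?_
  rw [LinearMap.comp_apply, LinearMap.comp_apply, extMap_word, extMap_word]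
  exact congrArg ModuleCat.Hom.hom (φ.naturality (wordHom w))

end LinearExtension

namespace GrOp

/-- The trivial morphism. -/
def triv (X Y : GrOp) : X ⟶ Y := (1 : FreeGroup (Fin Y.rank) →* FreeGroup (Fin X.rank))

/-- The product `X × X` in `GrOp`. -/
def sq (X : GrOp) : GrOp := ⟨X.rank + X.rank⟩

/-- The group homomorphism that maps both copies of `x_i` to `x_i`. -/
def diagHom (n : ℕ) : FreeGroup (Fin (n + n)) →* FreeGroup (Fin n) :=
  FreeGroup.lift (Fin.addCases FreeGroup.of FreeGroup.of)

/-- The group homomorphism that is trivial on the first copies and the identity on the second. -/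
def killLHom (n : ℕ) : FreeGroup (Fin (n + n)) →* FreeGroup (Fin (n + n)) :=
  FreeGroup.lift (Fin.addCases (fun _ => 1) fun i => FreeGroup.of (Fin.natAdd n i))

/-- The group homomorphism that is trivial on the second copies and the identity on the first. -/
def killRHom (n : ℕ) : FreeGroup (Fin (n + n)) →* FreeGroup (Fin (n + n)) :=
  FreeGroup.lift (Fin.addCases (fun i => FreeGroup.of (Fin.castAdd n i)) fun _ => 1)

@[simp] lemma diagHom_l {n : ℕ} (i : Fin n) :
    diagHom n (FreeGroup.of (Fin.castAdd n i)) = FreeGroup.of i := by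
  rw [diagHom, FreeGroup.lift_apply_of, Fin.addCases_left]

@[simp] lemma diagHom_r {n : ℕ} (i : Fin n) :
    diagHom n (FreeGroup.of (Fin.natAdd n i)) = FreeGroup.of i := by
  rw [diagHom, FreeGroup.lift_apply_of, Fin.addCases_right]

lemma killLHom_l {n : ℕ} (i : Fin n) : killLHom n (FreeGroup.of (Fin.castAdd n i)) = 1 := by
  rw [killLHom, FreeGroup.lift_apply_of, Fin.addCases_left]

lemma killLHom_r {n : ℕ} (i : Fin n) :
    killLHom n (FreeGroup.of (Fin.natAdd n i)) = FreeGroup.of (Fin.natAdd n i) := by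
  rw [killLHom, FreeGroup.lift_apply_of, Fin.addCases_right]

lemma killRHom_l {n : ℕ} (i : Fin n) :
    killRHom n (FreeGroup.of (Fin.castAdd n i)) = FreeGroup.of (Fin.castAdd n i) := by
  rw [killRHom, FreeGroup.lift_apply_of, Fin.addCases_left]

lemma killRHom_r {n : ℕ} (i : Fin n) : killRHom n (FreeGroup.of (Fin.natAdd n i)) = 1 := by
  rw [killRHom, FreeGroup.lift_apply_of, Fin.addCases_right]

/-- The diagonal `X ⟶ X × X`. -/
def diag (X : GrOp) : X ⟶ sq X := diagHom X.rank

/-- The endomorphism of `X × X` that is trivial on the first factor and the identity on the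
second. -/
def killL (X : GrOp) : sq X ⟶ sq X := killLHom X.rank

/-- The endomorphism of `X × X` that is trivial on the second factor and the identity on the
first. -/
def killR (X : GrOp) : sq X ⟶ sq X := killRHom X.rank

/-- The group homomorphism `id * f * id`, where `*` is the free product. -/
def padHom (a b : ℕ) {l m : ℕ} (f : FreeGroup (Fin l) →* FreeGroup (Fin m)) :
    FreeGroup (Fin (a + l + b)) →* FreeGroup (Fin (a + m + b)) :=
  FreeGroup.lift (Fin.addCases (Fin.addCases
    (fun i => FreeGroup.of (Fin.castAdd b (Fin.castAdd m i)))
    fun i => FreeGroup.map (fun y => Fin.castAdd b (Fin.natAdd a y)) (f (FreeGroup.of i)))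
    fun i => FreeGroup.of (Fin.natAdd (a + m) i))

lemma hom_ext_pad {a b l : ℕ} {G : Type*} [Group G] {f g : FreeGroup (Fin (a + l + b)) →* G}
    (h1 : ∀ i : Fin a, f (FreeGroup.of (Fin.castAdd b (Fin.castAdd l i))) =
      g (FreeGroup.of (Fin.castAdd b (Fin.castAdd l i))))
    (h2 : ∀ i : Fin l, f (FreeGroup.of (Fin.castAdd b (Fin.natAdd a i))) =
      g (FreeGroup.of (Fin.castAdd b (Fin.natAdd a i))))
    (h3 : ∀ i : Fin b, f (FreeGroup.of (Fin.natAdd (a + l) i)) =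
      g (FreeGroup.of (Fin.natAdd (a + l) i))) : f = g :=
  FreeGroup.ext_hom _ _ fun i => by
    refine Fin.addCases (fun i => ?_) h3 i
    exact Fin.addCases h1 h2 i

lemma padHom_map (a b : ℕ) {l m : ℕ} (f : FreeGroup (Fin l) →* FreeGroup (Fin m))
    (u : FreeGroup (Fin l)) :
    padHom a b f (FreeGroup.map (fun y => Fin.castAdd b (Fin.natAdd a y)) u) =
      FreeGroup.map (fun y => Fin.castAdd b (Fin.natAdd a y)) (f u) := by
  have : (padHom a b f).comp (FreeGroup.map fun y => Fin.castAdd b (Fin.natAdd a y)) =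
      (FreeGroup.map fun y => Fin.castAdd b (Fin.natAdd a y)).comp f :=
    FreeGroup.ext_hom _ _ fun i => by simp [padHom]
  exact DFunLike.congr_fun this u

/-- The endofunctor `Y ↦ a + Y + b` of `GrOp`. -/
def pad (a b : ℕ) : GrOp ⥤ GrOp where
  obj Y := ⟨a + Y.rank + b⟩
  map f := padHom a b f
  map_id X := hom_ext_pad (fun i => by simp [padHom]; rfl)
    (fun i => by simp [padHom]; rfl) (fun i => by simp [padHom]; rfl)
  map_comp {X Y Z} f g := by
    change padHom a b (MonoidHom.comp f g) = (padHom a b f).comp (padHom a b g)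
    refine hom_ext_pad (fun i => ?_) (fun i => ?_) (fun i => ?_)
    · simp [padHom]
    · rw [MonoidHom.comp_apply]
      conv_rhs => rw [padHom.eq_def a b g]
      rw [FreeGroup.lift_apply_of, Fin.addCases_left, Fin.addCases_right, padHom_map]
      simp [padHom]
    · simp [padHom]

end GrOp

section Primitive
variable {k : Type u} [CommRing k]
open GrOp

/-- The first cross effect `cr¹(G)(X)`, as a submodule of `G(X)`. -/
def crOne (G : GrOp ⥤ ModuleCat.{u} k) (X : GrOp) : Submodule k (G.obj X) :=
  LinearMap.range (LinearMap.id - (G.map (triv X X)).hom)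

/-- The idempotent of `G(X × X)` whose image is the second cross effect. -/
def chi (G : GrOp ⥤ ModuleCat.{u} k) (X : GrOp) : G.obj (sq X) →ₗ[k] G.obj (sq X) :=
  (LinearMap.id - (G.map (killL X)).hom) ∘ₗ (LinearMap.id - (G.map (killR X)).hom)

/-- The largest subfunctor `P₁(G)` of polynomial degree at most one, evaluated at `X`. -/
def polyOne (G : GrOp ⥤ ModuleCat.{u} k) (X : GrOp) : Submodule k (G.obj X) :=
  LinearMap.ker (chi G X ∘ₗ (G.map (diag X)).hom)

/-- The value at `X` of `P₁(cr¹(G))`, as a submodule of `G(X)`. Since `cr¹(G)` is a subfunctor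
of `G`, it is the intersection of `cr¹(G)(X)` and `P₁(G)(X)`. -/
def primOne (G : GrOp ⥤ ModuleCat.{u} k) (X : GrOp) : Submodule k (G.obj X) :=
  crOne G X ⊓ polyOne G X

/-- The primitive part of `F` at `n`: the elements of `F(n)` that, for each decomposition
`n = a + 1 + b`, belong to `P₁(cr¹(G))(1)` for the functor `G(Y) = F(a + Y + b)`. -/
def primPart (F : GrOp ⥤ ModuleCat.{u} k) (n : ℕ) : Submodule k (F.obj ⟨n⟩) :=
  ⨅ (a : ℕ) (b : ℕ) (h : n = a + 1 + b),
    (primOne (pad a b ⋙ F) ⟨1⟩).comap (F.map (eqToHom (congrArg GrOp.mk h))).hom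

/-- The action of a group homomorphism. -/
def ap (F : GrOp ⥤ ModuleCat.{u} k) {n m : ℕ} (ρ : FreeGroup (Fin m) →* FreeGroup (Fin n)) :
    F.obj ⟨n⟩ →ₗ[k] F.obj ⟨m⟩ :=
  (F.map (show GrOp.mk n ⟶ GrOp.mk m from ρ)).hom

lemma ap_ap (F : GrOp ⥤ ModuleCat.{u} k) {n m l : ℕ} (ρ : FreeGroup (Fin m) →* FreeGroup (Fin n))
    (σ : FreeGroup (Fin l) →* FreeGroup (Fin m)) (v : F.obj ⟨n⟩) :
    ap F σ (ap F ρ v) = ap F (ρ.comp σ) v := by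
  have := F.map_comp (show GrOp.mk n ⟶ GrOp.mk m from ρ) (show GrOp.mk m ⟶ GrOp.mk l from σ)
  exact (LinearMap.congr_fun (congrArg ModuleCat.Hom.hom this) v).symm

lemma mem_primOne (G : GrOp ⥤ ModuleCat.{u} k) (X : GrOp) (v : G.obj X) :
    v ∈ primOne G X ↔ (G.map (diag X)).hom v =
      (G.map (diag X ≫ killR X)).hom v + (G.map (diag X ≫ killL X)).hom v := by
  have hc : ∀ {A B C : GrOp} (f : A ⟶ B) (g : B ⟶ C) (w : G.obj A),
      (G.map g).hom ((G.map f).hom w) = (G.map (f ≫ g)).hom w := fun f g w => by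
    rw [G.map_comp]; rfl
  have hr : ∀ {A B C : GrOp} (f : B ⟶ C), triv A B ≫ f = triv A C := fun {A B C} f => by
    change (1 : FreeGroup (Fin B.rank) →* FreeGroup (Fin A.rank)).comp f = 1
    ext; rfl
  have hl : ∀ {A B C : GrOp} (f : A ⟶ B), f ≫ triv B C = triv A C := fun {A B C} f => by
    change (MonoidHom.comp f (1 : FreeGroup (Fin C.rank) →* FreeGroup (Fin B.rank))) = 1
    exact MonoidHom.comp_one _
  have hk : killR X ≫ killL X = triv _ _ := by
    change (killRHom X.rank).comp (killLHom X.rank) = 1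
    refine FreeGroup.ext_hom _ _ fun i => ?_
    refine Fin.addCases (fun i => ?_) (fun i => ?_) i
    · rw [MonoidHom.comp_apply, killLHom_l, map_one]; rfl
    · rw [MonoidHom.comp_apply, killLHom_r, killRHom_r]; rfl
  have hchi : chi G X ((G.map (diag X)).hom v) = (G.map (diag X)).hom v -
      (G.map (diag X ≫ killR X)).hom v - (G.map (diag X ≫ killL X)).hom v +
      (G.map (triv X (sq X))).hom v := by
    simp only [chi, LinearMap.comp_apply, LinearMap.sub_apply, LinearMap.id_apply, map_sub, hc,
      Category.assoc, hk, hl]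
    abel
  rw [primOne, Submodule.mem_inf, polyOne, LinearMap.mem_ker, LinearMap.comp_apply, hchi]
  constructor
  · rintro ⟨⟨w, rfl⟩, h⟩
    have h0 : (G.map (triv X X)).hom
        ((LinearMap.id - (G.map (triv X X)).hom : G.obj X →ₗ[k] G.obj X) w) = 0 := by
      rw [LinearMap.sub_apply, map_sub, hc, hr, LinearMap.id_apply, sub_self]
    have h1 := congrArg (G.map (triv X (sq X))).hom h0
    rw [hc, hr, map_zero] at h1
    rw [h1, add_zero, sub_sub, sub_eq_zero] at h
    exact h
  · intro h
    have h0 := congrArg (G.map (triv (sq X) X)).hom h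
    rw [map_add, hc, hc, hc, hl, hl, hl] at h0
    have h0 := left_eq_add.1 h0
    refine ⟨⟨v, by rw [LinearMap.sub_apply, h0]; simp⟩, ?_⟩
    have h1 := congrArg (G.map (triv X (sq X))).hom h0
    rw [hc, hr, map_zero] at h1
    rw [h1, h]; abel

/-- Doubling of the variable `x_i`: the extra variable is mapped to `x_i`. -/
def dbl {n : ℕ} (i : Fin n) : FreeGroup (Option (Fin n)) →* FreeGroup (Fin n) :=
  FreeGroup.lift fun o => o.elim (FreeGroup.of i) FreeGroup.of

/-- The extra variable is mapped to `1`. -/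
def fst {n : ℕ} : FreeGroup (Option (Fin n)) →* FreeGroup (Fin n) :=
  FreeGroup.lift fun o => o.elim 1 FreeGroup.of

/-- The extra variable is mapped to `x_i`, and `x_i` to `1`. -/
def snd {n : ℕ} (i : Fin n) : FreeGroup (Option (Fin n)) →* FreeGroup (Fin n) :=
  FreeGroup.lift fun o => o.elim (FreeGroup.of i) fun j => if j = i then 1 else FreeGroup.of j

/-- Primitivity in the `i`-th variable. -/
def IsPrimAt (F : GrOp ⥤ ModuleCat.{u} k) {n : ℕ} (i : Fin n) (v : F.obj ⟨n⟩) : Prop :=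
  ∀ (N : ℕ) (ψ : FreeGroup (Fin N) →* FreeGroup (Option (Fin n))),
    ap F ((dbl i).comp ψ) v = ap F (fst.comp ψ) v + ap F ((snd i).comp ψ) v

lemma prim_pad_iff (F : GrOp ⥤ ModuleCat.{u} k) (a b : ℕ) (v : F.obj ⟨a + 1 + b⟩) :
    ap F (padHom a b (diagHom 1)) v = ap F (padHom a b ((diagHom 1).comp (killRHom 1))) v +
      ap F (padHom a b ((diagHom 1).comp (killLHom 1))) v ↔
      IsPrimAt F (Fin.castAdd b (Fin.natAdd a 0)) v := by
  set mid : Fin (a + 1 + b) := Fin.castAdd b (Fin.natAdd a 0) with hmid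
  -- the extra variable is the second of the two middle variables
  set χ : FreeGroup (Option (Fin (a + 1 + b))) →* FreeGroup (Fin (a + (1 + 1) + b)) :=
    FreeGroup.lift fun o => o.elim (FreeGroup.of (Fin.castAdd b (Fin.natAdd a (Fin.natAdd 1 0))))
      (Fin.addCases (Fin.addCases (fun i => FreeGroup.of (Fin.castAdd b (Fin.castAdd _ i)))
        fun _ => FreeGroup.of (Fin.castAdd b (Fin.natAdd a (Fin.castAdd 1 0))))
        fun i => FreeGroup.of (Fin.natAdd _ i)) with hχ
  set χ' : FreeGroup (Fin (a + (1 + 1) + b)) →* FreeGroup (Option (Fin (a + 1 + b))) :=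
    FreeGroup.lift (Fin.addCases (Fin.addCases
      (fun i => FreeGroup.of (some (Fin.castAdd b (Fin.castAdd 1 i))))
      (Fin.addCases (fun _ => FreeGroup.of (some mid)) fun _ => FreeGroup.of none))
      fun i => FreeGroup.of (some (Fin.natAdd _ i))) with hχ'
  have key : ∀ (g : FreeGroup (Fin (1 + 1)) →* FreeGroup (Fin 1))
      (g' : FreeGroup (Option (Fin (a + 1 + b))) →* FreeGroup (Fin (a + 1 + b))),
      (∀ j, j ≠ mid → g' (FreeGroup.of (some j)) = FreeGroup.of j) →
      g' (FreeGroup.of (some mid)) = FreeGroup.map (fun y => Fin.castAdd b (Fin.natAdd a y))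
        (g (FreeGroup.of (Fin.castAdd 1 0))) →
      g' (FreeGroup.of none) = FreeGroup.map (fun y => Fin.castAdd b (Fin.natAdd a y))
        (g (FreeGroup.of (Fin.natAdd 1 0))) →
      (padHom a b g).comp χ = g' ∧ g'.comp χ' = padHom a b g := by
    intro g g' h1 h2 h3
    have n1 : ∀ i : Fin a, Fin.castAdd b (Fin.castAdd 1 i) ≠ mid := fun i h => by
      have := congrArg Fin.val h; simp [hmid] at this; omega
    have n2 : ∀ i : Fin b, Fin.natAdd (a + 1) i ≠ mid := fun i h => by
      have := congrArg Fin.val h; simp [hmid] at this; omega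
    constructor
    · refine FreeGroup.ext_hom _ _ fun o => ?_
      rw [MonoidHom.comp_apply, hχ, FreeGroup.lift_apply_of]
      cases o with
      | none =>
        rw [h3, Option.elim_none, padHom, FreeGroup.lift_apply_of, Fin.addCases_left,
          Fin.addCases_right]
      | some j =>
        rw [Option.elim_some]
        refine Fin.addCases (fun j => ?_) (fun j => ?_) j
        · rw [Fin.addCases_left]
          refine Fin.addCases (fun j => ?_) (fun j => ?_) j
          · rw [Fin.addCases_left, h1 _ (n1 j), padHom, FreeGroup.lift_apply_of,
              Fin.addCases_left, Fin.addCases_left]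
          · rw [Subsingleton.elim j 0, Fin.addCases_right, ← hmid, h2, padHom,
              FreeGroup.lift_apply_of, Fin.addCases_left, Fin.addCases_right]
        · rw [Fin.addCases_right, h1 _ (n2 j), padHom, FreeGroup.lift_apply_of,
            Fin.addCases_right]
    · refine hom_ext_pad (fun i => ?_) (fun i => ?_) (fun i => ?_)
      · rw [MonoidHom.comp_apply, hχ', padHom, FreeGroup.lift_apply_of, FreeGroup.lift_apply_of,
          Fin.addCases_left, Fin.addCases_left, Fin.addCases_left, Fin.addCases_left, h1 _ (n1 i)]
      · rw [MonoidHom.comp_apply, hχ', padHom, FreeGroup.lift_apply_of, FreeGroup.lift_apply_of,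
          Fin.addCases_left, Fin.addCases_left, Fin.addCases_right, Fin.addCases_right]
        refine Fin.addCases (fun i => ?_) (fun i => ?_) i
        · rw [Subsingleton.elim i 0, Fin.addCases_left, h2]
        · rw [Subsingleton.elim i 0, Fin.addCases_right, h3]
      · rw [MonoidHom.comp_apply, hχ', padHom, FreeGroup.lift_apply_of, FreeGroup.lift_apply_of,
          Fin.addCases_right, Fin.addCases_right, h1 _ (n2 i)]
  obtain ⟨kd, kd'⟩ := key (diagHom 1) (dbl mid) (fun j _ => by simp [dbl])
    (by rw [diagHom_l]; simp [dbl, hmid]) (by rw [diagHom_r]; simp [dbl, hmid])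
  obtain ⟨kr, kr'⟩ := key ((diagHom 1).comp (killRHom 1)) fst (fun j _ => by simp [fst])
    (by rw [MonoidHom.comp_apply, killRHom_l, diagHom_l]; simp [fst, hmid])
    (by rw [MonoidHom.comp_apply, killRHom_r]; simp [fst])
  obtain ⟨kl, kl'⟩ := key ((diagHom 1).comp (killLHom 1)) (snd mid) (fun j hj => by simp [snd, hj])
    (by rw [MonoidHom.comp_apply, killLHom_l]; simp [snd])
    (by rw [MonoidHom.comp_apply, killLHom_r, diagHom_r]; simp [snd, hmid])
  constructor
  · intro h N ψ
    have := congrArg (ap F (χ.comp ψ)) h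
    rw [map_add, ap_ap, ap_ap, ap_ap, ← MonoidHom.comp_assoc, ← MonoidHom.comp_assoc,
      ← MonoidHom.comp_assoc, kd, kr, kl] at this
    exact this
  · intro h
    have := h _ χ'
    rw [kd', kr', kl'] at this
    exact this

lemma mem_primOne_pad (F : GrOp ⥤ ModuleCat.{u} k) (a b : ℕ) (v : F.obj ⟨a + 1 + b⟩) :
    v ∈ primOne (pad a b ⋙ F) ⟨1⟩ ↔ IsPrimAt F (Fin.castAdd b (Fin.natAdd a 0)) v :=
  (mem_primOne (pad a b ⋙ F) ⟨1⟩ v).trans (prim_pad_iff F a b v)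

lemma mem_primPart (F : GrOp ⥤ ModuleCat.{u} k) (n : ℕ) (v : F.obj ⟨n⟩) :
    v ∈ primPart F n ↔ ∀ i, IsPrimAt F i v := by
  simp only [primPart, Submodule.mem_iInf]
  constructor
  · intro h i
    obtain ⟨a, b, e, hi⟩ : ∃ (a b : ℕ) (e : a + 1 + b = n),
        Fin.cast e (Fin.castAdd b (Fin.natAdd a 0)) = i :=
      ⟨i, n - 1 - i, by omega, by ext; simp⟩
    subst e
    have := (mem_primOne_pad F a b _).1 (h a b rfl)
    rw [eqToHom_refl, F.map_id] at this
    rw [← hi]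
    exact this
  · intro h a b e
    subst e
    rw [eqToHom_refl, F.map_id]
    exact (mem_primOne_pad F a b _).2 (h _)

end Primitive

section Closure
variable {k : Type u} [CommRing k] (F : GrOp ⥤ ModuleCat.{u} k)

@[simp] lemma dbl_some {n : ℕ} (i j : Fin n) : dbl i (FreeGroup.of (some j)) = FreeGroup.of j := by
  simp [dbl]

@[simp] lemma dbl_none {n : ℕ} (i : Fin n) : dbl i (FreeGroup.of none) = FreeGroup.of i := by
  simp [dbl]

@[simp] lemma fst_some {n : ℕ} (j : Fin n) : fst (FreeGroup.of (some j)) = FreeGroup.of j := by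
  simp [fst]

@[simp] lemma fst_none {n : ℕ} : fst (n := n) (FreeGroup.of none) = 1 := by
  simp [fst]

@[simp] lemma snd_none {n : ℕ} (i : Fin n) : snd i (FreeGroup.of none) = FreeGroup.of i := by
  simp [snd]

@[simp] lemma snd_same {n : ℕ} (i : Fin n) : snd i (FreeGroup.of (some i)) = 1 := by
  simp [snd]

lemma snd_ne {n : ℕ} {i j : Fin n} (h : j ≠ i) :
    snd i (FreeGroup.of (some j)) = FreeGroup.of j := by
  simp [snd, h]

lemma prim_rename {n m : ℕ} {c : Fin m → Fin n} (hc : Function.Injective c) {v : F.obj ⟨n⟩}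
    (hv : ∀ i, IsPrimAt F i v) (i : Fin m) : IsPrimAt F i (ap F (FreeGroup.map c) v) := by
  intro N ψ
  rw [ap_ap, ap_ap, ap_ap]
  have h := hv (c i) N ((FreeGroup.map (Option.map c)).comp ψ)
  have e1 : (FreeGroup.map c).comp (dbl i) = (dbl (c i)).comp (FreeGroup.map (Option.map c)) :=
    FreeGroup.ext_hom _ _ fun o => by cases o <;> simp
  have e2 : (FreeGroup.map c).comp fst = fst.comp (FreeGroup.map (Option.map c)) :=
    FreeGroup.ext_hom _ _ fun o => by cases o <;> simp
  have e3 : (FreeGroup.map c).comp (snd i) = (snd (c i)).comp (FreeGroup.map (Option.map c)) :=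
    FreeGroup.ext_hom _ _ fun o => by
      cases o with
      | none => simp
      | some j =>
        by_cases h : j = i
        · subst h; simp
        · simp [snd_ne h, snd_ne (hc.ne h)]
  rw [← MonoidHom.comp_assoc, ← MonoidHom.comp_assoc, ← MonoidHom.comp_assoc, ← e1, ← e2, ← e3] at h
  exact h

/-- The group homomorphism with `x_j ↦ p` and `x_i ↦ x_{i+1}` for `i ≠ j`. -/
def putHom {m : ℕ} (j : Fin m) (p : FreeGroup (Fin (m + 1))) :
    FreeGroup (Fin m) →* FreeGroup (Fin (m + 1)) :=
  FreeGroup.lift fun i => if i = j then p else FreeGroup.of i.succ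

lemma prim_put_ne {m : ℕ} {j i : Fin m} (hij : i ≠ j) (p : FreeGroup (Fin (m + 1)))
    (hp : snd i.succ (FreeGroup.map some p) = p) {v : F.obj ⟨m + 1⟩} (hv : ∀ i, IsPrimAt F i v) :
    IsPrimAt F i (ap F (putHom j p) v) := by
  intro N ψ
  rw [ap_ap, ap_ap, ap_ap]
  set β : FreeGroup (Option (Fin m)) →* FreeGroup (Option (Fin (m + 1))) :=
    FreeGroup.lift fun o => o.elim (FreeGroup.of none) fun a =>
      if a = j then FreeGroup.map some p else FreeGroup.of (some a.succ) with hβ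
  have hd : dbl i.succ (FreeGroup.map some p) = p := by
    have : (dbl i.succ).comp (FreeGroup.map some) = MonoidHom.id _ :=
      FreeGroup.ext_hom _ _ fun a => by simp
    exact DFunLike.congr_fun this p
  have hf : fst (FreeGroup.map some p) = p := by
    have : (fst (n := m + 1)).comp (FreeGroup.map some) = MonoidHom.id _ :=
      FreeGroup.ext_hom _ _ fun a => by simp
    exact DFunLike.congr_fun this p
  have h := hv i.succ N (β.comp ψ)
  have e1 : (putHom j p).comp (dbl i) = (dbl i.succ).comp β :=
    FreeGroup.ext_hom _ _ fun o => by
      cases o with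
      | none => simp [hβ, putHom, hij]
      | some a => by_cases h : a = j <;> simp [hβ, putHom, h, hd]
  have e2 : (putHom j p).comp fst = fst.comp β :=
    FreeGroup.ext_hom _ _ fun o => by
      cases o with
      | none => simp [hβ]
      | some a => by_cases h : a = j <;> simp [hβ, putHom, h, hf]
  have e3 : (putHom j p).comp (snd i) = (snd i.succ).comp β :=
    FreeGroup.ext_hom _ _ fun o => by
      cases o with
      | none => simp [hβ, putHom, hij]
      | some a =>
        by_cases h : a = j
        · subst h; simp [hβ, putHom, snd_ne hij.symm, hp]
        · by_cases h' : a = i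
          · subst h'; simp [hβ, hij]
          · simp [hβ, putHom, h, snd_ne h', snd_ne (fun e => h' (Fin.succ_injective _ e))]
  rw [← MonoidHom.comp_assoc, ← MonoidHom.comp_assoc, ← MonoidHom.comp_assoc, ← e1, ← e2, ← e3] at h
  exact h

/-- The group homomorphism that maps the extra variable to `p`, `x_j` to `q`, and `x_i` to
`x_{i+1}` for `i ≠ j`. -/
def put2 {m : ℕ} (j : Fin m) (p q : FreeGroup (Fin (m + 1))) :
    FreeGroup (Option (Fin m)) →* FreeGroup (Fin (m + 1)) :=
  FreeGroup.lift fun o => o.elim p fun i => if i = j then q else FreeGroup.of i.succ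

lemma ap_put2 {m : ℕ} {j : Fin m} {v : F.obj ⟨m + 1⟩} (hv : ∀ i, IsPrimAt F i v)
    (a : Fin (m + 1)) (ha : a = 0 ∨ a = j.succ) {N : ℕ}
    (ψ : FreeGroup (Fin N) →* FreeGroup (Option (Fin m)))
    (p q : FreeGroup (Option (Fin (m + 1)))) :
    ap F ((put2 j (dbl a p) (dbl a q)).comp ψ) v =
      ap F ((put2 j (fst p) (fst q)).comp ψ) v + ap F ((put2 j (snd a p) (snd a q)).comp ψ) v := by
  set β : FreeGroup (Option (Fin m)) →* FreeGroup (Option (Fin (m + 1))) :=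
    FreeGroup.lift fun o => o.elim p fun i =>
      if i = j then q else FreeGroup.of (some i.succ) with hβ
  have hne : ∀ i, i ≠ j → i.succ ≠ a := by
    rintro i hi rfl
    rcases ha with h | h
    · exact Fin.succ_ne_zero _ h
    · exact hi (Fin.succ_injective _ h)
  have h := hv a N (β.comp ψ)
  have e1 : put2 j (dbl a p) (dbl a q) = (dbl a).comp β :=
    FreeGroup.ext_hom _ _ fun o => by
      cases o with
      | none => simp [hβ, put2]
      | some i => by_cases h : i = j <;> simp [hβ, put2, h]
  have e2 : put2 j (fst p) (fst q) = fst.comp β :=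
    FreeGroup.ext_hom _ _ fun o => by
      cases o with
      | none => simp [hβ, put2]
      | some i => by_cases h : i = j <;> simp [hβ, put2, h]
  have e3 : put2 j (snd a p) (snd a q) = (snd a).comp β :=
    FreeGroup.ext_hom _ _ fun o => by
      cases o with
      | none => simp [hβ, put2]
      | some i =>
        by_cases h : i = j
        · simp [hβ, put2, h]
        · simp [hβ, put2, h, snd_ne (hne i h)]
  rw [e1, e2, e3]
  exact h

lemma prim_bracket {m : ℕ} (j : Fin m) {v : F.obj ⟨m + 1⟩} (hv : ∀ i, IsPrimAt F i v)
    (i : Fin m) : IsPrimAt F i (ap F (putHom j (FreeGroup.of j.succ * FreeGroup.of 0)) v -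
      ap F (putHom j (FreeGroup.of 0 * FreeGroup.of j.succ)) v) := by
  by_cases hij : i = j
  · subst hij
    intro N ψ
    simp only [map_sub, ap_ap]
    have hd : ∀ p, (putHom i p).comp (dbl i) = put2 i p p := fun p =>
      FreeGroup.ext_hom _ _ fun o => by
        cases o with
        | none => simp [putHom, put2]
        | some a => by_cases h : a = i <;> simp [putHom, put2, h]
    have hf : ∀ p, (putHom i p).comp fst = put2 i 1 p := fun p =>
      FreeGroup.ext_hom _ _ fun o => by
        cases o with
        | none => simp [put2]
        | some a => by_cases h : a = i <;> simp [putHom, put2, h]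
    have hs : ∀ p, (putHom i p).comp (snd i) = put2 i p 1 := fun p =>
      FreeGroup.ext_hom _ _ fun o => by
        cases o with
        | none => simp [putHom, put2]
        | some a =>
          by_cases h : a = i
          · subst h; simp [put2]
          · simp [putHom, put2, h, snd_ne h]
    simp only [← MonoidHom.comp_assoc, hd, hf, hs]
    set X : FreeGroup (Option (Fin (m + 1))) := FreeGroup.of (some 0)
    set Y : FreeGroup (Option (Fin (m + 1))) := FreeGroup.of (some i.succ)
    set Z : FreeGroup (Option (Fin (m + 1))) := FreeGroup.of none
    have n0 : i.succ ≠ 0 := Fin.succ_ne_zero i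
    have a1 := ap_put2 F (j := i) hv 0 (Or.inl rfl) ψ (Y * Z) (Y * X)
    have a2 := ap_put2 F (j := i) hv i.succ (Or.inr rfl) ψ Z (Y * X)
    have a3 := ap_put2 F (j := i) hv i.succ (Or.inr rfl) ψ (Y * X) Z
    have b1 := ap_put2 F (j := i) hv 0 (Or.inl rfl) ψ (Z * Y) (X * Y)
    have b2 := ap_put2 F (j := i) hv i.succ (Or.inr rfl) ψ Z (X * Y)
    have b3 := ap_put2 F (j := i) hv i.succ (Or.inr rfl) ψ (X * Y) Z
    simp only [X, Y, Z, map_mul, dbl_some, dbl_none, fst_some, fst_none, snd_same, snd_none,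
      snd_ne n0, snd_ne n0.symm, mul_one, one_mul] at a1 a2 a3 b1 b2 b3
    rw [a1, a2, a3, b1, b2, b3]
    abel
  · have h1 : ∀ a : Fin m, a.succ ≠ 0 := fun a => Fin.succ_ne_zero a
    have h2 : j.succ ≠ i.succ := fun e => hij (Fin.succ_injective _ e).symm
    have A := prim_put_ne F hij (FreeGroup.of j.succ * FreeGroup.of 0)
      (by simp [snd_ne h2, snd_ne (h1 i).symm]) hv
    have B := prim_put_ne F hij (FreeGroup.of 0 * FreeGroup.of j.succ)
      (by simp [snd_ne h2, snd_ne (h1 i).symm]) hv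
    intro N ψ
    rw [map_sub, map_sub, map_sub, A N ψ, B N ψ]
    abel

lemma extMap_wordTensor {n m : ℕ} (w : Fin m → FreeMonoid (Fin n)) :
    extMap F n m (wordTensor k n m w) =
      ap F (FreeGroup.lift fun j => FreeMonoid.lift FreeGroup.of (w j)) :=
  extMap_word F w

/-- The tuple of words with `p` in position `j` and `x_{i+1}` in position `i ≠ j`. -/
def putWord {m : ℕ} (j : Fin m) (p : FreeMonoid (Fin (m + 1))) :
    Fin m → FreeMonoid (Fin (m + 1)) :=
  fun i => if i = j then p else FreeMonoid.of i.succ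

lemma deg_putWord {m : ℕ} (j : Fin m) (p : FreeMonoid (Fin (m + 1)))
    (hp : ∀ a, p.toList.count a = if a = 0 ∨ a = j.succ then 1 else 0) :
    deg (putWord j p) = fun _ => 1 := by
  funext a
  refine Fin.cases ?_ (fun b => ?_) a
  · rw [deg, Finset.sum_eq_single j]
    · simp [putWord, hp]
    · intro i _ hi
      simp [putWord, hi]
    · simp
  · rw [deg, Finset.sum_eq_single b]
    · by_cases h : b = j
      · simp [putWord, h, hp]
      · simp [putWord, h]
    · intro i _ hi
      by_cases h : i = j
      · subst h
        simp [putWord, hp, hi.symm]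
      · simp [putWord, h, hi]
    · simp

lemma putWord_mem {m : ℕ} (j : Fin m) (p : FreeMonoid (Fin (m + 1)))
    (hp : ∀ a, p.toList.count a = if a = 0 ∨ a = j.succ then 1 else 0) :
    wordTensor k (m + 1) m (putWord j p) ∈ multilin k (m + 1) m :=
  Submodule.subset_span ⟨_, deg_putWord j p hp, rfl⟩

lemma LieMonomial.ne_zero {n : ℕ} {d : Fin n → ℕ} {p : Lie k n} (h : LieMonomial k n d p) :
    ∃ i, d i ≠ 0 := by
  induction h with
  | var i => exact ⟨i, by simp⟩
  | bracket _ _ ih _ => obtain ⟨i, hi⟩ := ih; exact ⟨i, by simp [hi]⟩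

lemma le_of_lieMonomial {n m : ℕ} {f : Fin n → Fin m} {p : Fin m → Lie k n}
    (hp : ∀ j, LieMonomial k n (fib f j) (p j)) : m ≤ n := by
  have : Function.Surjective f := fun j => by
    obtain ⟨i, hi⟩ := (hp j).ne_zero
    exact ⟨i, by by_contra h; simp [fib, h] at hi⟩
  simpa using Fintype.card_le_of_surjective f this

lemma extMap_bracket {n m : ℕ} (j : Fin m) (p : Fin m → Lie k n) (a b : Lie k n)
    (hj : p j = ⁅a, b⁆) (v : F.obj ⟨n⟩) :
    extMap F n m (TPow.tprod k fun i => toAlg k n (p i)) v =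
      ap F (putHom j (FreeGroup.of j.succ * FreeGroup.of 0)) (extMap F n (m + 1)
        (TPow.tprod k fun i => toAlg k n
          ((Fin.cons b (Function.update p j a) : Fin (m + 1) → Lie k n) i)) v) -
      ap F (putHom j (FreeGroup.of 0 * FreeGroup.of j.succ)) (extMap F n (m + 1)
        (TPow.tprod k fun i => toAlg k n
          ((Fin.cons b (Function.update p j a) : Fin (m + 1) → Lie k n) i)) v) := by
  set p' : Fin (m + 1) → Lie k n := Fin.cons b (Function.update p j a) with hp'
  have p0 : p' 0 = b := rfl
  have pj : p' j.succ = a := by simp [hp']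
  have pi : ∀ i, i ≠ j → p' i.succ = p i := fun i hi => by simp [hp', hi]
  have key : ∀ (w : FreeMonoid (Fin (m + 1)))
      (_ : ∀ a, w.toList.count a = if a = 0 ∨ a = j.succ then 1 else 0),
      ap F (putHom j (FreeMonoid.lift FreeGroup.of w)) (extMap F n (m + 1)
        (TPow.tprod k fun i => toAlg k n (p' i)) v) =
      extMap F n m (TPow.tprod k (Function.update (fun i => toAlg k n (p i)) j
        (algSub (fun i => toAlg k n (p' i)) (word k _ w)))) v := by
    intro w hw
    have h := extMap_algSubst F (TPow.tprod k fun i => toAlg k n (p' i))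
      ⟨_, putWord_mem (k := k) j w hw⟩
    rw [algSubst_tprod, extMap_wordTensor] at h
    have e : (FreeGroup.lift fun i => FreeMonoid.lift FreeGroup.of (putWord j w i)) =
        putHom j (FreeMonoid.lift FreeGroup.of w) :=
      FreeGroup.ext_hom _ _ fun i => by
        by_cases h : i = j <;> simp [putHom, putWord, h]
    rw [e] at h
    refine (LinearMap.congr_fun h v).symm.trans ?_
    change extMap F n m (TPow.map m _ (TPow.tprod k _)) v = _
    rw [map_tprod]
    congr 3
    funext i
    by_cases h : i = j
    · subst h; simp [putWord]
    · simp [putWord, h, word, algSub, pi i h]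
  have k1 := key (FreeMonoid.of j.succ * FreeMonoid.of 0) (fun c => by
    rw [FreeMonoid.toList_mul, FreeMonoid.toList_of, FreeMonoid.toList_of, List.count_append,
      List.count_singleton, List.count_singleton]
    have : j.succ ≠ 0 := Fin.succ_ne_zero j
    by_cases h : c = 0
    · subst h; simp [this]
    · by_cases h' : c = j.succ
      · subst h'; simp [this.symm]
      · simp [h, h', Ne.symm h, Ne.symm h'])
  have k2 := key (FreeMonoid.of 0 * FreeMonoid.of j.succ) (fun c => by
    rw [FreeMonoid.toList_mul, FreeMonoid.toList_of, FreeMonoid.toList_of, List.count_append,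
      List.count_singleton, List.count_singleton]
    have : j.succ ≠ 0 := Fin.succ_ne_zero j
    by_cases h : c = 0
    · subst h; simp [this]
    · by_cases h' : c = j.succ
      · subst h'; simp [this.symm]
      · simp [h, h', Ne.symm h, Ne.symm h'])
  simp only [map_mul, FreeMonoid.lift_eval_of, word, algSub, FreeAlgebra.lift_ι_apply, p0, pj]
    at k1 k2
  rw [k1, k2, ← LinearMap.sub_apply, ← map_sub, ← MultilinearMap.map_update_sub, ← toAlg_lie, ← hj]
  congr 3
  exact (Function.update_eq_self j fun i => toAlg k n (p i)).symm

lemma LieMonomial.var_or_bracket {n : ℕ} {d : Fin n → ℕ} {p : Lie k n}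
    (h : LieMonomial k n d p) : (∃ i, d = Pi.single i 1 ∧ p = FreeLieAlgebra.of k i) ∨
      ∃ d₁ d₂ a b, LieMonomial k n d₁ a ∧ LieMonomial k n d₂ b ∧ d = d₁ + d₂ ∧ p = ⁅a, b⁆ := by
  cases h with
  | var i => exact Or.inl ⟨i, rfl, rfl⟩
  | bracket ha hb => exact Or.inr ⟨_, _, _, _, ha, hb, rfl, rfl⟩

lemma prim_tprod_step {n m : ℕ} {v : F.obj ⟨n⟩} (hv : ∀ i, IsPrimAt F i v)
    (ih : ∀ (f : Fin n → Fin (m + 1)) (p : Fin (m + 1) → Lie k n)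
      (_ : ∀ j, LieMonomial k n (fib f j) (p j)) (i : Fin (m + 1)),
      IsPrimAt F i (extMap F n (m + 1) (TPow.tprod k fun i => toAlg k n (p i)) v))
    (f : Fin n → Fin m) (p : Fin m → Lie k n) (hp : ∀ j, LieMonomial k n (fib f j) (p j))
    (i : Fin m) : IsPrimAt F i (extMap F n m (TPow.tprod k fun i => toAlg k n (p i)) v) := by
  by_cases hall : ∀ j, ∃ c, fib f j = Pi.single c 1 ∧ p j = FreeLieAlgebra.of k c
  · choose c hc hpc using hall
    have hfc : ∀ j, f (c j) = j := fun j => by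
      have := congrFun (hc j) (c j)
      by_contra h
      simp [fib, h] at this
    have e : (TPow.tprod k fun i => toAlg k n (p i)) =
        wordTensor k n m fun j => FreeMonoid.of (c j) := by
      change _ = TPow.tprod k _
      simp [hpc, word]
    rw [e, extMap_wordTensor]
    simp only [FreeMonoid.lift_eval_of]
    have e' : (FreeGroup.lift fun j => FreeGroup.of (c j)) = FreeGroup.map c :=
      FreeGroup.ext_hom _ _ fun j => by simp
    rw [e']
    exact prim_rename F (fun a b hab => by rw [← hfc a, hab, hfc]) hv i
  · push Not at hall
    obtain ⟨j, hj⟩ := hall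
    rcases (hp j).var_or_bracket with ⟨c, h1, h2⟩ | ⟨d₁, d₂, a, b, ha, hb, hd, hab⟩
    · exact absurd h2 (hj c h1)
    rw [extMap_bracket F j p a b hab]
    refine prim_bracket F j (ih (fun i => if d₂ i = 0 then (f i).succ else 0) _ ?_) i
    have hd' : ∀ i, d₁ i + d₂ i = if f i = j then 1 else 0 := fun i => (congrFun hd i).symm
    refine Fin.cases ?_ fun c => ?_
    · rw [Fin.cons_zero]
      convert hb using 1
      funext i
      have := hd' i
      by_cases h : d₂ i = 0
      · simp [fib, h]
      · simp only [fib, h, if_false, if_true]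
        split_ifs at this <;> omega
    · rw [Fin.cons_succ]
      by_cases hc : c = j
      · subst hc
        rw [Function.update_self]
        convert ha using 1
        funext i
        have := hd' i
        by_cases h : d₂ i = 0
        · simp only [fib, h, if_true, Fin.succ_inj]
          omega
        · simp only [fib, h, if_false, (Fin.succ_ne_zero c).symm]
          split_ifs at this <;> omega
      · rw [Function.update_of_ne hc]
        convert hp c using 1
        funext i
        have := hd' i
        by_cases h : d₂ i = 0
        · simp only [fib, h, if_true, Fin.succ_inj]
        · have h' : f i = j := by
            by_contra h'
            simp [h'] at this
            exact h this.2
          simp [fib, h, h', Ne.symm hc, (Fin.succ_ne_zero c).symm]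

lemma prim_tprod {n : ℕ} {v : F.obj ⟨n⟩} (hv : ∀ i, IsPrimAt F i v) (N : ℕ) :
    ∀ (m : ℕ) (_ : n ≤ m + N) (f : Fin n → Fin m) (p : Fin m → Lie k n)
      (_ : ∀ j, LieMonomial k n (fib f j) (p j)) (i : Fin m),
      IsPrimAt F i (extMap F n m (TPow.tprod k fun i => toAlg k n (p i)) v) := by
  induction N with
  | zero =>
    intro m h
    refine prim_tprod_step F hv fun f p hp => ?_
    have := le_of_lieMonomial hp
    omega
  | succ N ih =>
    intro m h
    exact prim_tprod_step F hv (ih (m + 1) (by omega))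

/-- The primitive part is stable under the action of the Lie category. -/
lemma extMap_mem_primPart {n m : ℕ} (a : lieHom k n m) {v : F.obj ⟨n⟩} (hv : v ∈ primPart F n) :
    extMap F n m (toAlgT k n m a) v ∈ primPart F m := by
  induction a using lieHom_induction with
  | gen f p hp =>
    rw [mem_primPart] at hv
    rw [toAlgT_gen, mem_primPart]
    exact prim_tprod F hv n m (by omega) f p hp
  | zero => rw [map_zero, map_zero, LinearMap.zero_apply]; exact zero_mem _
  | add s t hs ht => rw [map_add, map_add, LinearMap.add_apply]; exact add_mem hs ht
  | smul c s hs => rw [map_smul, map_smul, LinearMap.smul_apply]; exact Submodule.smul_mem _ c hs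

lemma app_mem_primPart {F G : GrOp ⥤ ModuleCat.{u} k} (φ : F ⟶ G) {n : ℕ} {v : F.obj ⟨n⟩}
    (hv : v ∈ primPart F n) : (φ.app ⟨n⟩).hom v ∈ primPart G n := by
  rw [mem_primPart] at hv ⊢
  have h : ∀ {N : ℕ} (ρ : FreeGroup (Fin N) →* FreeGroup (Fin n)),
      ap G ρ ((φ.app ⟨n⟩).hom v) = (φ.app ⟨N⟩).hom (ap F ρ v) := fun {N} ρ =>
    (LinearMap.congr_fun (congrArg ModuleCat.Hom.hom
      (φ.naturality (show GrOp.mk n ⟶ GrOp.mk N from ρ))) v).symm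
  intro i N ψ
  rw [h, h, h, ← map_add, hv i N ψ]

end Closure

section Functors
variable (k : Type u) [CommRing k]

/-- The property of being `k`-linear, for functors from the Lie category to modules. -/
def linearFunctors : ObjectProperty (CatLie k ⥤ ModuleCat.{u} k) :=
  fun G => G.Additive ∧ G.Linear k

/-- The category of left modules over the Lie category: `k`-linear functors to `k`-modules. -/
abbrev LieMod := (linearFunctors k).FullSubcategory

variable {k}

/-- The left module `n ↦ P(F)(n)` over the Lie category, where a morphism acts through its image
under `Lie → Ass` and the action of `GrOp` on `F`. -/
def primObj (F : GrOp ⥤ ModuleCat.{u} k) : CatLie k ⥤ ModuleCat.{u} k where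
  obj n := ModuleCat.of k (primPart F n.rank)
  map {n m} a := ModuleCat.ofHom ((extMap F n.rank m.rank (toAlgT k n.rank m.rank a)).restrict
    fun _ hv => extMap_mem_primPart F a hv)
  map_id n := ModuleCat.hom_ext (LinearMap.ext fun v => Subtype.ext (by
    change extMap F n.rank n.rank (toAlgT k n.rank n.rank (lieId k n.rank)) v.1 = v.1
    rw [toAlgT_id, extMap_wordTensor]
    simp only [FreeMonoid.lift_eval_of]
    have e : (FreeGroup.lift fun j => FreeGroup.of j) = MonoidHom.id (FreeGroup (Fin n.rank)) :=
      FreeGroup.ext_hom _ _ fun j => by simp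
    rw [e]
    exact LinearMap.congr_fun (congrArg ModuleCat.Hom.hom (F.map_id ⟨n.rank⟩)) v.1))
  map_comp {n m l} a b := ModuleCat.hom_ext (LinearMap.ext fun v => Subtype.ext (by
    change extMap F n.rank l.rank (toAlgT k n.rank l.rank (lieCompL _ _ _ a b)) v.1 = _
    rw [toAlgT_comp, extMap_algSubst]
    rfl))

lemma primObj_linear (F : GrOp ⥤ ModuleCat.{u} k) : linearFunctors k (primObj F) :=
  ⟨⟨fun {n m a b} => ModuleCat.hom_ext (LinearMap.ext fun v => Subtype.ext (by
      change extMap F _ _ (toAlgT k n.rank m.rank (a + b)) v.1 = _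
      rw [map_add, map_add]
      rfl))⟩,
    ⟨fun {n m} a c => ModuleCat.hom_ext (LinearMap.ext fun v => Subtype.ext (by
      change extMap F _ _ (toAlgT k n.rank m.rank (c • a)) v.1 = _
      rw [map_smul, map_smul]
      rfl))⟩⟩

variable (k) in
/-- The functor `F ↦ P(F)` from `GrOp`-modules to modules over the Lie category. -/
def primFunctor : (GrOp ⥤ ModuleCat.{u} k) ⥤ LieMod k :=
  (linearFunctors k).lift
    { obj := primObj
      map := fun φ =>
        { app := fun n => ModuleCat.ofHom ((φ.app ⟨n.rank⟩).hom.restrict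
            fun _ hv => app_mem_primPart φ hv)
          naturality := fun n m a => ModuleCat.hom_ext (LinearMap.ext fun v => Subtype.ext
            (extMap_natural φ (toAlgT k n.rank m.rank a) v.1)) }
      map_id := fun _ => rfl
      map_comp := fun _ _ => rfl }
    primObj_linear

/-- The left module `n ↦ Nat(K(n, -), F)` over the Lie category, where `K(n, -)` is the
`GrOp`-module of multilinear tensors in `n` variables: a morphism `a : n ⟶ m` maps
`ξ : K(n, -) ⟶ F` to its composite with the right action `K(m, -) ⟶ K(n, -)` of `a`. -/
def natObj (F : GrOp ⥤ ModuleCat.{u} k) : CatLie k ⥤ ModuleCat.{u} k where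
  obj n := ModuleCat.of k ((catAssBimod k).obj (Opposite.op n) ⟶ F)
  map a := ModuleCat.ofHom (Linear.leftComp k F ((catAssBimod k).map a.op))
  map_id n := ModuleCat.hom_ext (LinearMap.ext fun ξ => by
    change (catAssBimod k).map (𝟙 n).op ≫ ξ = ξ
    rw [op_id, (catAssBimod k).map_id]
    exact Category.id_comp ξ)
  map_comp a b := ModuleCat.hom_ext (LinearMap.ext fun ξ => by
    change (catAssBimod k).map (a ≫ b).op ≫ ξ = _
    rw [op_comp, (catAssBimod k).map_comp]
    exact Category.assoc _ _ _)

lemma natObj_linear (F : GrOp ⥤ ModuleCat.{u} k) : linearFunctors k (natObj F) := by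
  constructor
  · constructor
    intro n m a b
    have h : (catAssBimod k).map (a + b).op =
        (catAssBimod k).map a.op + (catAssBimod k).map b.op :=
      NatTrans.ext (funext fun l => ModuleCat.hom_ext
        (map_add (rightAct n.rank m.rank l.rank) a b))
    refine ModuleCat.hom_ext (LinearMap.ext fun ξ => ?_)
    change (catAssBimod k).map (a + b).op ≫ ξ = _
    rw [h]
    exact Preadditive.add_comp _ _ _ _ _ ξ
  · constructor
    intro n m a c
    have h : (catAssBimod k).map (c • a).op = c • (catAssBimod k).map a.op :=
      NatTrans.ext (funext fun l => ModuleCat.hom_ext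
        (map_smul (rightAct n.rank m.rank l.rank) c a))
    refine ModuleCat.hom_ext (LinearMap.ext fun ξ => ?_)
    change (catAssBimod k).map (c • a).op ≫ ξ = _
    rw [h]
    exact Linear.smul_comp _ _ _ _ _ ξ

variable (k) in
/-- The functor `F ↦ (n ↦ Nat(K(n, -), F))` from `GrOp`-modules to modules over the Lie
category. -/
def natFunctor : (GrOp ⥤ ModuleCat.{u} k) ⥤ LieMod k :=
  (linearFunctors k).lift
    { obj := natObj
      map := fun φ =>
        { app := fun n => ModuleCat.ofHom (Linear.rightComp k ((catAssBimod k).obj (Opposite.op n)) φ)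
          naturality := fun _ _ a => ModuleCat.hom_ext (LinearMap.ext fun ξ =>
            (Category.assoc ((catAssBimod k).map a.op) ξ φ)) }
      map_id := fun _ => NatTrans.ext (funext fun _ => ModuleCat.hom_ext (LinearMap.ext fun ξ =>
        Category.comp_id ξ))
      map_comp := fun φ χ => NatTrans.ext (funext fun _ => ModuleCat.hom_ext
        (LinearMap.ext fun ξ => (Category.assoc ξ φ χ).symm)) }
    natObj_linear

variable (k) in
/-- The element `x_1 ⊗ ⋯ ⊗ x_n`. -/
def xTensor (n : ℕ) : multilin k n n :=
  ⟨TPow.tprod k fun i => FreeAlgebra.ι k i, by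
    have := toAlgT_mem (lieId k n)
    rw [lieId, toAlgT_gen] at this
    simpa only [toAlg_of] using this⟩

end Functors

end PrimPart

end

/-! Write $X = x_1 \otimes \cdots \otimes x_n$ and $K =
{}_\Delta\mathsf{Cat}_{\mathfrak{Ass}^u}(n,-)$, which is `catAss k n`. The theorem says that $K$ is
freely generated by the primitive element $X$. Three facts make this true.

Generation: if each variable occurs exactly once in the words $w_1,\dots,w_l$, then
$[w_1|\cdots|w_l]$ maps $X$ to $w_1 \otimes \cdots \otimes w_l$ (`act_wordHom`), and such tensors
span $K(l)$. Hence a natural transformation $\xi : K \to F$ is determined by $v = \xi(X)$: it sends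
$t$ to `extMap` of $t$ applied to $v$ (`app_eq_extMap`).

Primitivity: $X$ is primitive in every variable because every $x_i$ is primitive in $A_n$
(`xTensor_isPrimAt`). Natural transformations preserve primitive elements, so $v$ lies in
$\mathcal{P}(F)(n)$.

Freeness: for primitive $v$ the map $t \mapsto$ `extMap` $(t)(v)$ has to be natural. By generation
this comes down to `ap_eq_extMap_act`, which says that $F(\sigma)v$ is obtained by expanding $\sigma
X$ in multilinear words and applying these to $v$, even though the words $\sigma(x_j)$ may contain
inverses and may repeat or omit variables. The difference of the two sides is a function $\Theta$ of
the tuple $(\sigma(x_1),\dots,\sigma(x_l))$ in $F_n^l$. Since both $v$ and $X$ are primitive,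
$\Theta$ is additive under the doubling of any variable. Such a function vanishes where a variable
is missing, it changes sign when a variable that occurs once is inverted, and a repeated variable
can be split into tuples with fewer letters. It is therefore determined by its values at multilinear
tuples of words (`IsPrimFun.eq_zero`), and there $\Theta = 0$.

The Hopf algebra computations behind the first two facts are differential calculus. Precomposition
with the multiplication by a primitive element is a derivation of the convolution algebra
(`shift_mul`). A positive word acts by a convolution product of algebra maps (`letter`), and $X$ is
a product of commuting primitive elements (`slot`). The value at $X$ is thus found by
differentiating a product of letters once for each variable and evaluating at $1$.

Naturality in the Lie category follows from `app_eq_extMap`, because the right action of a morphism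
on $x_1 \otimes \cdots \otimes x_m$ returns the image of that morphism in $A_n^{\otimes m}$. -/

noncomputable section

namespace PrimPart

open scoped TensorProduct
open Coalgebra Bialgebra HopfAlgebra WithConv CategoryTheory

/-! ### Derivations of the convolution algebra given by primitive elements -/

section Shift
variable {k : Type u} [CommRing k] {C B : Type u} [Ring C] [Bialgebra k C] [Ring B] [Algebra k B]

/-- Precomposition of a linear map with the left multiplication by `x`. -/
def shift (x : C) (f : WithConv (C →ₗ[k] B)) : WithConv (C →ₗ[k] B) :=
  toConv (f.ofConv ∘ₗ LinearMap.mulLeft k x)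

/-- For primitive `x`, the operator `shift x` is a derivation of the convolution algebra. -/
lemma shift_mul {x : C} (hx : comul (R := k) x = x ⊗ₜ[k] 1 + 1 ⊗ₜ[k] x)
    (f g : WithConv (C →ₗ[k] B)) : shift x (f * g) = shift x f * g + f * shift x g := by
  refine WithConv.ext (LinearMap.ext fun y => ?_)
  -- As $\Delta(xy) = (x \otimes 1 + 1 \otimes x)\Delta(y)$, the two summands hand $x$ to `f` and to
  -- `g` respectively.
  simp only [WithConv.ofConv_add, LinearMap.add_apply, LinearMap.convMul_def, shift,
    LinearMap.comp_apply, LinearMap.mulLeft_apply, Bialgebra.comul_mul, hx, WithConv.ofConv_toConv]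
  generalize comul (R := k) y = s
  induction s with
  | zero => simp
  | add x y hx hy => simp only [mul_add, map_add, hx, hy]; abel
  | tmul x y => simp [add_mul]

lemma shift_one {x : C} (hx : counit (R := k) x = 0) :
    shift x (1 : WithConv (C →ₗ[k] B)) = 0 := by
  refine WithConv.ext (LinearMap.ext fun y => ?_)
  simp [shift, LinearMap.convOne_def, hx]

/-- Here $1$ is grouplike. This is the end of every computation, once all slots have been removed by
differentiation. -/
lemma convMul_apply_one (f g : WithConv (C →ₗ[k] B)) :
    (f * g).ofConv 1 = f.ofConv 1 * g.ofConv 1 := by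
  simp [LinearMap.convMul_def, Algebra.TensorProduct.one_def]

/-- Left multiplication of the values of a linear map by a constant. -/
def smulConv (c : B) (f : WithConv (C →ₗ[k] B)) : WithConv (C →ₗ[k] B) :=
  toConv (LinearMap.mulLeft k c ∘ₗ f.ofConv)

/-- The constant stands to the left of all values of `f`, so it moves out by associativity alone. No
commutativity is needed, because the factors that produce such constants stand at the front of the
products. -/
lemma smulConv_mul (c : B) (f g : WithConv (C →ₗ[k] B)) :
    smulConv c f * g = smulConv c (f * g) := by
  refine WithConv.ext (LinearMap.ext fun y => ?_)
  simp only [LinearMap.convMul_def, smulConv, LinearMap.comp_apply, WithConv.ofConv_toConv]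
  generalize comul (R := k) y = s
  induction s with
  | zero => simp
  | add x y hx hy => simp only [map_add, hx, hy]
  | tmul x y => simp [mul_assoc]

/-- Multiplicativity $f(xy) = f(x)f(y)$ makes algebra maps behave like exponentials: the derivative
is the map itself times a constant. -/
lemma shift_algHom (x : C) (f : C →ₐ[k] B) :
    shift x (toConv f.toLinearMap) = smulConv (f x) (toConv f.toLinearMap) := by
  refine WithConv.ext (LinearMap.ext fun y => ?_)
  simp [shift, smulConv]

end Shift

lemma prod_map_flatten {M α : Type*} [Monoid M] (f : α → M) (L : List (List α)) :
    (L.flatten.map f).prod = (L.map fun l => (l.map f).prod).prod := by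
  induction L with
  | nil => rfl
  | cons l L ih => rw [List.flatten_cons, List.map_append, List.prod_append, ih]; rfl

/-! ### The action of positive words on $x_1 \otimes \cdots \otimes x_n$ -/

section Letters
variable {k : Type u} [CommRing k] {n l : ℕ}

variable (k) in
/-- The element `1 ⊗ ⋯ ⊗ x_i ⊗ ⋯ ⊗ 1`, with `x_i` in position `i`. -/
def slot (i : Fin n) : TPow k (Alg k n) n := TPow.single i (FreeAlgebra.ι k i)

lemma comul_slot (i : Fin n) :
    comul (R := k) (slot k i) = slot k i ⊗ₜ[k] 1 + 1 ⊗ₜ[k] slot k i := by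
  rw [slot, TPow.comul_single, comul_ι, map_add, Algebra.TensorProduct.map_tmul,
    Algebra.TensorProduct.map_tmul, map_one]

lemma counit_slot (i : Fin n) : counit (R := k) (slot k i) = 0 := by
  rw [slot, TPow.counit_single, counit_ι]

variable (k) in
/-- The map `h_1 ⊗ ⋯ ⊗ h_n ↦ 1 ⊗ ⋯ ⊗ h_i ⊗ ⋯ ⊗ 1`, with `h_i` in position `j`, up to counits. -/
def letter (j : Fin l) (i : Fin n) : WithConv (TPow k (Alg k n) n →ₗ[k] TPow k (Alg k n) l) :=
  toConv ((TPow.single j).comp (TPow.proj i)).toLinearMap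

lemma ev_of_eq_letter (j : Fin l) (i : Fin n) :
    (TPow.ev n (TPow.single (k := k) (H := Alg k n) j) (FreeGroup.of i)).val = letter k j i :=
  TPow.ev_of _ _

lemma letter_one (j : Fin l) (i : Fin n) : (letter k j i).ofConv 1 = 1 := by
  simp [letter]

/-- Together with `shift_letter_ne` this is the rule for partial derivatives: only the letters `i`
depend on the slot `i`, and differentiation brings out the factor $x_i$ in position `j`. -/
lemma shift_letter_self (j : Fin l) (i : Fin n) : shift (slot k i) (letter k j i) =
    smulConv (TPow.single j (FreeAlgebra.ι k i)) (letter k j i) := by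
  rw [letter, shift_algHom, slot, AlgHom.comp_apply, TPow.proj_single_same]

lemma shift_letter_ne (j : Fin l) {i a : Fin n} (h : a ≠ i) :
    shift (slot k a) (letter k j i) = 0 := by
  rw [letter, shift_algHom, slot, AlgHom.comp_apply, proj_ι, if_neg h, map_zero]
  refine WithConv.ext (LinearMap.ext fun y => ?_)
  simp [smulConv]

/-- A letter `i` has no effect on products of slots different from `i`. -/
lemma mul_letter_mul_apply (j : Fin l) (i : Fin n) {I : List (Fin n)} (hI : i ∉ I) :
    ∀ f g : WithConv (TPow k (Alg k n) n →ₗ[k] TPow k (Alg k n) l),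
      (f * (letter k j i * g)).ofConv (I.map (slot k)).prod =
        (f * g).ofConv (I.map (slot k)).prod := by
  induction I with
  | nil =>
    intro f g
    -- With no slots left, convolution is multiplication of the values at $1$, and a letter has the
    -- value $1$ there.
    rw [List.map_nil, List.prod_nil, convMul_apply_one, convMul_apply_one, convMul_apply_one,
      letter_one, one_mul]
  | cons a I ih =>
    intro f g
    rw [List.mem_cons, not_or] at hI
    have e : ∀ f : WithConv (TPow k (Alg k n) n →ₗ[k] TPow k (Alg k n) l),
        f.ofConv ((a :: I).map (slot k)).prod =
          (shift (slot k a) f).ofConv (I.map (slot k)).prod := fun f => by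
      simp [shift]
    -- By the Leibniz rule the derivative falls on `f` or on `g`, since the letter `i` is constant
    -- with respect to the slot `a`. The induction hypothesis is used for both terms, with one of
    -- `f`, `g` replaced by its derivative; this is why they are quantified inside the induction.
    rw [e, e, shift_mul (comul_slot a), shift_mul (comul_slot a), shift_mul (comul_slot a),
      shift_letter_ne j (Ne.symm hI.1), zero_mul, zero_add, WithConv.ofConv_add,
      WithConv.ofConv_add, LinearMap.add_apply, LinearMap.add_apply, ih hI.2, ih hI.2]

lemma letter_mul_apply (j : Fin l) (i : Fin n) {I : List (Fin n)} (hI : i ∉ I)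
    (g : WithConv (TPow k (Alg k n) n →ₗ[k] TPow k (Alg k n) l)) :
    (letter k j i * g).ofConv (I.map (slot k)).prod = g.ofConv (I.map (slot k)).prod := by
  have h := mul_letter_mul_apply j i hI 1 g
  rwa [one_mul (letter k j i * g), one_mul g] at h

/-- A derivation kills a product of constants. The factors form an arbitrary family because in
`act_dbl` some of them are $1$ and not letters. -/
lemma shift_prod_letter {ι : Type*} (a : Fin n)
    (φ : ι → WithConv (TPow k (Alg k n) n →ₗ[k] TPow k (Alg k n) l)) (L : List ι)
    (h : ∀ p ∈ L, shift (slot k a) (φ p) = 0) : shift (slot k a) (L.map φ).prod = 0 := by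
  induction L with
  | nil => exact shift_one (counit_slot a)
  | cons p L ih =>
    rw [List.map_cons, List.prod_cons, shift_mul (comul_slot a), h p (by simp),
      ih fun q hq => h q (by simp [hq]), zero_mul, mul_zero, add_zero]

/-- A product of letters, applied to the product of the corresponding slots. -/
lemma prod_letter_apply (L : List (Fin l × Fin n)) (hL : (L.map Prod.snd).Nodup) :
    (L.map fun p => letter k p.1 p.2).prod.ofConv ((L.map Prod.snd).map (slot k)).prod =
      (L.map fun p => TPow.single (k := k) p.1 (FreeAlgebra.ι k p.2)).prod := by
  induction L with
  | nil => simp [LinearMap.convOne_def]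
  | cons p L ih =>
    rw [List.map_cons, List.nodup_cons] at hL
    have e : ∀ f : WithConv (TPow k (Alg k n) n →ₗ[k] TPow k (Alg k n) l),
        f.ofConv (((p :: L).map Prod.snd).map (slot k)).prod =
          (shift (slot k p.2) f).ofConv ((L.map Prod.snd).map (slot k)).prod := fun f => by
      simp [shift]
    -- The variables are distinct, so the derivative for the first slot falls only on the first
    -- letter and brings out its factor. The letter itself survives, but it has no effect on the
    -- remaining slots; it is inserted on the right-hand side to match.
    rw [e, List.map_cons, List.prod_cons, List.map_cons, List.prod_cons, ← ih hL.2,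
      ← letter_mul_apply p.1 p.2 hL.1 (List.map _ L).prod, shift_mul (comul_slot _), shift_letter_self,
      shift_prod_letter p.2 (fun p => letter k p.1 p.2) L fun q hq => shift_letter_ne _ fun h =>
        hL.1 (List.mem_map.2 ⟨q, hq, h.symm⟩),
      mul_zero, add_zero, smulConv_mul]
    rfl

lemma tprod_ι_eq_prod : (TPow.tprod k fun i : Fin n => FreeAlgebra.ι k i) =
    ((List.finRange n).map (slot k)).prod := by
  rw [tprod_eq_prod, List.ofFn_eq_map]; rfl

/-- Different slots occupy different tensor factors and so commute. This allows the slots to be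
removed in any convenient order, such as the order in which the variables occur in a tuple of words.
-/
lemma prod_slot_perm {I J : List (Fin n)} (h : I.Perm J) (hI : I.Nodup) :
    (I.map (slot k)).prod = (J.map (slot k)).prod := by
  refine (h.map _).prod_eq' ?_
  rw [List.pairwise_map]
  exact hI.imp fun hab => TPow.single_commute hab _ _

lemma perm_finRange {I : List (Fin n)} (h : ∀ i, I.count i = 1) : I.Perm (List.finRange n) :=
  List.perm_iff_count.2 fun i => by
    rw [h, List.count_eq_one_of_mem (List.nodup_finRange n) (List.mem_finRange i)]

/-- A morphism `[w_1 | ⋯ | w_l]`, where each variable occurs exactly once in the `w_j`, maps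
`x_1 ⊗ ⋯ ⊗ x_n` to `w_1 ⊗ ⋯ ⊗ w_l`. -/
lemma act_wordHom (w : Fin l → FreeMonoid (Fin n)) (hw : deg w = fun _ => 1) :
    TPow.act (FreeGroup.lift fun j => FreeMonoid.lift FreeGroup.of (w j))
      (TPow.tprod k fun i : Fin n => FreeAlgebra.ι k i) = wordTensor k n l w := by
  set L : List (Fin l × Fin n) :=
    ((List.finRange l).map fun j => (w j).toList.map fun i => (j, i)).flatten with hLdef
  have hc : ∀ i, (L.map Prod.snd).count i = 1 := fun i => by
    rw [← congrFun hw i, deg, hLdef, List.map_flatten, List.count_flatten, List.map_map,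
      List.map_map, ← List.sum_ofFn, List.ofFn_eq_map]
    congr 2
    funext j
    simp [Function.comp_def]
  have hp := perm_finRange hc
  have hn : (L.map Prod.snd).Nodup := hp.nodup_iff.2 (List.nodup_finRange n)
  -- No inverse occurs, so the antipode does not enter: `ev` is a homomorphism and turns each word
  -- into the product of its letters.
  have ha : toConv (TPow.act (k := k) (H := Alg k n)
      (FreeGroup.lift fun j => FreeMonoid.lift FreeGroup.of (w j))) =
      (L.map fun p => letter k p.1 p.2).prod := by
    rw [TPow.toConv_act, List.ofFn_eq_map, hLdef]
    have h := prod_map_flatten (M := WithConv (TPow k (Alg k n) n →ₗ[k] TPow k (Alg k n) l))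
      (fun p : Fin l × Fin n => letter k p.1 p.2)
      ((List.finRange l).map fun j => (w j).toList.map fun i => (j, i))
    refine Eq.trans ?_ h.symm
    rw [List.map_map]
    congr 2
    funext j
    rw [FreeGroup.lift_apply_of]
    simp only [Function.comp_apply, List.map_map]
    induction w j using FreeMonoid.inductionOn' with
    | one => simp
    | of_mul i v ih =>
      rw [map_mul, map_mul, Units.val_mul, ih, FreeMonoid.lift_eval_of, ev_of_eq_letter]
      simp [Function.comp_def]
  change (toConv (TPow.act (k := k) (H := Alg k n) _)).ofConv _ = _
  -- The slots are put in the order of occurrence of the variables, as `prod_letter_apply` requires;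
  -- what remains is to regroup the product by tensor factors.
  rw [ha, tprod_ι_eq_prod, ← prod_slot_perm hp hn, prod_letter_apply L hn]
  change _ = TPow.tprod k _
  rw [tprod_eq_prod, hLdef, prod_map_flatten, List.map_map, List.ofFn_eq_map]
  congr 2
  funext j
  simp only [Function.comp_apply, List.map_map]
  induction w j using FreeMonoid.inductionOn' with
  | one => simp
  | of_mul i v ih =>
    rw [FreeMonoid.toList_mul, map_mul (word k n), map_mul, ← ih]
    simp [Function.comp_def, word]

/-- Letters `i` can be erased anywhere in a product that is evaluated away from the slot `i`. The
factor `f` collects the part of the product that has been passed in the induction. -/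
lemma mul_prod_letter_apply {ι : Type*} (i : Fin n)
    (φ φ' : ι → WithConv (TPow k (Alg k n) n →ₗ[k] TPow k (Alg k n) l)) {I : List (Fin n)}
    (hI : i ∉ I) (L : List ι) (h : ∀ p ∈ L, φ p = φ' p ∨ φ' p = 1 ∧ ∃ j, φ p = letter k j i) :
    ∀ f, (f * (L.map φ).prod).ofConv (I.map (slot k)).prod =
      (f * (L.map φ').prod).ofConv (I.map (slot k)).prod := by
  induction L with
  | nil => intro f; rfl
  | cons p L ih =>
    intro f
    have ih := ih fun q hq => h q (by simp [hq])
    simp only [List.map_cons, List.prod_cons]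
    rcases h p (by simp) with e | ⟨e, j, e'⟩
    · rw [e, ← mul_assoc f, ih, mul_assoc f]
    · rw [e, e', one_mul (List.map φ' L).prod, mul_letter_mul_apply j i hI, ih]

end Letters

/-! ### Primitivity of $x_1 \otimes \cdots \otimes x_n$ -/

section PrimitiveTensor
variable {k : Type u} [CommRing k] {n : ℕ}

/-- The bijection between the generators of `F_{n+1}` and those of the free group with an extra
variable, which corresponds to `x_0`. -/
def optOf : FreeGroup (Fin (n + 1)) →* FreeGroup (Option (Fin n)) :=
  FreeGroup.lift (Fin.cons (FreeGroup.of none) fun j => FreeGroup.of (some j))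

/-- The inverse of `optOf`. -/
def optInv : FreeGroup (Option (Fin n)) →* FreeGroup (Fin (n + 1)) :=
  FreeGroup.lift fun o => o.elim (FreeGroup.of 0) fun j => FreeGroup.of j.succ

lemma optOf_optInv : (optOf (n := n)).comp optInv = MonoidHom.id _ :=
  FreeGroup.ext_hom _ _ fun o => by cases o <;> simp [optOf, optInv]

/-- This is the universal instance of primitivity. Doubling acts by $\lambda P$, where $\lambda$ is
the letter `i` in position `0` and $P$ is the product of the letters `j` in positions `j.succ`. With
$D$ the derivation for the slot `i`, one has $D(\lambda P) = D(\lambda)P + \lambda D(P)$. On the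
slots other than `i`, the second term agrees with $D(P)$, which accounts for `fst`. In the first
term the letter `i` may be erased from $P$, which accounts for `snd i`. -/
lemma act_dbl (i : Fin n) :
    TPow.act ((dbl i).comp optOf) (TPow.tprod k fun i : Fin n => FreeAlgebra.ι k i) =
      TPow.act (fst.comp optOf) (TPow.tprod k fun i : Fin n => FreeAlgebra.ι k i) +
      TPow.act ((snd i).comp optOf) (TPow.tprod k fun i : Fin n => FreeAlgebra.ι k i) := by
  set φ : Fin n → WithConv (TPow k (Alg k n) n →ₗ[k] TPow k (Alg k n) (n + 1)) :=
    fun j => letter k j.succ j with hφ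
  set φ' : Fin n → WithConv (TPow k (Alg k n) n →ₗ[k] TPow k (Alg k n) (n + 1)) :=
    fun j => if j = i then 1 else letter k j.succ j with hφ'
  have hd : toConv (TPow.act (k := k) (H := Alg k n) ((dbl i).comp optOf)) =
      letter k 0 i * ((List.finRange n).map φ).prod := by
    rw [TPow.toConv_act, List.ofFn_succ, List.prod_cons, List.ofFn_eq_map]
    simp [optOf, ev_of_eq_letter, hφ]
  have hf : toConv (TPow.act (k := k) (H := Alg k n) (fst.comp optOf)) =
      ((List.finRange n).map φ).prod := by
    rw [TPow.toConv_act, List.ofFn_succ, List.prod_cons, List.ofFn_eq_map]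
    simp [optOf, ev_of_eq_letter, hφ]
  have hs : toConv (TPow.act (k := k) (H := Alg k n) ((snd i).comp optOf)) =
      letter k 0 i * ((List.finRange n).map φ').prod := by
    rw [TPow.toConv_act, List.ofFn_succ, List.prod_cons, List.ofFn_eq_map]
    congr 1
    · simp [optOf, ev_of_eq_letter]
    · congr 2
      funext j
      by_cases h : j = i
      · subst h; simp [optOf, hφ']
      · simp [optOf, hφ', h, snd_ne h, ev_of_eq_letter]
  -- The slot `i` is moved to the front and removed by differentiation, which leaves the slots in
  -- `I`.
  set I := (List.finRange n).erase i with hI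
  have hp : (List.finRange n).Perm (i :: I) := List.perm_cons_erase (List.mem_finRange i)
  have hi : i ∉ I := (List.nodup_finRange n).not_mem_erase
  have hx : ∀ f : WithConv (TPow k (Alg k n) n →ₗ[k] TPow k (Alg k n) (n + 1)),
      f.ofConv (TPow.tprod k fun i : Fin n => FreeAlgebra.ι k i) =
        (shift (slot k i) f).ofConv (I.map (slot k)).prod := fun f => by
    rw [tprod_ι_eq_prod, prod_slot_perm hp (List.nodup_finRange n)]
    simp [shift]
  -- For `snd i` the product no longer contains the letter `i`, so only the extra letter in position
  -- `0` is differentiated.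
  have h0 : shift (slot k i) ((List.finRange n).map φ').prod = 0 :=
    shift_prod_letter i φ' _ fun j _ => by
      by_cases h : j = i
      · simp only [hφ', if_pos h]; exact shift_one (counit_slot i)
      · simp only [hφ', if_neg h]; exact shift_letter_ne _ (Ne.symm h)
  change (toConv (TPow.act (k := k) (H := Alg k n) _)).ofConv _ =
    (toConv (TPow.act (k := k) (H := Alg k n) _)).ofConv _ +
    (toConv (TPow.act (k := k) (H := Alg k n) _)).ofConv _
  rw [hd, hf, hs, hx, hx, hx, shift_mul (comul_slot i), shift_mul (comul_slot i), h0, mul_zero,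
    add_zero, WithConv.ofConv_add, LinearMap.add_apply, letter_mul_apply 0 i hi,
    add_comm (DFunLike.coe _ _),
    shift_letter_self, smulConv_mul, smulConv_mul]
  congr 1
  refine congrArg (TPow.single (k := k) 0 (FreeAlgebra.ι k i) * ·)
    (mul_prod_letter_apply i φ φ' hi _ (fun j _ => ?_) _)
  by_cases h : j = i
  · subst h; exact Or.inr ⟨by simp [hφ'], _, rfl⟩
  · exact Or.inl (by simp [hφ', hφ, h])

/-- The tensor `x_1 ⊗ ⋯ ⊗ x_n` is primitive. -/
lemma xTensor_isPrimAt (i : Fin n) : IsPrimAt (catAss k n) i (xTensor k n) := by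
  intro N ψ
  refine Subtype.ext ?_
  -- Every `ψ` equals `optOf` composed with `optInv.comp ψ`, so the general case is the image of the
  -- universal one under a linear map.
  have e : ∀ g : FreeGroup (Option (Fin n)) →* FreeGroup (Fin n),
      TPow.act (k := k) (H := Alg k n) (g.comp ψ) =
        TPow.act (optInv.comp ψ) ∘ₗ TPow.act (g.comp optOf) := fun g => by
    rw [← TPow.act_comp, MonoidHom.comp_assoc, ← MonoidHom.comp_assoc ψ, optOf_optInv,
      MonoidHom.id_comp]
  change TPow.act ((dbl i).comp ψ) (TPow.tprod k fun i : Fin n => FreeAlgebra.ι k i) =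
    TPow.act (fst.comp ψ) (TPow.tprod k fun i : Fin n => FreeAlgebra.ι k i) +
      TPow.act ((snd i).comp ψ) (TPow.tprod k fun i : Fin n => FreeAlgebra.ι k i)
  rw [e, e, e, LinearMap.comp_apply, act_dbl, map_add]
  rfl

end PrimitiveTensor

/-! ### Tuples of group elements as lists of signed letters with positions -/

section Words
variable {l : ℕ} {X Y : Type}

/-- The tuple with `x` or `x⁻¹` in position `j`, depending on the sign, and `1` elsewhere. -/
def tup (e : Fin l × X × Bool) : Fin l → FreeGroup X :=
  Pi.mulSingle e.1 (cond e.2.2 (FreeGroup.of e.2.1) (FreeGroup.of e.2.1)⁻¹)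

/-- The product of the tuples that correspond to a list of signed letters with positions. -/
def tupProd (L : List (Fin l × X × Bool)) : Fin l → FreeGroup X := (L.map tup).prod

lemma tupProd_append (A B : List (Fin l × X × Bool)) :
    tupProd (A ++ B) = tupProd A * tupProd B := by
  simp [tupProd]

lemma tupProd_cons (e : Fin l × X × Bool) (B : List (Fin l × X × Bool)) :
    tupProd (e :: B) = tup e * tupProd B := by
  simp [tupProd]

lemma compLeft_mulSingle {G H : Type*} [Group G] [Group H] (g : G →* H) (j : Fin l) (a : G) :
    g.compLeft (Fin l) (Pi.mulSingle j a) = Pi.mulSingle j (g a) := by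
  funext b
  by_cases h : b = j
  · subst h; simp
  · simp [h]

lemma compLeft_tup (g : FreeGroup X →* FreeGroup Y) {x : X} {y : Y}
    (h : g (FreeGroup.of x) = FreeGroup.of y) (j : Fin l) (b : Bool) :
    g.compLeft (Fin l) (tup (j, x, b)) = tup (j, y, b) := by
  rw [tup, compLeft_mulSingle]
  cases b <;> simp [tup, h]

lemma compLeft_tup_one (g : FreeGroup X →* FreeGroup Y) {x : X}
    (h : g (FreeGroup.of x) = 1) (j : Fin l) (b : Bool) :
    g.compLeft (Fin l) (tup (j, x, b)) = 1 := by
  rw [tup, compLeft_mulSingle]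
  cases b <;> simp [h]

lemma tup_inv_mul (j : Fin l) (x : X) : tup (j, x, false) * tup (j, x, true) = 1 := by
  rw [tup, tup, ← Pi.mulSingle_mul]
  simp

/-- A single list for the whole tuple treats all occurrences of a variable alike, whichever
component they lie in. The lists need not be reduced, so each component can be written out
separately and the results concatenated. -/
lemma exists_tupProd (u : Fin l → FreeGroup X) : ∃ L, tupProd L = u := by
  have hs : ∀ j (g : FreeGroup X), ∃ L : List (Fin l × X × Bool), tupProd L = Pi.mulSingle j g := by
    intro j g
    induction g using FreeGroup.induction_on with
    | C1 => exact ⟨[], by simp [tupProd]⟩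
    | of x => exact ⟨[(j, x, true)], by simp [tupProd, tup]⟩
    | inv_of x _ => exact ⟨[(j, x, false)], by simp [tupProd, tup]⟩
    | mul g h hg hh =>
      obtain ⟨A, hA⟩ := hg
      obtain ⟨B, hB⟩ := hh
      exact ⟨A ++ B, by rw [tupProd_append, hA, hB, ← Pi.mulSingle_mul]⟩
  choose A hA using fun j => hs j (u j)
  refine ⟨(List.ofFn A).flatten, ?_⟩
  rw [tupProd, prod_map_flatten, List.map_ofFn]
  have : ((fun l => (List.map tup l).prod) ∘ A) = fun j => Pi.mulSingle j (u j) :=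
    funext fun j => hA j
  rw [this]
  funext a
  rw [Pi.list_prod_apply, List.map_ofFn]
  -- In the component `a` only the list for `a` contributes; the others are trivial there.
  refine (prod_ofFn_eq _ a fun j hj => ?_).trans (Pi.mulSingle_eq_same _ _)
  exact Pi.mulSingle_eq_of_ne hj.symm _

variable {n : ℕ}

/-- Regards letters as letters of the alphabet with an extra variable. -/
def embLetter (e : Fin l × Fin n × Bool) : Fin l × Option (Fin n) × Bool := (e.1, some e.2.1, e.2.2)

/-- The letters different from `x_i`. -/
def dropVar (i : Fin n) (L : List (Fin l × Fin n × Bool)) : List (Fin l × Fin n × Bool) :=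
  L.filter fun e => e.2.1 ≠ i

lemma dropVar_eq_self {i : Fin n} {L : List (Fin l × Fin n × Bool)}
    (h : i ∉ L.map fun e => e.2.1) : dropVar i L = L :=
  List.filter_eq_self.2 fun e he => by
    simp only [ne_eq, decide_not, Bool.not_eq_eq_eq_not, Bool.not_true, decide_eq_false_iff_not]
    exact fun h' => h (List.mem_map.2 ⟨e, he, h'⟩)

lemma compLeft_tupProd_emb (g : FreeGroup (Option (Fin n)) →* FreeGroup (Fin n))
    (h : ∀ i, g (FreeGroup.of (some i)) = FreeGroup.of i) (L : List (Fin l × Fin n × Bool)) :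
    g.compLeft (Fin l) (tupProd (L.map embLetter)) = tupProd L := by
  induction L with
  | nil => exact map_one _
  | cons e L ih => rw [List.map_cons, tupProd_cons, map_mul, ih, tupProd_cons, embLetter,
      compLeft_tup g (h _)]

/-- An embedded list does not contain the extra variable, so `snd i` merely sends each occurrence of
$x_i^{\pm 1}$ to $1$. -/
lemma snd_tupProd_emb (i : Fin n) (L : List (Fin l × Fin n × Bool)) :
    (snd i).compLeft (Fin l) (tupProd (L.map embLetter)) = tupProd (dropVar i L) := by
  induction L with
  | nil => exact map_one _
  | cons e L ih =>
    rw [List.map_cons, tupProd_cons, map_mul, ih, embLetter, dropVar, dropVar, List.filter_cons]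
    by_cases h : e.2.1 = i
    · rw [compLeft_tup_one _ (by rw [h, snd_same]), one_mul, if_neg (by simp [h])]
    · rw [compLeft_tup _ (snd_ne h), if_pos (by simp [h]), tupProd_cons]

lemma deg_mulSingle (j : Fin l) (i : Fin n) :
    deg (Pi.mulSingle j (FreeMonoid.of i)) = Pi.single i 1 := by
  funext a
  rw [deg, Finset.sum_eq_single j]
  · rw [Pi.mulSingle_eq_same, FreeMonoid.toList_of, List.count_singleton, Pi.single_apply]
    by_cases h : a = i
    · simp [h]
    · simp [h, Ne.symm h]
  · intro b _ hb
    rw [Pi.mulSingle_eq_of_ne hb]; simp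
  · simp

/-- A list without inverses already spells a tuple of words, with the same number of occurrences of
each variable. This recognises the terminal case of the reduction in `IsPrimFun.tupProd_eq_zero`. -/
lemma exists_word_of_pos (L : List (Fin l × Fin n × Bool)) (hL : ∀ e ∈ L, e.2.2 = true) :
    ∃ w : Fin l → FreeMonoid (Fin n), (fun j => FreeMonoid.lift FreeGroup.of (w j)) = tupProd L ∧
      ∀ i, deg w i = (L.map fun e => e.2.1).count i := by
  induction L with
  | nil => exact ⟨1, by funext j; simp [tupProd], fun i => by simp [deg]⟩
  | cons e L ih =>
    obtain ⟨w, hw, hd⟩ := ih fun e he => hL e (by simp [he])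
    refine ⟨Pi.mulSingle e.1 (FreeMonoid.of e.2.1) * w, ?_, fun i => ?_⟩
    · rw [tupProd_cons, ← hw]
      funext j
      rw [Pi.mul_apply, Pi.mul_apply, map_mul, tup, hL e (by simp)]
      by_cases h : j = e.1
      · subst h; simp
      · simp [h]
    · rw [deg_mul, deg_mulSingle, Pi.add_apply, hd, List.map_cons, List.count_cons, add_comm,
        Pi.single_apply]
      by_cases h : i = e.2.1
      · simp [h]
      · simp [h, Ne.symm h]

end Words

/-! ### Functions additive under doubling are determined by multilinear words -/

section Uniqueness
variable {l n : ℕ} {M : Type*} [AddCommGroup M]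

/-- Functions of tuples of elements of the free group that are additive with respect to the
doubling of each of the variables. -/
def IsPrimFun (Θ : (Fin l → FreeGroup (Fin n)) → M) : Prop :=
  ∀ (i : Fin n) (u : Fin l → FreeGroup (Option (Fin n))), Θ ((dbl i).compLeft (Fin l) u) =
    Θ (fst.compLeft (Fin l) u) + Θ ((snd i).compLeft (Fin l) u)

variable {Θ : (Fin l → FreeGroup (Fin n)) → M}

/-- For a tuple that involves neither $x_i$ nor the extra variable, the maps `dbl i`, `fst` and `snd
i` all give the same result, so additivity reads $\Theta = \Theta + \Theta$. -/
lemma IsPrimFun.eq_zero_of_not_mem (h : IsPrimFun Θ) {i : Fin n} {L : List (Fin l × Fin n × Bool)}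
    (hi : i ∉ L.map fun e => e.2.1) : Θ (tupProd L) = 0 := by
  have := h i (tupProd (L.map embLetter))
  rw [compLeft_tupProd_emb _ (dbl_some i), compLeft_tupProd_emb _ fst_some, snd_tupProd_emb,
    dropVar_eq_self hi] at this
  exact left_eq_add.1 this

/-- The displayed occurrence of $x_i^{\pm 1}$ is replaced by the extra variable with the same sign:
`fst` deletes it, while `snd i` keeps it and deletes all other occurrences of $x_i$. -/
lemma IsPrimFun.split (h : IsPrimFun Θ) (A B : List (Fin l × Fin n × Bool)) (j : Fin l) (i : Fin n)
    (b : Bool) : Θ (tupProd (A ++ (j, i, b) :: B)) =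
      Θ (tupProd (A ++ B)) + Θ (tupProd (dropVar i A ++ (j, i, b) :: dropVar i B)) := by
  have := h i (tupProd (A.map embLetter) * (tup (j, none, b) * tupProd (B.map embLetter)))
  simp only [map_mul] at this
  rwa [compLeft_tupProd_emb _ (dbl_some i), compLeft_tupProd_emb _ fst_some, snd_tupProd_emb,
    compLeft_tupProd_emb _ (dbl_some i), compLeft_tupProd_emb _ fst_some, snd_tupProd_emb,
    compLeft_tup _ (dbl_none i), compLeft_tup_one _ fst_none, compLeft_tup _ (snd_none i), one_mul,
    ← tupProd_cons, ← tupProd_cons, ← tupProd_append, ← tupProd_append, ← tupProd_append] at this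

/-- Additivity is applied to the tuple with $x_i^{-1}z$ inserted, where $z$ is the extra variable:
`dbl i` cancels the insertion, `fst` leaves $x_i^{-1}$, and `snd i` leaves $x_i$ as the only
occurrence. If $x_i$ is absent from `A` and `B`, the left-hand side vanishes and inverting $x_i$
becomes a change of sign. -/
lemma IsPrimFun.flip (h : IsPrimFun Θ) (A B : List (Fin l × Fin n × Bool)) (j : Fin l)
    (i : Fin n) : Θ (tupProd (A ++ B)) = Θ (tupProd (A ++ (j, i, false) :: B)) +
      Θ (tupProd (dropVar i A ++ (j, i, true) :: dropVar i B)) := by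
  have := h i (tupProd (A.map embLetter) * (tup (j, some i, false) * (tup (j, none, true) *
    tupProd (B.map embLetter))))
  simp only [map_mul] at this
  rwa [compLeft_tupProd_emb _ (dbl_some i), compLeft_tupProd_emb _ fst_some, snd_tupProd_emb,
    compLeft_tupProd_emb _ (dbl_some i), compLeft_tupProd_emb _ fst_some, snd_tupProd_emb,
    compLeft_tup _ (dbl_none i), compLeft_tup_one _ fst_none, compLeft_tup _ (snd_none i),
    compLeft_tup _ (dbl_some i i), compLeft_tup _ (fst_some i), compLeft_tup_one _ (snd_same i),
    one_mul, one_mul, ← mul_assoc (tup (j, i, false)), tup_inv_mul, one_mul,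
    ← tupProd_cons, ← tupProd_cons, ← tupProd_append, ← tupProd_append, ← tupProd_append] at this

/-- The number of letters, with inverses counted twice. -/
def weight (L : List (Fin l × Fin n × Bool)) : ℕ := L.length + L.countP fun e => !e.2.2

/-- Induction on the weight. If some variable does not occur exactly once, it is either missing, so
that $\Theta$ vanishes, or repeated, and `split` gives two shorter lists. If every variable occurs
exactly once, `flip` removes an inverse at the same length, which is why inverses count twice;
without inverses the list is a multilinear tuple of words. -/
lemma IsPrimFun.tupProd_eq_zero (h : IsPrimFun Θ)
    (h1 : ∀ w : Fin l → FreeMonoid (Fin n), deg w = (fun _ => 1) →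
      Θ (fun j => FreeMonoid.lift FreeGroup.of (w j)) = 0) (N : ℕ) :
    ∀ L : List (Fin l × Fin n × Bool), weight L ≤ N → Θ (tupProd L) = 0 := by
  induction N with
  | zero =>
    intro L hL
    have hL : L = [] := by
      rw [weight] at hL
      exact List.length_eq_zero_iff.1 (by omega)
    subst hL
    -- The empty list misses every variable. For `n = 0` there is none to miss, but then the tuple
    -- of empty words is itself multilinear and `h1` applies.
    by_cases hn : ∃ i : Fin n, True
    · exact h.eq_zero_of_not_mem (i := hn.choose) (by simp)
    · have := h1 1 (funext fun i => absurd ⟨i, trivial⟩ hn)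
      rw [← this]
      congr 1
  | succ N ih =>
    intro L hL
    by_cases hc : ∀ i, (L.map fun e => e.2.1).count i = 1
    · by_cases hp : ∀ e ∈ L, e.2.2 = true
      · obtain ⟨w, hw, hd⟩ := exists_word_of_pos L hp
        rw [← hw]
        exact h1 w (funext fun i => (hd i).trans (hc i))
      · push Not at hp
        obtain ⟨⟨j, i, b⟩, he, hb⟩ := hp
        obtain rfl : b = false := by simpa using hb
        obtain ⟨A, B, rfl⟩ := List.append_of_mem he
        have hi := hc i
        simp only [List.map_append, List.map_cons, List.count_append, List.count_cons_self] at hi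
        have hA : i ∉ A.map fun e => e.2.1 := List.count_eq_zero.1 (by omega)
        have hB : i ∉ B.map fun e => e.2.1 := List.count_eq_zero.1 (by omega)
        have := h.flip A B j i
        -- The list with $x_i$ in place of $x_i^{-1}$ has smaller weight, and `A ++ B` does not
        -- contain $x_i$.
        rw [dropVar_eq_self hA, dropVar_eq_self hB, ih (A ++ (j, i, true) :: B),
          h.eq_zero_of_not_mem (i := i) (by simp only [List.map_append, List.mem_append]; tauto),
          add_zero] at this
        · exact this.symm
        · simp [weight] at hL ⊢
          omega
    · push Not at hc
      obtain ⟨i, hi⟩ := hc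
      by_cases hm : i ∈ L.map fun e => e.2.1
      · obtain ⟨⟨j, i, b⟩, he, rfl⟩ := List.mem_map.1 hm
        obtain ⟨A, B, rfl⟩ := List.append_of_mem he
        have hsA := List.filter_sublist (l := A) (p := fun e => e.2.1 ≠ i)
        have hsB := List.filter_sublist (l := B) (p := fun e => e.2.1 ≠ i)
        have cA := hsA.countP_le (p := fun e => !e.2.2)
        have cB := hsB.countP_le (p := fun e => !e.2.2)
        -- A second occurrence of $x_i$ lies in `A` or `B`, so the term of `split` that keeps the
        -- displayed letter still loses at least one letter.
        have hlt : ((A ++ B).filter fun e => e.2.1 ≠ i).length < (A ++ B).length := by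
          rw [List.length_filter_lt_length_iff_exists]
          have : i ∈ (A ++ B).map fun e => e.2.1 := by
            rw [← List.count_pos_iff]
            simp only [List.map_append, List.map_cons, List.count_append,
              List.count_cons_self] at hi ⊢
            omega
          obtain ⟨e, he, hei⟩ := List.mem_map.1 this
          exact ⟨e, he, by simp [hei]⟩
        rw [List.filter_append, List.length_append, List.length_append] at hlt
        rw [h.split A B j i b, ih, ih, add_zero]
        · simp only [weight, dropVar, List.length_append, List.length_cons, List.countP_append,
            List.countP_cons] at hL ⊢
          omega
        · simp only [weight, List.length_append, List.length_cons, List.countP_append,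
            List.countP_cons] at hL ⊢
          omega
      · exact h.eq_zero_of_not_mem hm

/-- A primitive function that vanishes at the tuples of words in which each variable occurs
exactly once is zero. -/
lemma IsPrimFun.eq_zero (h : IsPrimFun Θ)
    (h1 : ∀ w : Fin l → FreeMonoid (Fin n), deg w = (fun _ => 1) →
      Θ (fun j => FreeMonoid.lift FreeGroup.of (w j)) = 0) (u : Fin l → FreeGroup (Fin n)) :
    Θ u = 0 := by
  obtain ⟨L, rfl⟩ := exists_tupProd u
  exact h.tupProd_eq_zero h1 _ L le_rfl

end Uniqueness

/-! ### Natural transformations and primitive elements -/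

section Representability
variable {k : Type u} [CommRing k] {n : ℕ}

lemma xTensor_eq_wordTensor :
    (xTensor k n).1 = wordTensor k n n (FreeMonoid.of : Fin n → FreeMonoid (Fin n)) := by
  change TPow.tprod k _ = TPow.tprod k _
  simp [word]

/-- By `act_wordHom` the spanning tensors are images of $x_1 \otimes \cdots \otimes x_n$ under
morphisms of `GrOp`, so this is induction over a module generated by one element. -/
lemma multilin_induction {m : ℕ} {p : multilin k n m → Prop}
    (word : ∀ w : Fin m → FreeMonoid (Fin n), deg w = (fun _ => 1) →
      p (leftAct k n (wordHom w) (xTensor k n)))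
    (zero : p 0) (add : ∀ s t, p s → p t → p (s + t)) (smul : ∀ (c : k) s, p s → p (c • s))
    (t : multilin k n m) : p t := by
  obtain ⟨t, ht⟩ := t
  induction ht using Submodule.span_induction with
  | mem t ht =>
    obtain ⟨w, hw, rfl⟩ := ht
    have := word w hw
    rwa [show leftAct k n (wordHom w) (xTensor k n) = ⟨wordTensor k n m w, _⟩ from
      Subtype.ext (act_wordHom w hw)] at this
  | zero => exact zero
  | add s t _ _ hs ht => exact add _ _ hs ht
  | smul c s _ hs => exact smul c _ hs

/-- A primitive element determines the action of all morphisms on it through the multilinear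
tensors. -/
lemma ap_eq_extMap_act (F : GrOp ⥤ ModuleCat.{u} k) {v : F.obj ⟨n⟩} (hv : ∀ i, IsPrimAt F i v)
    {l : ℕ} (σ : FreeGroup (Fin l) →* FreeGroup (Fin n)) :
    ap F σ v = extMap F n l (leftAct k n σ (xTensor k n)).1 v := by
  set Θ : (Fin l → FreeGroup (Fin n)) → F.obj ⟨l⟩ := fun u =>
    ap F (FreeGroup.lift u) v - extMap F n l (leftAct k n (FreeGroup.lift u) (xTensor k n)).1 v
    with hΘ
  have hlift : ∀ (g : FreeGroup (Option (Fin n)) →* FreeGroup (Fin n))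
      (u : Fin l → FreeGroup (Option (Fin n))),
      FreeGroup.lift (g.compLeft (Fin l) u) = g.comp (FreeGroup.lift u) := fun g u =>
    FreeGroup.ext_hom _ _ fun j => by simp
  -- The first term of `Θ` is additive because `v` is primitive, the second because $x_1 \otimes
  -- \cdots \otimes x_n$ is.
  have hprim : IsPrimFun Θ := fun i u => by
    have hx : leftAct k n ((dbl i).comp (FreeGroup.lift u)) (xTensor k n) =
        leftAct k n (fst.comp (FreeGroup.lift u)) (xTensor k n) +
          leftAct k n ((snd i).comp (FreeGroup.lift u)) (xTensor k n) :=
      xTensor_isPrimAt i l (FreeGroup.lift u)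
    simp only [hΘ, hlift]
    rw [hv i l (FreeGroup.lift u), hx, Submodule.coe_add, map_add, LinearMap.add_apply]
    abel
  -- At a multilinear tuple of words the second term is, by `act_wordHom`, the action of that very
  -- tuple, so the two terms cancel.
  have h := hprim.eq_zero (fun w hw => by
    have e : (leftAct k n (FreeGroup.lift fun j => FreeMonoid.lift FreeGroup.of (w j))
        (xTensor k n)).1 = wordTensor k n l w := act_wordHom w hw
    simp only [hΘ]
    rw [e, extMap_wordTensor, sub_self]) fun j => σ (FreeGroup.of j)
  have e : FreeGroup.lift (fun j => σ (FreeGroup.of j)) = σ :=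
    FreeGroup.ext_hom _ _ fun j => by simp
  simp only [hΘ, e] at h
  exact sub_eq_zero.1 h

/-- This is the naturality needed for `ofPrim`. For `t` the image of $x_1 \otimes \cdots \otimes
x_n$ under a morphism, both sides are the action on `v` of that morphism followed by `ρ`, by
`ap_eq_extMap_act`; linearity gives the rest. -/
lemma extMap_leftAct (F : GrOp ⥤ ModuleCat.{u} k) {v : F.obj ⟨n⟩} (hv : ∀ i, IsPrimAt F i v)
    {m l : ℕ} (ρ : FreeGroup (Fin l) →* FreeGroup (Fin m)) (t : multilin k n m) :
    extMap F n l (leftAct k n ρ t).1 v = ap F ρ (extMap F n m t.1 v) := by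
  induction t using multilin_induction with
  | word w hw =>
    have e : leftAct k n ρ (leftAct k n (wordHom w) (xTensor k n)) =
        leftAct k n (MonoidHom.comp (wordHom w) ρ) (xTensor k n) :=
      Subtype.ext (LinearMap.congr_fun (TPow.act_comp (wordHom w) ρ) (xTensor k n).1).symm
    rw [e, ← ap_eq_extMap_act F hv, ← ap_eq_extMap_act F hv, ap_ap]
  | zero => rw [map_zero, ZeroMemClass.coe_zero, ZeroMemClass.coe_zero, map_zero, map_zero,
      LinearMap.zero_apply, LinearMap.zero_apply, map_zero]
  | add s t hs ht => rw [map_add, Submodule.coe_add, Submodule.coe_add, map_add, map_add,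
      LinearMap.add_apply, LinearMap.add_apply, map_add, hs, ht]
  | smul c s hs => rw [map_smul, Submodule.coe_smul, Submodule.coe_smul, map_smul, map_smul,
      LinearMap.smul_apply, LinearMap.smul_apply, map_smul, hs]

/-- The natural transformation determined by a primitive element. -/
def ofPrim (F : GrOp ⥤ ModuleCat.{u} k) (v : primPart F n) : catAss k n ⟶ F where
  app m := ModuleCat.ofHom ((extMap F n m.rank).flip v.1 ∘ₗ (multilin k n m.rank).subtype)
  naturality _ _ ρ := ModuleCat.hom_ext (LinearMap.ext fun t =>
    extMap_leftAct F ((mem_primPart F n v.1).1 v.2) ρ t)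

lemma extMap_xTensor (F : GrOp ⥤ ModuleCat.{u} k) (v : F.obj ⟨n⟩) :
    extMap F n n (xTensor k n).1 v = v := by
  rw [xTensor_eq_wordTensor, extMap_wordTensor]
  simp only [FreeMonoid.lift_eval_of]
  have e : (FreeGroup.lift fun j => FreeGroup.of j) = MonoidHom.id (FreeGroup (Fin n)) :=
    FreeGroup.ext_hom _ _ fun j => by simp
  rw [e]
  exact LinearMap.congr_fun (congrArg ModuleCat.Hom.hom (F.map_id ⟨n⟩)) v

lemma app_xTensor_mem {F : GrOp ⥤ ModuleCat.{u} k} (ξ : catAss k n ⟶ F) :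
    (ξ.app ⟨n⟩).hom (xTensor k n) ∈ primPart F n :=
  app_mem_primPart ξ ((mem_primPart (catAss k n) n _).2 xTensor_isPrimAt)

/-- A natural transformation is determined by its value at `x_1 ⊗ ⋯ ⊗ x_n`. -/
lemma app_eq_extMap {F : GrOp ⥤ ModuleCat.{u} k} (ξ : catAss k n ⟶ F) {m : ℕ}
    (t : multilin k n m) :
    (ξ.app ⟨m⟩).hom t = extMap F n m t.1 ((ξ.app ⟨n⟩).hom (xTensor k n)) := by
  have hξ := (mem_primPart F n _).1 (app_xTensor_mem ξ)
  induction t using multilin_induction with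
  | word w hw =>
    rw [← ap_eq_extMap_act F hξ]
    exact LinearMap.congr_fun (congrArg ModuleCat.Hom.hom (ξ.naturality (wordHom w)))
      (xTensor k n)
  | zero => rw [ZeroMemClass.coe_zero, map_zero, LinearMap.zero_apply]; exact map_zero _
  | add s t hs ht =>
    rw [Submodule.coe_add, map_add, LinearMap.add_apply, ← hs, ← ht]; exact map_add _ _ _
  | smul c s hs =>
    rw [Submodule.coe_smul, map_smul, LinearMap.smul_apply, ← hs]; exact map_smul _ _ _

/-- Natural transformations correspond to primitive elements, by evaluation at
`x_1 ⊗ ⋯ ⊗ x_n`. -/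
def evalEquiv (F : GrOp ⥤ ModuleCat.{u} k) (n : ℕ) : (catAss k n ⟶ F) ≃ₗ[k] primPart F n where
  toFun ξ := ⟨(ξ.app ⟨n⟩).hom (xTensor k n), app_xTensor_mem ξ⟩
  map_add' _ _ := rfl
  map_smul' _ _ := rfl
  invFun := ofPrim F
  left_inv ξ := NatTrans.ext (funext fun _ => ModuleCat.hom_ext (LinearMap.ext fun t =>
    (app_eq_extMap ξ t).symm))
  right_inv v := Subtype.ext (extMap_xTensor F v.1)

/-- Substituting in the variables themselves returns what is substituted. Hence a morphism of the
Lie category acts on the generator by its own image under `toAlgT`, which links the right action on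
the bimodule to the action on primitive parts. -/
lemma algSubst_xTensor {m : ℕ} (s : TPow k (Alg k n) m) : algSubst n m m s (xTensor k m) = s := by
  have : (algSubst n m m).flip (xTensor k m) = LinearMap.id :=
    TPow.lin_ext fun P => by
      rw [LinearMap.flip_apply, algSubst_tprod]
      change TPow.map m _ (TPow.tprod k _) = _
      rw [map_tprod]
      simp [algSub]
  exact LinearMap.congr_fun this s

/-- Evaluation at `x_1 ⊗ ⋯ ⊗ x_n` is natural with respect to the Lie category. -/
lemma evalEquiv_rightAct (F : GrOp ⥤ ModuleCat.{u} k) {n m : CatLie k} (a : n ⟶ m)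
    (ξ : catAss k n.rank ⟶ F) :
    (ξ.app ⟨m.rank⟩).hom (rightAct n.rank m.rank m.rank a (xTensor k m.rank)) =
      extMap F n.rank m.rank (toAlgT k n.rank m.rank a)
        ((ξ.app ⟨n.rank⟩).hom (xTensor k n.rank)) := by
  rw [app_eq_extMap]
  congr 2
  exact algSubst_xTensor _

variable (k) in
/-- The bimodule of multilinear tensors represents the functor of primitive elements. -/
def primIso : natFunctor k ≅ primFunctor k :=
  NatIso.ofComponents (fun F => (linearFunctors k).isoMk
    (NatIso.ofComponents (F := natObj F) (G := primObj F)
      (fun n => (evalEquiv F n.rank).toModuleIso)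
      fun a => ModuleCat.hom_ext (LinearMap.ext fun ξ =>
        Subtype.ext (evalEquiv_rightAct F a ξ))))
    -- Naturality in `F` is immediate: evaluating a composite at $x_1 \otimes \cdots \otimes x_n$
    -- applies the second transformation to the value of the first.
    fun _ => rfl

end Representability

end PrimPart

end

/-- An isomorphism of functors with values in `LieMod` contains at once the bijectivity, the
linearity and the naturality in both variables, and its target forces the values to be primitive.
The formula for `Φ` identifies it as the evaluation map. -/
theorem theorem202212160932 (k : Type u) [CommRing k] :
    ∃ Φ : PrimPart.natFunctor k ≅ PrimPart.primFunctor k,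
      ∀ (F : PrimPart.GrOp ⥤ ModuleCat.{u} k) (n : ℕ)
        (ξ : (PrimPart.catAssBimod k).obj (Opposite.op ⟨n⟩) ⟶ F),
        (((Φ.hom.app F).hom.app ⟨n⟩).hom ξ).val = (ξ.app ⟨n⟩).hom (PrimPart.xTensor k n) :=
  ⟨PrimPart.primIso k, fun _ _ _ => rfl⟩
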